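/- **The model.** Let $\alpha\in(0,1)$, $\beta\in(0,1-\alpha)$, $p\in(0,1]$ and let $m,n\ge 1$ be integers. Let $S$ be the unit hypercube in $\mathbb R^m$ with the torus metric $d(x,y)=\min\{\|x-y+u\|_\infty : u\in\{-1,0,1\}^m\}$ (opposite faces are identified). Consider the following Markov chain. A state consists of $n$ nodes, each identified with a point of $S$, a ranking of the nodes (a bijection $r$ from the nodes onto $\{1,\dots,n\}$, rank $1$ being the highest), and an undirected simple graph on the nodes. The influence region of a node $u$ of rank $r(u)$ is the ball around $u$ of volume $r(u)^{-\alpha}n^{-\beta}$. One time step consists of the following, where all random choices are independent: 1. a new node $v$ is born at a uniformly random point of $S$, and for each existing node $u$ such that $v$ lies in the influence region of $u$, the edge $vu$ is created with probability $p$, independently; 2. one of the $n$ old nodes, chosen uniformly at random, is deleted with all its edges; 3. the new node $v$ obtains an initial rank $R$ chosen uniformly at random from $\{1,\dots,n\}$; 4. the ranks of the remaining old nodes are updated: a node of rank $r$ gets rank $r+\delta-\gamma$, where $\gamma=1$ if the deleted node had rank smaller than $r$ and $\gamma=0$ otherwise, and $\delta=1$ if $r-\gamma\ge R$ and $\delta=0$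 otherwise. **Theorem 3.1.** For all $m,n\ge1$ this chain has exactly one stationary distribution. The random graph in a state with this distribution is denoted GEO-P$(\alpha,\beta,m,p)$. For an integer $k$ let $N_{\ge k}$ be the number of its nodes of degree at least $k$. Then there are constants $C,c>0$ and $n_0$, depending only on $\alpha,\beta,p$, such that for all $m\ge1$, all $n\ge n_0$ and all integers $k$ with $$n^{1-\alpha-\beta}\log^{1/2}n\;\le\;k\;\le\;n^{1-\alpha/2-\beta}\log^{-2\alpha-1}n ,$$ with probability at least $1-\exp(-c\log^2 n)$, $$\left|\,N_{\ge k}-\frac{\alpha}{\alpha+1}\,p^{1/\alpha}n^{(1-\beta)/\alpha}k^{-1/\alpha}\right|\;\le\;C\log^{-1/3}n\cdot\frac{\alpha}{\alpha+1}\,p^{1/\alpha}n^{(1-\beta)/\alpha}k^{-1/\alpha}.$$ That is, with extreme probability $N_{\ge k}=\big(1+O(\log^{-1/3}n)\big)\frac{\alpha}{\alpha+1}p^{1/\alpha}n^{(1-\beta)/\alpha}k^{-1/\alpha}$. -/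

import Mathlib

open MeasureTheory ProbabilityTheory

namespace GeoP

/-- The unit hypercube in dimension `m` with opposite faces identified. Its distance is the
maximum over the coordinates of the distance on the circle `ℝ / ℤ`, which is the torus metric
`min {‖x - y + u‖_∞ : u ∈ {-1, 0, 1}^m}`, and `volume` on it is the uniform distribution. -/
abbrev Torus (m : ℕ) : Type := Fin m → UnitAddCircle

/-- A state of the process on `n` nodes. The nodes present at a given time are labelled by
`Fin n`. Ranks are shifted by one: the node `v` has rank `(rank v : ℕ) + 1 ∈ {1, …, n}`, and rank
`1` is the highest one. -/
structure State (n m : ℕ) where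
  /-- the point of the hypercube that is identified with a node -/
  pos : Fin n → Torus m
  /-- the ranking of the nodes, a bijection -/
  rank : Equiv.Perm (Fin n)
  /-- the current graph -/
  graph : SimpleGraph (Fin n)

instance (n m : ℕ) : MeasurableSpace (State n m) :=
  MeasurableSpace.comap (fun s => (s.pos, (s.rank : Fin n → Fin n), s.graph)) inferInstance

/-- The radius of the ball of volume `r ^ (-α) * n ^ (-β)` in the `m`-dimensional torus, where a
ball of radius `ρ ≤ 1 / 2` is a cube of side `2 * ρ`. -/
noncomputable def radius (α β : ℝ) (m n r : ℕ) : ℝ :=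
  ((r : ℝ) ^ (-α) * (n : ℝ) ^ (-β)) ^ (1 / (m : ℝ)) / 2

/-- The influence region of a node of rank `r` at the point `x`. -/
noncomputable def influenceRegion (α β : ℝ) {m : ℕ} (n : ℕ) (x : Torus m) (r : ℕ) :
    Set (Torus m) :=
  Metric.closedBall x (radius α β m n r)

/-- The influence region has the prescribed volume. -/
theorem volume_influenceRegion {α β : ℝ} (hα : 0 ≤ α) (hβ : 0 ≤ β) {m n r : ℕ} (hm : 1 ≤ m)
    (hn : 1 ≤ n) (hr : 1 ≤ r) (x : Torus m) :
    volume (influenceRegion α β n x r) = ENNReal.ofReal ((r : ℝ) ^ (-α) * (n : ℝ) ^ (-β)) := by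
  have hv0 : 0 ≤ (r : ℝ) ^ (-α) * (n : ℝ) ^ (-β) := by positivity
  have hv1 : (r : ℝ) ^ (-α) * (n : ℝ) ^ (-β) ≤ 1 := by
    have h1 : (r : ℝ) ^ (-α) ≤ 1 :=
      Real.rpow_le_one_of_one_le_of_nonpos (by exact_mod_cast hr) (by linarith)
    have h2 : (n : ℝ) ^ (-β) ≤ 1 :=
      Real.rpow_le_one_of_one_le_of_nonpos (by exact_mod_cast hn) (by linarith)
    exact mul_le_one₀ h1 (by positivity) h2
  have hs1 : ((r : ℝ) ^ (-α) * (n : ℝ) ^ (-β)) ^ (1 / (m : ℝ)) ≤ 1 :=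
    Real.rpow_le_one hv0 hv1 (by positivity)
  have hs0 : 0 ≤ ((r : ℝ) ^ (-α) * (n : ℝ) ^ (-β)) ^ (1 / (m : ℝ)) := Real.rpow_nonneg hv0 _
  have hm' : (m : ℝ) ≠ 0 := by exact_mod_cast (by omega : m ≠ 0)
  unfold influenceRegion radius
  rw [closedBall_pi _ (by linarith), volume_pi_pi]
  simp only [AddCircle.volume_closedBall]
  rw [Finset.prod_const, Finset.card_univ, Fintype.card_fin, min_eq_right (by linarith),
    ← ENNReal.ofReal_pow (by linarith), mul_div_cancel₀ _ (two_ne_zero), ← Real.rpow_natCast,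
    ← Real.rpow_mul hv0, one_div_mul_cancel hm', Real.rpow_one]

/-- How ranks change when the node of rank `d` is deleted and a node is inserted with rank `R`:
a remaining node of rank `x` moves to rank `x + δ - γ`, where `γ = 1` if `d < x` and `γ = 0`
otherwise (closing the gap), and then `δ = 1` if `R ≤ x - γ` and `δ = 0` otherwise (making room
for the new node). Position `d` itself, now held by the new node, is sent to `R`. -/
def moveRankVal {n : ℕ} (d R x : Fin n) : ℕ :=
  if x = d then R
  else
    let γ : ℕ := if d < x then 1 else 0
    let δ : ℕ := if (R : ℕ) ≤ x - γ then 1 else 0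
    x + δ - γ

theorem moveRankVal_lt {n : ℕ} (d R x : Fin n) : moveRankVal d R x < n := by
  have h1 := d.isLt
  have h2 := R.isLt
  have h3 := x.isLt
  simp only [moveRankVal, Fin.ext_iff, Fin.lt_def]
  split_ifs <;> omega

theorem moveRankVal_injective {n : ℕ} (d R : Fin n) : Function.Injective (moveRankVal d R) := by
  intro x y h
  simp only [moveRankVal, Fin.ext_iff, Fin.lt_def] at h ⊢
  split_ifs at h <;> omega

/-- The bijection of the ranks given by `moveRankVal`. -/
noncomputable def moveRank {n : ℕ} (d R : Fin n) : Equiv.Perm (Fin n) :=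
  Equiv.ofBijective (fun x => ⟨moveRankVal d R x, moveRankVal_lt d R x⟩)
    (Finite.injective_iff_bijective.mp fun _ _ h =>
      moveRankVal_injective d R (congrArg Fin.val h))

/-- The randomness used in one time step. -/
structure Noise (n m : ℕ) where
  /-- the point at which the new node is born -/
  pt : Torus m
  /-- the coins that decide about the possible edges at the new node -/
  coin : Fin n → Bool
  /-- the node that is deleted -/
  del : Fin n
  /-- the initial rank of the new node -/
  init : Fin n

instance (n m : ℕ) : MeasurableSpace (Noise n m) :=
  MeasurableSpace.comap (fun w => (w.pt, w.coin, w.del, w.init)) inferInstance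

/-- The law of the randomness of one step: a uniform point of the torus, independent coins that
show `true` with probability `p`, a uniform node and a uniform rank, all independent. -/
noncomputable def noiseLaw (p : unitInterval) (n m : ℕ) : Measure (Noise n m) :=
  ((volume : Measure (Torus m)).prod
    ((Measure.pi fun _ : Fin n => bernoulliMeasure true false p).prod
      ((uniformOn (Set.univ : Set (Fin n))).prod (uniformOn (Set.univ : Set (Fin n)))))).map
    fun w => ⟨w.1, w.2.1, w.2.2.1, w.2.2.2⟩

theorem isProbabilityMeasure_noiseLaw (p : unitInterval) {n : ℕ} (hn : 1 ≤ n) (m : ℕ) :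
    IsProbabilityMeasure (noiseLaw p n m) := by
  have : Nonempty (Fin n) := ⟨⟨0, hn⟩⟩
  have : IsProbabilityMeasure (volume : Measure UnitAddCircle) :=
    ⟨UnitAddCircle.measure_univ⟩
  have : IsProbabilityMeasure (uniformOn (Set.univ : Set (Fin n))) :=
    isProbabilityMeasure_uniformOn Set.finite_univ Set.univ_nonempty
  refine Measure.isProbabilityMeasure_map (Measurable.aemeasurable ?_)
  exact measurable_comap_iff.mpr measurable_id

/-- The new node is joined to the node `u` of the old graph: it lies in the influence region that
`u` had before the step, and the coin of `u` shows `true`. -/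
def Joined (α β : ℝ) {n m : ℕ} (s : State n m) (w : Noise n m) (u : Fin n) : Prop :=
  w.pt ∈ influenceRegion α β n (s.pos u) ((s.rank u : ℕ) + 1) ∧ w.coin u = true

/-- One time step. The node `w.del` is deleted together with its edges, and the new node takes
over its label. -/
noncomputable def step (α β : ℝ) {n m : ℕ} (s : State n m) (w : Noise n m) : State n m where
  pos := Function.update s.pos w.del w.pt
  rank := s.rank.trans (moveRank (s.rank w.del) w.init)
  graph :=
    { Adj := fun a b =>
        (a ≠ w.del ∧ b ≠ w.del ∧ s.graph.Adj a b) ∨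
        (a = w.del ∧ b ≠ w.del ∧ Joined α β s w b) ∨
        (a ≠ w.del ∧ b = w.del ∧ Joined α β s w a)
      symm := ⟨by
        rintro a b (⟨ha, hb, h⟩ | ⟨ha, hb, h⟩ | ⟨ha, hb, h⟩)
        · exact Or.inl ⟨hb, ha, h.symm⟩
        · exact Or.inr (Or.inr ⟨hb, ha, h⟩)
        · exact Or.inr (Or.inl ⟨hb, ha, h⟩)⟩
      loopless := ⟨by
        rintro a (⟨_, _, h⟩ | ⟨ha, hb, _⟩ | ⟨ha, hb, _⟩)
        · exact s.graph.loopless.irrefl a h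
        · exact hb ha
        · exact ha hb⟩ }

theorem measurable_step (α β : ℝ) (n m : ℕ) :
    Measurable fun x : State n m × Noise n m => step α β x.1 x.2 := by
  have hS : Measurable fun s : State n m => (s.pos, (s.rank : Fin n → Fin n), s.graph) :=
    comap_measurable _
  have hN : Measurable fun w : Noise n m => (w.pt, w.coin, w.del, w.init) := comap_measurable _
  have hpos : Measurable fun x : State n m × Noise n m => x.1.pos := hS.fst.comp measurable_fst
  have hrank : Measurable fun x : State n m × Noise n m => (x.1.rank : Fin n → Fin n) :=
    hS.snd.fst.comp measurable_fst
  have hgraph : Measurable fun x : State n m × Noise n m => x.1.graph :=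
    hS.snd.snd.comp measurable_fst
  have hpt : Measurable fun x : State n m × Noise n m => x.2.pt := hN.fst.comp measurable_snd
  have hcoin : Measurable fun x : State n m × Noise n m => x.2.coin :=
    hN.snd.fst.comp measurable_snd
  have hdel : Measurable fun x : State n m × Noise n m => x.2.del :=
    hN.snd.snd.fst.comp measurable_snd
  have hinit : Measurable fun x : State n m × Noise n m => x.2.init :=
    hN.snd.snd.snd.comp measurable_snd
  have hdelset (a : Fin n) : MeasurableSet {x : State n m × Noise n m | a = x.2.del} := by
    have := hdel (MeasurableSet.singleton a)
    convert this using 1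
    ext x
    exact eq_comm
  have hjoin (u : Fin n) :
      MeasurableSet {x : State n m × Noise n m | Joined α β x.1 x.2 u} := by
    refine MeasurableSet.inter ?_ ?_
    · have h1 : Measurable fun x : State n m × Noise n m => dist x.2.pt (x.1.pos u) :=
        hpt.dist ((measurable_pi_apply u).comp hpos)
      have h2 : Measurable fun x : State n m × Noise n m =>
          radius α β m n ((x.1.rank u : ℕ) + 1) :=
        (measurable_of_countable fun r : Fin n => radius α β m n ((r : ℕ) + 1)).comp
          ((measurable_pi_apply u).comp hrank)
      exact measurableSet_le h1 h2
    · exact ((measurable_pi_apply u).comp hcoin) (MeasurableSet.singleton true)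
  refine Measurable.of_comap_le ?_
  change MeasurableSpace.comap _ (MeasurableSpace.comap _ _) ≤ _
  rw [MeasurableSpace.comap_comp]
  refine Measurable.comap_le ?_
  refine Measurable.prodMk ?_ (Measurable.prodMk ?_ ?_)
  · refine measurable_pi_lambda _ fun a => ?_
    have : (fun x : State n m × Noise n m => (step α β x.1 x.2).pos a) =
        fun x => if a = x.2.del then x.2.pt else x.1.pos a := by
      funext x
      by_cases h : a = x.2.del
      · simp [step, h]
      · simp [step, h]
    change Measurable (fun x : State n m × Noise n m => (step α β x.1 x.2).pos a)
    rw [this]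
    exact Measurable.ite (hdelset a) hpt ((measurable_pi_apply a).comp hpos)
  · have : Measurable fun y : (Fin n → Fin n) × Fin n × Fin n =>
        fun a => moveRank (y.1 y.2.1) y.2.2 (y.1 a) := measurable_of_countable _
    exact this.comp (hrank.prodMk (hdel.prodMk hinit))
  · refine measurable_comap_iff.mpr ?_
    refine measurable_pi_lambda _ fun a => measurable_pi_lambda _ fun b => ?_
    have hadj : MeasurableSet {x : State n m × Noise n m | x.1.graph.Adj a b} := by
      have h0 : Measurable (SimpleGraph.Adj : SimpleGraph (Fin n) → Fin n → Fin n → Prop) :=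
        comap_measurable _
      exact measurableSet_setOfPred.mpr
        ((measurable_pi_apply b).comp ((measurable_pi_apply a).comp (h0.comp hgraph)))
    refine measurableSet_setOfPred.mp ?_
    exact (((hdelset a).compl.inter ((hdelset b).compl.inter hadj)).union
      (((hdelset a).inter ((hdelset b).compl.inter (hjoin b))).union
        ((hdelset a).compl.inter ((hdelset b).inter (hjoin a)))))

/-- `π` is a stationary distribution of the Markov chain: if the state has law `π` and the
randomness of a step is independent of it, the next state has law `π`. The graph of a state with
this law is the geo-protean graph. -/
def IsStationary (α β : ℝ) (p : unitInterval) {n m : ℕ} (π : Measure (State n m)) : Prop :=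
  IsProbabilityMeasure π ∧ (π.prod (noiseLaw p n m)).map (fun x => step α β x.1 x.2) = π

open scoped Classical in
/-- The number of nodes of degree at least `k`. -/
noncomputable def numDegreeGE {n : ℕ} (G : SimpleGraph (Fin n)) (k : ℕ) : ℕ :=
  (Finset.univ.filter fun v => k ≤ G.degree v).card

end GeoP

/-! Existence and uniqueness. If the labels are deleted in the order 0, 1, ..., n-1 and every new
node receives the last rank, nothing is left of the initial state after n steps
(`run_eq_of_mem_sequentialPaths`). Hence the n-step kernel dominates a nonzero measure that does not
depend on the start, and an invariant law must be the sum of an explicit series with geometrically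
decreasing masses (`existsUnique_invariant_of_minorized`).

Degrees. Put L = log n and η = L^(-1/3). A stationary probability is at most the supremum over all
starting states of the probability after T = ⌈n L²⌉ steps (`measure_le_of_isStationary`). By then
every node has been replaced, up to a coupon collector error (`seqLaw_notReplaced_le`). The ranks
depend only on the deletions and the initial ranks, not on the births. The rank of a surviving node
is an almost driftless walk with steps in {-1, 0, 1}, so it stays within Δ = 6 √n L² of its initial
value R (`rankLaw_rankMoves_le`). Given the deletions and the initial ranks, the births are i.i.d.,
and once the birth of a node is fixed its degree is a sum of independent indicators. If a nodes are
younger, they contribute about a p R^(-α) n^(-β) to the mean; the older ones contribute at most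
n^(1-α-β) / (1-α) ≤ η k. With x defined by k x^α = p n^(1-β), having degree at least k therefore
amounts to R ≤ x (a/n)^(1/α), up to an error O(η x) in the threshold (`seqLaw_degree_deviation_le`).

Counting. The ages a take each value 0, ..., n-1 once, and given the deletions the initial ranks are
independent and uniform. The expected number of nodes below the threshold is thus close to x ∫₀¹
y^(1/α) dy = α/(α+1) x, and a Chernoff bound controls the fluctuations up to order √n L. All errors
are collected in `pathLaw_deviation_le`. The lower bound on k makes the older neighbours negligible
and gives x ≤ n; the upper bound gives x ≥ p^(1/α) √n L³, so that Δ and √n L are at most η x. -/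

namespace GeoP

/-! ### I.i.d. sequences -/

section Sequences

/-- The sequence that starts with `a` and continues with `w`. -/
def seqCons {X : Type*} (a : X) (w : ℕ → X) : ℕ → X := fun t => Nat.casesOn t a w

@[simp] theorem seqCons_zero {X : Type*} (a : X) (w : ℕ → X) : seqCons a w 0 = a := rfl

@[simp] theorem seqCons_succ {X : Type*} (a : X) (w : ℕ → X) (t : ℕ) :
    seqCons a w (t + 1) = w t := rfl

theorem measurable_seqCons {X : Type*} [MeasurableSpace X] :
    Measurable fun x : X × (ℕ → X) => seqCons x.1 x.2 := by
  refine measurable_pi_lambda _ fun t => ?_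
  cases t with
  | zero => exact measurable_fst
  | succ t => exact (measurable_pi_apply t).comp measurable_snd

/-- The law of an i.i.d. sequence. -/
noncomputable def seqLaw {X : Type*} [MeasurableSpace X] (μ : Measure X) : Measure (ℕ → X) :=
  Measure.infinitePi fun _ : ℕ => μ

instance {X : Type*} [MeasurableSpace X] (μ : Measure X) [IsProbabilityMeasure μ] :
    IsProbabilityMeasure (seqLaw μ) := by unfold seqLaw; infer_instance

/-- Checked on cylinders, where the condition at time 0 splits off as a factor. This is the source
of every first-step decomposition below. -/
theorem map_seqCons {X : Type*} [MeasurableSpace X] (μ : Measure X) [IsProbabilityMeasure μ] :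
    (μ.prod (seqLaw μ)).map (fun x => seqCons x.1 x.2) = seqLaw μ := by
  refine Measure.eq_infinitePi _ fun s t ht => ?_
  classical
  rw [Measure.map_apply measurable_seqCons (MeasurableSet.pi s.countable_toSet fun i _ => ht i)]
  -- `Nat.pred` sends `0` to `0`, so `u` may contain `0` although `1 ∉ s`; the condition `i + 1 ∈ s`
  -- below makes such an index harmless.
  set u : Finset ℕ := s.image Nat.pred with hu
  have key : (fun x : X × (ℕ → X) => seqCons x.1 x.2) ⁻¹' (Set.pi s t) =
      (if 0 ∈ s then t 0 else Set.univ) ×ˢ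
        (Set.pi (u : Set ℕ) fun i => if i + 1 ∈ s then t (i + 1) else Set.univ) := by
    ext ⟨a, w⟩
    simp only [Set.mem_preimage, Set.mem_pi, Finset.mem_coe, Set.mem_prod]
    constructor
    · intro h
      refine ⟨?_, fun i _ => ?_⟩
      · split_ifs with h0
        · exact h 0 h0
        · trivial
      · split_ifs with h0
        · exact h (i + 1) h0
        · trivial
    · rintro ⟨h0, h1⟩ i hi
      cases i with
      | zero => simpa [hi] using h0
      | succ i =>
        have := h1 i (Finset.mem_image.mpr ⟨i + 1, hi, rfl⟩)
        simpa [hi] using this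
  rw [key, Measure.prod_prod, seqLaw, Measure.infinitePi_pi]
  swap
  · intro i _
    split_ifs
    · exact ht _
    · exact MeasurableSet.univ
  have h1 : ∏ i ∈ u, μ (if i + 1 ∈ s then t (i + 1) else Set.univ) =
      ∏ i ∈ s.erase 0, μ (t i) := by
    have h2 : s.erase 0 = (u.filter fun i => i + 1 ∈ s).image Nat.succ := by
      ext i
      cases i with
      | zero => simp
      | succ i =>
        simp only [Finset.mem_erase, hu, Finset.mem_image, Finset.mem_filter]
        constructor
        · rintro ⟨_, h⟩
          exact ⟨i, ⟨⟨i + 1, h, rfl⟩, h⟩, rfl⟩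
        · rintro ⟨j, ⟨_, h⟩, h'⟩
          obtain rfl : j = i := Nat.succ_injective h'
          exact ⟨Nat.succ_ne_zero _, h⟩
    rw [h2, Finset.prod_image (fun a _ b _ h => Nat.succ_injective h), Finset.prod_filter]
    refine Finset.prod_congr rfl fun i _ => ?_
    split_ifs <;> simp
  rw [h1]
  by_cases h0 : 0 ∈ s
  · rw [if_pos h0, Finset.mul_prod_erase s (fun i => μ (t i)) h0]
  · rw [if_neg h0, Finset.erase_eq_of_notMem h0]
    simp

theorem lintegral_seqLaw {X : Type*} [MeasurableSpace X] (μ : Measure X) [IsProbabilityMeasure μ]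
    {f : (ℕ → X) → ENNReal} (hf : Measurable f) :
    ∫⁻ w, f w ∂(seqLaw μ) = ∫⁻ a, ∫⁻ w, f (seqCons a w) ∂(seqLaw μ) ∂μ := by
  conv_lhs => rw [← map_seqCons μ]
  rw [lintegral_map hf measurable_seqCons, lintegral_prod]
  exact (hf.comp measurable_seqCons).aemeasurable

/-- Draws at distinct times are independent. The times will be the birth times of the nodes that are
present in the end. -/
theorem map_precomp_seqLaw {X ι : Type*} [MeasurableSpace X] [Fintype ι] (μ : Measure X)
    [IsProbabilityMeasure μ] {τ : ι → ℕ} (hτ : Function.Injective τ) :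
    (seqLaw μ).map (fun w i => w (τ i)) = Measure.pi fun _ : ι => μ := by
  classical
  refine (Measure.pi_eq fun s hs => ?_).symm
  have hm : Measurable fun (w : ℕ → X) i => w (τ i) :=
    measurable_pi_lambda _ fun i => measurable_pi_apply _
  rw [Measure.map_apply hm (MeasurableSet.univ_pi hs)]
  rcases isEmpty_or_nonempty ι with h | h
  · have : (fun (w : ℕ → X) i => w (τ i)) ⁻¹' (Set.pi Set.univ s) = Set.univ := by
      ext w; simp
    rw [this]; simp
  have : (fun (w : ℕ → X) i => w (τ i)) ⁻¹' (Set.pi Set.univ s) =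
      Set.pi ((Finset.univ.image τ : Finset ℕ) : Set ℕ) fun t => s (Function.invFun τ t) := by
    ext w
    simp [Set.mem_pi, Function.leftInverse_invFun hτ _]
  rw [this, seqLaw, Measure.infinitePi_pi _ (fun i _ => hs _),
    Finset.prod_image (fun a _ b _ h => hτ h)]
  exact Finset.prod_congr rfl fun i _ => by rw [Function.leftInverse_invFun hτ i]

end Sequences

/-! ### Chernoff bounds for sums of independent indicators -/

section Chernoff

variable {ι : Type*} [Fintype ι] {X : ι → Type*} [∀ i, MeasurableSpace (X i)]
  (μ : ∀ i, Measure (X i)) [∀ i, IsProbabilityMeasure (μ i)] {S : ∀ i, Set (X i)}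

theorem exp_indicator_eq {α : Type*} (S : Set α) (t : ℝ) (y : α) :
    Real.exp (t * S.indicator 1 y) = 1 + (Real.exp t - 1) * S.indicator 1 y := by
  by_cases h : y ∈ S <;> simp [h]

/-- The moment generating function factors by independence, and each factor `1 + (e ^ t - 1) q` is
at most `exp ((e ^ t - 1) q)`. -/
theorem mgf_sum_indicator_le (hS : ∀ i, MeasurableSet (S i)) (t : ℝ) :
    mgf (fun y => ∑ i, (S i).indicator (1 : X i → ℝ) (y i)) (Measure.pi μ) t ≤
      Real.exp ((Real.exp t - 1) * ∑ i, (μ i).real (S i)) := by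
  have h1 : mgf (fun y => ∑ i, (S i).indicator (1 : X i → ℝ) (y i)) (Measure.pi μ) t =
      ∏ i, ∫ y, Real.exp (t * (S i).indicator (1 : X i → ℝ) y) ∂(μ i) := by
    rw [← integral_fintype_prod_eq_prod (𝕜 := ℝ)
      (fun i y => Real.exp (t * (S i).indicator (1 : X i → ℝ) y))]
    simp only [mgf, Finset.mul_sum, Real.exp_sum]
  have h2 (i : ι) : ∫ y, Real.exp (t * (S i).indicator (1 : X i → ℝ) y) ∂(μ i) =
      1 + (Real.exp t - 1) * (μ i).real (S i) := by
    have hi : Integrable ((S i).indicator (1 : X i → ℝ)) (μ i) :=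
      (integrable_const (1 : ℝ)).indicator (hS i)
    simp only [exp_indicator_eq]
    rw [integral_add (integrable_const _) (hi.const_mul _), integral_const_mul,
      integral_indicator_one (hS i)]
    simp
  rw [h1, Finset.mul_sum, Real.exp_sum]
  refine Finset.prod_le_prod (fun i _ => integral_nonneg fun y => (Real.exp_pos _).le)
    fun i _ => ?_
  rw [h2, add_comm]
  exact Real.add_one_le_exp _

theorem integrable_exp_sum_indicator (hS : ∀ i, MeasurableSet (S i)) (t : ℝ) :
    Integrable (fun y : ∀ i, X i => Real.exp (t * ∑ i, (S i).indicator (1 : X i → ℝ) (y i)))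
      (Measure.pi μ) := by
  have hm : Measurable fun y : ∀ i, X i => ∑ i, (S i).indicator (1 : X i → ℝ) (y i) :=
    Finset.measurable_sum _ fun i _ =>
      ((measurable_const (a := (1 : ℝ))).indicator (hS i)).comp (measurable_pi_apply i)
  refine Integrable.of_bound (C := Real.exp (|t| * Fintype.card ι))
    (Real.measurable_exp.comp (hm.const_mul t)).aestronglyMeasurable (ae_of_all _ fun y => ?_)
  rw [Real.norm_eq_abs, Real.abs_exp, Real.exp_le_exp]
  refine (le_abs_self _).trans ?_
  rw [abs_mul]
  refine mul_le_mul_of_nonneg_left ((Finset.abs_sum_le_sum_abs _ _).trans ?_) (abs_nonneg t)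
  refine (Finset.sum_le_card_nsmul _ _ 1 fun i _ => ?_).trans (by simp)
  by_cases h : y i ∈ S i <;> simp [h]

theorem exp_le_one_add_add_sq {y : ℝ} (hy : |y| ≤ 1) : Real.exp y ≤ 1 + y + y ^ 2 := by
  linarith [(abs_le.mp (Real.abs_exp_sub_one_sub_id_le hy)).2]

/-- Upper tail of a sum of independent indicators. -/
theorem measureReal_sum_indicator_ge_le (hS : ∀ i, MeasurableSet (S i)) {M s l : ℝ}
    (hM : ∑ i, (μ i).real (S i) ≤ M) (hl0 : 0 ≤ l) (hl1 : l ≤ 1) :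
    (Measure.pi μ).real {y | M + s ≤ ∑ i, (S i).indicator (1 : X i → ℝ) (y i)} ≤
      Real.exp (-(l * s) + l ^ 2 * M) := by
  have hM0 : 0 ≤ M := (Finset.sum_nonneg fun i _ => measureReal_nonneg).trans hM
  refine (measure_ge_le_exp_mul_mgf (M + s) hl0 (integrable_exp_sum_indicator μ hS l)).trans ?_
  refine (mul_le_mul_of_nonneg_left (mgf_sum_indicator_le μ hS l) (Real.exp_pos _).le).trans ?_
  rw [← Real.exp_add, Real.exp_le_exp]
  have h1 : 1 ≤ Real.exp l := Real.one_le_exp hl0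
  -- The exponent is `-l (M + s) + (e ^ l - 1) M`, and `e ^ l - 1 ≤ l + l ^ 2` cancels the term `l
  -- M`.
  have h2 := exp_le_one_add_add_sq (abs_le.mpr ⟨by linarith, hl1⟩)
  have h3 := mul_le_mul_of_nonneg_left hM (sub_nonneg.mpr h1)
  nlinarith

/-- Lower tail of a sum of independent indicators. -/
theorem measureReal_sum_indicator_le_le (hS : ∀ i, MeasurableSet (S i)) {M s l : ℝ}
    (hM0 : 0 ≤ M) (hM : M ≤ ∑ i, (μ i).real (S i)) (hl0 : 0 ≤ l) (hl1 : l ≤ 1) :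
    (Measure.pi μ).real {y | ∑ i, (S i).indicator (1 : X i → ℝ) (y i) ≤ M - s} ≤
      Real.exp (-(l * s) + l ^ 2 * M) := by
  refine (measure_le_le_exp_mul_mgf (M - s) (neg_nonpos.mpr hl0)
    (integrable_exp_sum_indicator μ hS (-l))).trans ?_
  refine (mul_le_mul_of_nonneg_left (mgf_sum_indicator_le μ hS (-l)) (Real.exp_pos _).le).trans ?_
  rw [← Real.exp_add, Real.exp_le_exp]
  have h1 : Real.exp (-l) ≤ 1 := Real.exp_le_one_iff.mpr (by linarith)
  have h2 := exp_le_one_add_add_sq (y := -l) (by rw [abs_neg]; exact abs_le.mpr ⟨by linarith, hl1⟩)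
  have h3 := mul_le_mul_of_nonneg_left hM (sub_nonneg.mpr h1)
  nlinarith

/-- A bound for all values of one coordinate is a bound. -/
theorem pi_le_of_forall_insertNth_le {N : ℕ} {Y : Type*} [MeasurableSpace Y] (ν : Measure Y)
    [IsProbabilityMeasure ν] (i : Fin (N + 1)) {A : Set (Fin (N + 1) → Y)} (hA : MeasurableSet A)
    {b : ENNReal}
    (h : ∀ y : Y, (Measure.pi fun _ : Fin N => ν) {z | i.insertNth (α := fun _ => Y) y z ∈ A} ≤ b) :
    (Measure.pi fun _ : Fin (N + 1) => ν) A ≤ b := by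
  have hp := (measurePreserving_piFinSuccAbove (fun _ : Fin (N + 1) => ν) i).symm
  rw [← hp.measure_preimage hA.nullMeasurableSet,
    Measure.prod_apply (hp.measurable hA)]
  calc _ ≤ ∫⁻ _ : Y, b ∂ν := lintegral_mono fun y => h y
    _ = b := by simp

end Chernoff

/-! ### Invariant distributions under a minorization -/

section Invariant

variable {S : Type*} [MeasurableSpace S]

theorem bind_add_kernel {K B : Kernel S S} {N : Measure S} (hK : ∀ s, K s = N + B s)
    (μ : Measure S) {A : Set S} (hA : MeasurableSet A) :
    μ.bind K A = μ Set.univ * N A + μ.bind B A := by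
  rw [Measure.bind_apply hA K.measurable.aemeasurable,
    Measure.bind_apply hA B.measurable.aemeasurable]
  simp only [hK, Measure.add_apply]
  rw [lintegral_add_left measurable_const, lintegral_const, mul_comm]

/-- The measure that is obtained from `N` by `j` applications of `B`. -/
noncomputable def iterBind (B : Kernel S S) (N : Measure S) : ℕ → Measure S
  | 0 => N
  | j + 1 => (iterBind B N j).bind B

theorem iterBind_univ {B : Kernel S S} {r : ENNReal} (hr : ∀ s, B s Set.univ = r) (N : Measure S)
    (j : ℕ) : iterBind B N j Set.univ = N Set.univ * r ^ j := by
  induction j with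
  | zero => simp [iterBind]
  | succ j ih =>
    rw [iterBind, Measure.bind_apply MeasurableSet.univ B.measurable.aemeasurable]
    simp only [hr]
    rw [lintegral_const, ih, pow_succ]
    ring

/-- As `π` has mass one, invariance reads `π = N + π B`; this is inserted into itself `J` times. -/
theorem eq_sum_iterBind_add {K B : Kernel S S} {N π : Measure S} (hK : ∀ s, K s = N + B s)
    [IsProbabilityMeasure π] (hπ : π.bind K = π) (J : ℕ) {A : Set S} (hA : MeasurableSet A) :
    π A = ∑ j ∈ Finset.range J, iterBind B N j A + iterBind B π J A := by
  induction J generalizing A with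
  | zero => simp [iterBind]
  | succ J ih =>
    have h1 (A : Set S) (hA : MeasurableSet A) : π A = N A + π.bind B A := by
      conv_lhs => rw [← hπ]
      rw [bind_add_kernel hK π hA, measure_univ, one_mul]
    have h2 : π = N + π.bind B := Measure.ext fun A hA => by rw [h1 A hA, Measure.add_apply]
    have h3 (j : ℕ) : iterBind B π j = iterBind B N j + iterBind B π (j + 1) := by
      induction j with
      | zero => exact h2
      | succ j ih2 =>
        refine Measure.ext fun A hA => ?_
        change (iterBind B π j).bind B A =
          ((iterBind B N j).bind B + (iterBind B π (j + 1)).bind B) A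
        conv_lhs => rw [ih2]
        rw [Measure.add_apply, Measure.bind_apply hA B.measurable.aemeasurable,
          lintegral_add_measure, Measure.bind_apply hA B.measurable.aemeasurable,
          Measure.bind_apply hA B.measurable.aemeasurable]
    rw [ih hA, h3 J, Measure.add_apply, Finset.sum_range_succ, add_assoc]

/-- The remainder has mass `r ^ J → 0`. Hence an invariant distribution is determined by `N` and
`B`, which is uniqueness for `K`. -/
theorem eq_sum_iterBind {K B : Kernel S S} {N π : Measure S} (hK : ∀ s, K s = N + B s)
    {r : ENNReal} (hr : ∀ s, B s Set.univ = r) (hr1 : r < 1)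
    [IsProbabilityMeasure π] (hπ : π.bind K = π) : π = Measure.sum (iterBind B N) := by
  refine Measure.ext fun A hA => ?_
  rw [Measure.sum_apply _ hA]
  have h1 : Filter.Tendsto
      (fun J => ∑ j ∈ Finset.range J, iterBind B N j A + iterBind B π J A) Filter.atTop
      (nhds (∑' j, iterBind B N j A + 0)) := by
    refine ENNReal.summable.hasSum.tendsto_sum_nat.add ?_
    refine tendsto_of_tendsto_of_tendsto_of_le_of_le tendsto_const_nhds
      (ENNReal.tendsto_pow_atTop_nhds_zero_of_lt_one hr1) (fun _ => zero_le) fun J => ?_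
    refine (measure_mono (Set.subset_univ A)).trans ?_
    rw [iterBind_univ hr, measure_univ, one_mul]
  simp only [← eq_sum_iterBind_add hK hπ _ hA, add_zero] at h1
  exact tendsto_nhds_unique tendsto_const_nhds h1

/-- A Markov kernel has exactly one invariant distribution if a kernel `K` that commutes with it
(in applications one of its powers) dominates a nonzero measure `N` that does not depend on the
starting point. -/
theorem existsUnique_invariant_of_minorized [Nonempty S] {κ K B : Kernel S S} [IsMarkovKernel κ]
    [IsMarkovKernel K] {N : Measure S} (hK : ∀ s, K s = N + B s) (hN : N Set.univ ≠ 0)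
    (hcomm : ∀ μ : Measure S, (μ.bind κ).bind K = (μ.bind K).bind κ)
    (hinv : ∀ π : Measure S, π.bind κ = π → π.bind K = π) :
    ∃! π : Measure S, IsProbabilityMeasure π ∧ π.bind κ = π := by
  obtain ⟨s0⟩ := ‹Nonempty S›
  have hsum (s : S) : N Set.univ + B s Set.univ = 1 := by
    rw [← Measure.add_apply, ← hK, measure_univ]
  have hN1 : N Set.univ ≤ 1 := le_self_add.trans (hsum s0).le
  have hNt : N Set.univ ≠ ⊤ := ne_top_of_le_ne_top ENNReal.one_ne_top hN1
  set r : ENNReal := 1 - N Set.univ with hrdef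
  -- As `K` is Markov and `N` does not depend on `s`, all `B s` have the same mass.
  have hr (s : S) : B s Set.univ = r := by
    rw [hrdef, ← hsum s, ENNReal.add_sub_cancel_left hNt]
  have hr1 : r < 1 := ENNReal.sub_lt_self ENNReal.one_ne_top one_ne_zero hN
  set π := Measure.sum (iterBind B N) with hπdef
  have hprob : IsProbabilityMeasure π := by
    refine ⟨?_⟩
    rw [hπdef, Measure.sum_apply _ MeasurableSet.univ]
    simp only [iterBind_univ hr]
    rw [ENNReal.tsum_mul_left, ENNReal.tsum_geometric, hrdef,
      ENNReal.sub_sub_cancel ENNReal.one_ne_top hN1, ENNReal.mul_inv_cancel hN hNt]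
  have hπK : π.bind K = π := by
    refine Measure.ext fun A hA => ?_
    rw [bind_add_kernel hK π hA, measure_univ, one_mul,
      Measure.bind_apply hA B.measurable.aemeasurable, hπdef, lintegral_sum_measure,
      Measure.sum_apply _ hA,
      tsum_eq_zero_add' (f := fun j => iterBind B N j A) ENNReal.summable]
    simp only [iterBind]
    congr 1
    refine tsum_congr fun j => ?_
    rw [Measure.bind_apply hA B.measurable.aemeasurable]
  have hpκ : IsProbabilityMeasure (π.bind κ) := by
    refine ⟨?_⟩
    rw [Measure.bind_apply MeasurableSet.univ κ.measurable.aemeasurable]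
    simp
  refine ⟨π, ⟨hprob, ?_⟩, ?_⟩
  -- Since `κ` and `K` commute, `π.bind κ` is again invariant under `K`, so it equals `π`.
  · refine eq_sum_iterBind hK hr hr1 ?_
    rw [hcomm, hπK]
  · rintro ρ ⟨hρ, hρκ⟩
    exact eq_sum_iterBind hK hr hr1 (hinv ρ hρκ)

/-- The kernel that applies a random map. -/
noncomputable def randomMap {W : Type*} [MeasurableSpace W] (ν : Measure W) [SFinite ν]
    (f : S × W → S) : Kernel S S :=
  (Kernel.id ×ₖ Kernel.const S ν).map f

theorem randomMap_apply {W : Type*} [MeasurableSpace W] (ν : Measure W) [SFinite ν]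
    {f : S × W → S} (hf : Measurable f) (s : S) :
    randomMap ν f s = ν.map fun w => f (s, w) := by
  rw [randomMap, Kernel.map_apply _ hf, Kernel.prod_apply, Kernel.id_apply, Kernel.const_apply,
    Measure.dirac_prod, Measure.map_map hf measurable_prodMk_left]
  rfl

theorem bind_randomMap {W : Type*} [MeasurableSpace W] (ν : Measure W) [SFinite ν]
    {f : S × W → S} (hf : Measurable f) (μ : Measure S) [SFinite μ] :
    μ.bind (randomMap ν f) = (μ.prod ν).map f := by
  refine Measure.ext fun A hA => ?_
  rw [Measure.bind_apply hA (Kernel.measurable _).aemeasurable, Measure.map_apply hf hA,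
    Measure.prod_apply (hf hA)]
  refine lintegral_congr fun s => ?_
  rw [randomMap_apply ν hf]
  exact Measure.map_apply (hf.comp measurable_prodMk_left) hA

end Invariant

/-! ### The chain driven by i.i.d. noise -/

section Chain

/-- First-step decompositions of two independent factors combine, by Tonelli, to one of their
product. It keeps births, deletions and initial ranks as separate sequences, so that they can be
conditioned on separately. -/
theorem lintegral_prod_of_decomp {V W A C : Type*} [MeasurableSpace V] [MeasurableSpace W]
    [MeasurableSpace A] [MeasurableSpace C] {M : Measure W} {N : Measure V} {μ : Measure A}
    {θ : Measure C} [SFinite M] [SFinite N] [SFinite μ] [SFinite θ]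
    {g : A → W → W} {h : C → V → V}
    (hg : Measurable fun x : A × W => g x.1 x.2) (hh : Measurable fun x : C × V => h x.1 x.2)
    (hM : ∀ f : W → ENNReal, Measurable f → ∫⁻ w, f w ∂M = ∫⁻ a, ∫⁻ w, f (g a w) ∂M ∂μ)
    (hN : ∀ f : V → ENNReal, Measurable f → ∫⁻ v, f v ∂N = ∫⁻ c, ∫⁻ v, f (h c v) ∂N ∂θ)
    {f : W × V → ENNReal} (hf : Measurable f) :
    ∫⁻ x, f x ∂(M.prod N) =
      ∫⁻ y, ∫⁻ x, f (g y.1 x.1, h y.2 x.2) ∂(M.prod N) ∂(μ.prod θ) := by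
  have hF : Measurable fun z : (A × C) × (W × V) => f (g z.1.1 z.2.1, h z.1.2 z.2.2) :=
    hf.comp ((hg.comp (measurable_fst.fst.prodMk measurable_snd.fst)).prodMk
      (hh.comp (measurable_fst.snd.prodMk measurable_snd.snd)))
  have hfg : Measurable fun z : A × W × V => f (g z.1 z.2.1, z.2.2) :=
    hf.comp ((hg.comp (measurable_fst.prodMk measurable_snd.fst)).prodMk measurable_snd.snd)
  have h1 (a : A) (c : C) : Measurable fun x : W × V => f (g a x.1, h c x.2) :=
    hF.comp (measurable_prodMk_left (x := (a, c)))
  have h2 (a : A) (w : W) : Measurable fun v : V => f (g a w, v) :=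
    hf.comp measurable_prodMk_left
  have h3 (a : A) (w : W) : Measurable fun z : C × V => f (g a w, h z.1 z.2) :=
    hf.comp (measurable_const.prodMk hh)
  rw [lintegral_prod _ hf.aemeasurable, hM _ hf.lintegral_prod_right',
    lintegral_prod _ (hF.lintegral_prod_right').aemeasurable]
  refine lintegral_congr fun a => ?_
  have h4 (w : W) : ∫⁻ v, f (g a w, v) ∂N = ∫⁻ c, ∫⁻ v, f (g a w, h c v) ∂N ∂θ :=
    hN _ (h2 a w)
  simp only [h4]
  rw [lintegral_lintegral_swap]
  · refine lintegral_congr fun c => ?_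
    rw [lintegral_prod _ (h1 a c).aemeasurable]
  · have : Measurable fun z : (W × C) × V => f (g a z.1.1, h z.1.2 z.2) :=
      hF.comp ((measurable_const.prodMk measurable_fst.snd).prodMk
        (measurable_fst.fst.prodMk measurable_snd))
    exact this.lintegral_prod_right'.aemeasurable

/-- The uniform distribution on the labels. -/
noncomputable abbrev unif (n : ℕ) : Measure (Fin n) := uniformOn (Set.univ : Set (Fin n))

/-- The point and the coins of a step. -/
abbrev Birth (n m : ℕ) : Type := Torus m × (Fin n → Bool)

/-- The randomness of all steps: points and coins, deleted nodes, initial ranks. -/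
abbrev Path (n m : ℕ) : Type := (ℕ → Birth n m) × (ℕ → Fin n) × (ℕ → Fin n)

instance isProbabilityMeasure_circle : IsProbabilityMeasure (volume : Measure UnitAddCircle) :=
  ⟨UnitAddCircle.measure_univ⟩

/-- The law of the point and the coins of a step. -/
noncomputable def birthLaw (p : unitInterval) (n m : ℕ) : Measure (Birth n m) :=
  (volume : Measure (Torus m)).prod (Measure.pi fun _ : Fin n => bernoulliMeasure true false p)

instance (p : unitInterval) (n m : ℕ) : IsProbabilityMeasure (birthLaw p n m) := by
  unfold birthLaw; infer_instance

/-- The law of the randomness of all steps. -/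
noncomputable def pathLaw (p : unitInterval) (n m : ℕ) : Measure (Path n m) :=
  (seqLaw (birthLaw p n m)).prod ((seqLaw (unif n)).prod (seqLaw (unif n)))

instance (p : unitInterval) (n m : ℕ) [NeZero n] : IsProbabilityMeasure (pathLaw p n m) := by
  unfold pathLaw; infer_instance

/-- The randomness of a step, assembled from its parts. -/
def mkNoise {n m : ℕ} (b : Birth n m) (d r : Fin n) : Noise n m := ⟨b.1, b.2, d, r⟩

theorem measurable_mkNoise (n m : ℕ) :
    Measurable fun x : Birth n m × Fin n × Fin n => mkNoise x.1 x.2.1 x.2.2 := by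
  refine measurable_comap_iff.mpr ?_
  exact measurable_fst.fst.prodMk (measurable_fst.snd.prodMk
    (measurable_snd.fst.prodMk measurable_snd.snd))

theorem noiseLaw_eq_map (p : unitInterval) (n m : ℕ) [NeZero n] :
    noiseLaw p n m = ((birthLaw p n m).prod ((unif n).prod (unif n))).map
      fun x => mkNoise x.1 x.2.1 x.2.2 := by
  unfold noiseLaw birthLaw
  rw [← Measure.prodAssoc_prod, Measure.map_map _ (MeasurableEquiv.measurable _)]
  · rfl
  · exact measurable_comap_iff.mpr measurable_id

instance (p : unitInterval) (n m : ℕ) [NeZero n] : IsProbabilityMeasure (noiseLaw p n m) :=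
  isProbabilityMeasure_noiseLaw p (NeZero.one_le) m

theorem lintegral_pathLaw (p : unitInterval) (n m : ℕ) [NeZero n] {f : Path n m → ENNReal}
    (hf : Measurable f) :
    ∫⁻ ω, f ω ∂(pathLaw p n m) =
      ∫⁻ x, ∫⁻ ω, f (seqCons x.1 ω.1, seqCons x.2.1 ω.2.1, seqCons x.2.2 ω.2.2) ∂(pathLaw p n m)
        ∂((birthLaw p n m).prod ((unif n).prod (unif n))) := by
  unfold pathLaw
  refine lintegral_prod_of_decomp (g := seqCons)
    (h := fun (c : Fin n × Fin n) (v : (ℕ → Fin n) × (ℕ → Fin n)) =>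
      (seqCons c.1 v.1, seqCons c.2 v.2)) measurable_seqCons ?_
    (fun f hf => lintegral_seqLaw _ hf) (fun f hf => ?_) hf
  · exact (measurable_seqCons.comp (measurable_fst.fst.prodMk measurable_snd.fst)).prodMk
      (measurable_seqCons.comp (measurable_fst.snd.prodMk measurable_snd.snd))
  · exact lintegral_prod_of_decomp measurable_seqCons measurable_seqCons
      (fun f hf => lintegral_seqLaw _ hf) (fun f hf => lintegral_seqLaw _ hf) hf

/-- The state after `t` steps. -/
noncomputable def run (α β : ℝ) {n m : ℕ} (s : State n m) (ω : Path n m) : ℕ → State n m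
  | 0 => s
  | t + 1 => step α β (run α β s ω t) (mkNoise (ω.1 t) (ω.2.1 t) (ω.2.2 t))

/-- `run` adds steps at the end; recursions over the law of the path need the first step in front.
-/
theorem run_seqCons (α β : ℝ) {n m : ℕ} (s : State n m) (ω : Path n m)
    (x : Birth n m × Fin n × Fin n) (t : ℕ) :
    run α β s (seqCons x.1 ω.1, seqCons x.2.1 ω.2.1, seqCons x.2.2 ω.2.2) (t + 1) =
      run α β (step α β s (mkNoise x.1 x.2.1 x.2.2)) ω t := by
  induction t with
  | zero => rfl
  | succ t ih => rw [run, ih]; rfl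

theorem measurable_run (α β : ℝ) (n m t : ℕ) :
    Measurable fun x : State n m × Path n m => run α β x.1 x.2 t := by
  induction t with
  | zero => exact measurable_fst
  | succ t ih =>
    have h0 : Measurable fun x : State n m × Path n m => (x.2.1 t, x.2.2.1 t, x.2.2.2 t) :=
      ((measurable_pi_apply t).comp measurable_snd.fst).prodMk
        (((measurable_pi_apply t).comp measurable_snd.snd.fst).prodMk
          ((measurable_pi_apply t).comp measurable_snd.snd.snd))
    have h1 : Measurable fun x : State n m × Path n m =>
        mkNoise (x.2.1 t) (x.2.2.1 t) (x.2.2.2 t) := (measurable_mkNoise n m).comp h0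
    exact (measurable_step α β n m).comp (ih.prodMk h1)

theorem measurable_run_right (α β : ℝ) {n m : ℕ} (s : State n m) (t : ℕ) :
    Measurable fun ω : Path n m => run α β s ω t :=
  (measurable_run α β n m t).comp measurable_prodMk_left

theorem lintegral_run_succ (α β : ℝ) (p : unitInterval) {n m : ℕ} [NeZero n] (s : State n m)
    (t : ℕ) {f : State n m → ENNReal} (hf : Measurable f) :
    ∫⁻ ω, f (run α β s ω (t + 1)) ∂(pathLaw p n m) =
      ∫⁻ w, ∫⁻ ω, f (run α β (step α β s w) ω t) ∂(pathLaw p n m) ∂(noiseLaw p n m) := by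
  rw [lintegral_pathLaw p n m (f := fun ω => f (run α β s ω (t + 1)))
    (hf.comp (measurable_run_right α β s (t + 1))), noiseLaw_eq_map,
    lintegral_map _ (measurable_mkNoise n m)]
  · simp only [run_seqCons]
  · have h1 : Measurable fun z : Noise n m × Path n m => run α β (step α β s z.1) z.2 t :=
      (measurable_run α β n m t).comp
        (((measurable_step α β n m).comp (measurable_const.prodMk measurable_fst)).prodMk
          measurable_snd)
    exact (hf.comp h1).lintegral_prod_right'

/-- The transition kernel of `t` steps. -/
noncomputable def runKernel (α β : ℝ) (p : unitInterval) (n m : ℕ) [NeZero n] (t : ℕ) :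
    Kernel (State n m) (State n m) :=
  randomMap (pathLaw p n m) fun x => run α β x.1 x.2 t

/-- The transition kernel. -/
noncomputable def stepKernel (α β : ℝ) (p : unitInterval) (n m : ℕ) [NeZero n] :
    Kernel (State n m) (State n m) :=
  randomMap (noiseLaw p n m) fun x => step α β x.1 x.2

theorem stepKernel_apply (α β : ℝ) (p : unitInterval) {n m : ℕ} [NeZero n] (s : State n m) :
    stepKernel α β p n m s = (noiseLaw p n m).map (step α β s) :=
  randomMap_apply _ (measurable_step α β n m) s

theorem runKernel_apply (α β : ℝ) (p : unitInterval) {n m : ℕ} [NeZero n] (t : ℕ)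
    (s : State n m) :
    runKernel α β p n m t s = (pathLaw p n m).map fun ω => run α β s ω t :=
  randomMap_apply _ (measurable_run α β n m t) s

theorem measurable_step_right (α β : ℝ) {n m : ℕ} (s : State n m) :
    Measurable (step α β s : Noise n m → State n m) :=
  (measurable_step α β n m).comp measurable_prodMk_left

instance (α β : ℝ) (p : unitInterval) (n m : ℕ) [NeZero n] :
    IsMarkovKernel (stepKernel α β p n m) :=
  ⟨fun s => by
    rw [stepKernel_apply]
    exact Measure.isProbabilityMeasure_map (measurable_step_right α β s).aemeasurable⟩

instance (α β : ℝ) (p : unitInterval) (n m : ℕ) [NeZero n] (t : ℕ) :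
    IsMarkovKernel (runKernel α β p n m t) :=
  ⟨fun s => by
    rw [runKernel_apply]
    exact Measure.isProbabilityMeasure_map (measurable_run_right α β s t).aemeasurable⟩

theorem isStationary_iff (α β : ℝ) (p : unitInterval) {n m : ℕ} [NeZero n]
    (π : Measure (State n m)) :
    IsStationary α β p π ↔ IsProbabilityMeasure π ∧ π.bind (stepKernel α β p n m) = π := by
  unfold IsStationary stepKernel
  refine and_congr_right fun h => ?_
  rw [bind_randomMap _ (measurable_step α β n m)]

theorem runKernel_succ (α β : ℝ) (p : unitInterval) {n m : ℕ} [NeZero n] (t : ℕ)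
    (s : State n m) :
    runKernel α β p n m (t + 1) s = (stepKernel α β p n m s).bind (runKernel α β p n m t) := by
  refine Measure.ext fun A hA => ?_
  rw [Measure.bind_apply hA (Kernel.measurable _).aemeasurable, stepKernel_apply,
    lintegral_map (Kernel.measurable_coe _ hA) (measurable_step_right α β s), runKernel_apply,
    ← lintegral_indicator_one hA,
    lintegral_map (measurable_one.indicator hA) (measurable_run_right α β s _),
    lintegral_run_succ α β p s t (measurable_one.indicator hA)]
  refine lintegral_congr fun w => ?_
  rw [runKernel_apply, ← lintegral_indicator_one hA,
    lintegral_map (measurable_one.indicator hA) (measurable_run_right α β _ _)]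

theorem bind_runKernel_succ (α β : ℝ) (p : unitInterval) {n m : ℕ} [NeZero n] (t : ℕ)
    (μ : Measure (State n m)) :
    μ.bind (runKernel α β p n m (t + 1)) =
      (μ.bind (stepKernel α β p n m)).bind (runKernel α β p n m t) := by
  rw [Measure.bind_bind (Kernel.measurable _).aemeasurable (Kernel.measurable _).aemeasurable]
  exact congrArg _ (funext fun s => runKernel_succ α β p t s)

theorem bind_runKernel (α β : ℝ) (p : unitInterval) {n m : ℕ} [NeZero n] (t : ℕ)
    (μ : Measure (State n m)) :
    μ.bind (runKernel α β p n m t) = (fun ν => ν.bind (stepKernel α β p n m))^[t] μ := by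
  induction t generalizing μ with
  | zero =>
    have h : (runKernel α β p n m 0 : State n m → Measure (State n m)) = Measure.dirac := by
      funext s
      rw [runKernel_apply]
      change (pathLaw p n m).map (fun _ => s) = _
      rw [Measure.map_const, measure_univ, one_smul]
    rw [h, Measure.bind_dirac]
    rfl
  | succ t ih => rw [bind_runKernel_succ, ih]; rfl

theorem bind_runKernel_of_isStationary {α β : ℝ} {p : unitInterval} {n m : ℕ} [NeZero n]
    {π : Measure (State n m)} (h : π.bind (stepKernel α β p n m) = π) (t : ℕ) :
    π.bind (runKernel α β p n m t) = π := by
  rw [bind_runKernel]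
  exact Function.iterate_fixed h t

/-- An event is unlikely in the stationary state if it is unlikely after `t` steps from every
state. -/
theorem measure_le_of_isStationary {α β : ℝ} {p : unitInterval} {n m : ℕ} [NeZero n]
    {π : Measure (State n m)} (h : IsStationary α β p π) (t : ℕ) {A : Set (State n m)}
    (hA : MeasurableSet A) {b : ENNReal}
    (hb : ∀ s, pathLaw p n m {ω | run α β s ω t ∈ A} ≤ b) : π A ≤ b := by
  obtain ⟨hp, hs⟩ := (isStationary_iff α β p π).mp h
  rw [← bind_runKernel_of_isStationary hs t,
    Measure.bind_apply hA (Kernel.measurable _).aemeasurable]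
  calc _ ≤ ∫⁻ _, b ∂π := lintegral_mono fun s => by
        rw [runKernel_apply, Measure.map_apply (measurable_run_right α β s t) hA]
        exact hb s
    _ = b := by simp

/-- Running `t` steps is an iterate of the one-step map on measures, and iterates commute with the
map. -/
theorem bind_step_bind_run_comm (α β : ℝ) (p : unitInterval) {n m : ℕ} [NeZero n] (t : ℕ)
    (μ : Measure (State n m)) :
    (μ.bind (stepKernel α β p n m)).bind (runKernel α β p n m t) =
      (μ.bind (runKernel α β p n m t)).bind (stepKernel α β p n m) := by
  rw [bind_runKernel, bind_runKernel]
  exact (Function.Commute.iterate_self (fun ν => Measure.bind ν (stepKernel α β p n m)) t).eq μ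

end Chain

/-! ### Positions, ranks and edges along a path -/

section Dynamics

/-- The ranks after `t` steps. -/
noncomputable def rankAt {n : ℕ} (σ : Equiv.Perm (Fin n)) (D R : ℕ → Fin n) :
    ℕ → Equiv.Perm (Fin n)
  | 0 => σ
  | t + 1 => (rankAt σ D R t).trans (moveRank (rankAt σ D R t (D t)) (R t))

/-- The ranks evolve autonomously: the births `ω.1` play no role. This allows to fix the ranks and
still have independent births. -/
theorem rank_run (α β : ℝ) {n m : ℕ} (s : State n m) (ω : Path n m) (t : ℕ) :
    (run α β s ω t).rank = rankAt s.rank ω.2.1 ω.2.2 t := by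
  induction t with
  | zero => rfl
  | succ t ih => rw [run, rankAt, ← ih]; rfl

/-- The last deletion of the label `i` before time `t` happened at time `τ`. -/
def LastDel {n : ℕ} (D : ℕ → Fin n) (i : Fin n) (τ t : ℕ) : Prop :=
  τ < t ∧ D τ = i ∧ ∀ u, τ < u → u < t → D u ≠ i

theorem LastDel.of_succ {n : ℕ} {D : ℕ → Fin n} {i : Fin n} {τ t : ℕ}
    (h : LastDel D i τ (t + 1)) : (t = τ ∧ D t = i) ∨ (LastDel D i τ t ∧ D t ≠ i) := by
  obtain ⟨h1, h2, h3⟩ := h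
  rcases Nat.lt_succ_iff_lt_or_eq.mp h1 with h4 | rfl
  · exact Or.inr ⟨⟨h4, h2, fun u hu hut => h3 u hu (hut.trans t.lt_succ_self)⟩,
      h3 t h4 t.lt_succ_self⟩
  · exact Or.inl ⟨rfl, h2⟩

theorem pos_run (α β : ℝ) {n m : ℕ} (s : State n m) (ω : Path n m) {i : Fin n} {τ t : ℕ}
    (h : LastDel ω.2.1 i τ t) : (run α β s ω t).pos i = (ω.1 τ).1 := by
  induction t with
  | zero => exact absurd h.1 (Nat.not_lt_zero _)
  | succ t ih =>
    rcases h.of_succ with ⟨rfl, rfl⟩ | ⟨h1, h2⟩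
    · simp [run, step, mkNoise]
    · rw [← ih h1]
      simp [run, step, mkNoise, h2.symm]

/-- An edge is decided at the birth of its younger end and is not touched until an end is deleted.
So once all nodes are new, the initial state enters only through the ranks. -/
theorem adj_run (α β : ℝ) {n m : ℕ} (s : State n m) (ω : Path n m) {i j : Fin n} {τ τ' t : ℕ}
    (hi : LastDel ω.2.1 i τ t) (hj : LastDel ω.2.1 j τ' t) (hlt : τ < τ') :
    (run α β s ω t).graph.Adj i j ↔
      (ω.1 τ').1 ∈ influenceRegion α β n (ω.1 τ).1
          ((rankAt s.rank ω.2.1 ω.2.2 τ' i : ℕ) + 1) ∧ (ω.1 τ').2 i = true := by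
  induction t with
  | zero => exact absurd hi.1 (Nat.not_lt_zero _)
  | succ t ih =>
    rcases hi.of_succ with ⟨rfl, rfl⟩ | ⟨hi1, hi2⟩
    · exact absurd hj.1 (by omega)
    rcases hj.of_succ with ⟨rfl, rfl⟩ | ⟨hj1, hj2⟩
    · have := pos_run α β s ω hi1
      simp only [run, step, mkNoise, Joined, this, rank_run]
      simp [hi2.symm]
    · rw [← ih hi1 hj1]
      simp [run, step, mkNoise, hi2.symm, hj2.symm]

end Dynamics

/-! ### Existence and uniqueness of the stationary distribution -/

section Uniqueness

theorem moveRank_apply_of_lt {n : ℕ} {d R x : Fin n} (hR : (R : ℕ) = n - 1) (h : d < x) :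
    (moveRank d R x : ℕ) = x - 1 := by
  have h1 := x.isLt
  have h2 : (d : ℕ) < x := h
  simp only [moveRank, Equiv.ofBijective_apply, moveRankVal, Fin.ext_iff, if_pos h]
  split_ifs <;> omega

theorem moveRank_apply_self {n : ℕ} (d R : Fin n) : moveRank d R d = R := by
  simp [moveRank, moveRankVal]

/-- The `t` new nodes occupy the last `t` ranks in the order of birth; each step takes an old node
from above them, so they all move up by one. -/
theorem rankAt_of_sequential {n : ℕ} (σ : Equiv.Perm (Fin n)) {D R : ℕ → Fin n}
    (hD : ∀ t < n, (D t : ℕ) = t) (hR : ∀ t < n, (R t : ℕ) = n - 1) {t : ℕ} (ht : t ≤ n) :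
    ∀ j : Fin n, (j : ℕ) < t → (rankAt σ D R t j : ℕ) = n - t + j := by
  induction t with
  | zero => exact fun j hj => absurd hj (Nat.not_lt_zero _)
  | succ t ih =>
    intro j hj
    have ih' := ih (by omega)
    rw [rankAt, Equiv.trans_apply]
    rcases Nat.lt_succ_iff_lt_or_eq.mp hj with h1 | h1
    · have h2 : (rankAt σ D R t (D t) : ℕ) < n - t := by
        by_contra hge
        have h4 := (rankAt σ D R t (D t)).isLt
        have h5 := ih' ⟨(rankAt σ D R t (D t) : ℕ) - (n - t), by omega⟩
          (show (rankAt σ D R t (D t) : ℕ) - (n - t) < t by omega)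
        have h6 := (rankAt σ D R t).injective
          (Fin.ext (h5.trans (Nat.add_sub_of_le (not_lt.mp hge))))
        have h7 := congrArg Fin.val h6
        rw [hD t ht] at h7
        dsimp only at h7
        omega
      have h3 := ih' j h1
      rw [moveRank_apply_of_lt (hR t ht) (Fin.lt_def.mpr (by omega)), h3]
      omega
    · have h2 : D t = j := Fin.ext (by rw [hD t ht, h1])
      rw [h2, moveRank_apply_self, hR t ht]
      omega

/-- Paths along which the nodes are replaced one after the other, each time in the last rank. -/
def sequentialPaths (n m : ℕ) : Set (Path n m) :=
  {ω | ∀ i : Fin n, ω.2.1 i = i ∧ (ω.2.2 i : ℕ) = n - 1}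

/-- Coalescence: every label is replaced exactly once, positions come from the births, and the ranks
of the new nodes, hence the edges, do not depend on the initial ranking. -/
theorem run_eq_of_mem_sequentialPaths (α β : ℝ) {n m : ℕ} {ω : Path n m}
    (hω : ω ∈ sequentialPaths n m) (s s' : State n m) : run α β s ω n = run α β s' ω n := by
  have hD : ∀ t < n, (ω.2.1 t : ℕ) = t := fun t ht => congrArg Fin.val (hω ⟨t, ht⟩).1
  have hR : ∀ t < n, (ω.2.2 t : ℕ) = n - 1 := fun t ht => (hω ⟨t, ht⟩).2
  have hl (i : Fin n) : LastDel ω.2.1 i i n :=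
    ⟨i.isLt, (hω i).1, fun u h1 h2 h3 => by
      have := hD u h2
      rw [h3] at this
      omega⟩
  have hrank (t : ℕ) (ht : t ≤ n) (j : Fin n) (hj : (j : ℕ) < t) :
      rankAt s.rank ω.2.1 ω.2.2 t j = rankAt s'.rank ω.2.1 ω.2.2 t j :=
    Fin.ext (by rw [rankAt_of_sequential _ hD hR ht j hj, rankAt_of_sequential _ hD hR ht j hj])
  have hadj (i j : Fin n) (hij : i < j) :
      (run α β s ω n).graph.Adj i j ↔ (run α β s' ω n).graph.Adj i j := by
    rw [adj_run α β s ω (hl i) (hl j) hij, adj_run α β s' ω (hl i) (hl j) hij,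
      hrank j j.isLt.le i hij]
  have h1 : (run α β s ω n).pos = (run α β s' ω n).pos :=
    funext fun i => (pos_run α β s ω (hl i)).trans (pos_run α β s' ω (hl i)).symm
  have h2 : (run α β s ω n).rank = (run α β s' ω n).rank := by
    rw [rank_run, rank_run]
    exact Equiv.ext fun i => hrank n le_rfl i i.isLt
  have h3 : (run α β s ω n).graph = (run α β s' ω n).graph := by
    ext i j
    rcases lt_trichotomy i j with h | rfl | h
    · exact hadj i j h
    · simp
    · rw [SimpleGraph.adj_comm, hadj j i h, SimpleGraph.adj_comm]
  generalize run α β s ω n = a at *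
  generalize run α β s' ω n = b at *
  cases a
  cases b
  simp only at h1 h2 h3
  subst h1 h2 h3
  rfl

theorem measurableSet_sequentialPaths (n m : ℕ) : MeasurableSet (sequentialPaths n m) := by
  have : sequentialPaths n m = ⋂ i : Fin n, ({ω : Path n m | ω.2.1 i ∈ ({i} : Set (Fin n))} ∩
      {ω : Path n m | ω.2.2 i ∈ {r : Fin n | (r : ℕ) = n - 1}}) := by
    ext ω; simp [sequentialPaths]
  rw [this]
  refine MeasurableSet.iInter fun i => MeasurableSet.inter ?_ ?_
  · exact ((measurable_pi_apply _).comp measurable_snd.fst) (MeasurableSet.of_discrete)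
  · exact ((measurable_pi_apply _).comp measurable_snd.snd) (MeasurableSet.of_discrete)

theorem unif_singleton_ne_zero {n : ℕ} (i : Fin n) : unif n {i} ≠ 0 := by
  rw [uniformOn_univ]
  simp

theorem seqLaw_unif_ne_zero {n : ℕ} [NeZero n] (f : Fin n → Fin n) :
    seqLaw (unif n) {D | ∀ i : Fin n, D i = f i} ≠ 0 := by
  have h1 : {D : ℕ → Fin n | ∀ i : Fin n, D i = f i} =
      (fun (D : ℕ → Fin n) (i : Fin n) => D i) ⁻¹' {f} := by
    ext D; simp [funext_iff]
  have h2 : Measurable fun (D : ℕ → Fin n) (i : Fin n) => D i :=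
    measurable_pi_lambda _ fun i => measurable_pi_apply _
  rw [h1, ← Measure.map_apply h2 (MeasurableSet.singleton f),
    map_precomp_seqLaw _ Fin.val_injective, Measure.pi_singleton]
  exact Finset.prod_ne_zero_iff.mpr fun i _ => unif_singleton_ne_zero _

theorem pathLaw_sequentialPaths_ne_zero (p : unitInterval) (n m : ℕ) [NeZero n] :
    pathLaw p n m (sequentialPaths n m) ≠ 0 := by
  have hn : 0 < n := Nat.pos_of_ne_zero (NeZero.ne n)
  have : sequentialPaths n m = Set.univ ×ˢ
      ({D : ℕ → Fin n | ∀ i : Fin n, D i = i} ×ˢ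
        {R : ℕ → Fin n | ∀ i : Fin n, R i = ⟨n - 1, Nat.sub_lt hn one_pos⟩}) := by
    ext ω; simp [sequentialPaths, Fin.ext_iff, forall_and]
  rw [this, pathLaw, Measure.prod_prod, Measure.prod_prod, measure_univ, one_mul]
  exact mul_ne_zero (seqLaw_unif_ne_zero fun i => i) (seqLaw_unif_ne_zero fun _ => _)

/-- The chain has exactly one stationary distribution. -/
theorem existsUnique_isStationary (α β : ℝ) (p : unitInterval) (m n : ℕ) [NeZero n] :
    ∃! π : Measure (State n m), IsStationary α β p π := by
  simp only [isStationary_iff]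
  let s0 : State n m := ⟨fun _ => 0, Equiv.refl _, ⊥⟩
  have : Nonempty (State n m) := ⟨s0⟩
  have hG := measurableSet_sequentialPaths n m
  -- The `n`-step kernel is split according to whether the path is sequential; on sequential paths
  -- the start `s` may be replaced by the fixed `s0`.
  refine existsUnique_invariant_of_minorized (K := runKernel α β p n m n)
    (B := randomMap ((pathLaw p n m).restrict (sequentialPaths n m)ᶜ) fun x => run α β x.1 x.2 n)
    (N := ((pathLaw p n m).restrict (sequentialPaths n m)).map fun ω => run α β s0 ω n)
    (fun s => ?_) ?_ (bind_step_bind_run_comm α β p n)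
    (fun π hπ => bind_runKernel_of_isStationary hπ n)
  · have h1 : ((pathLaw p n m).restrict (sequentialPaths n m)).map (fun ω => run α β s0 ω n) =
        ((pathLaw p n m).restrict (sequentialPaths n m)).map fun ω => run α β s ω n := by
      refine Measure.map_congr ?_
      filter_upwards [ae_restrict_mem hG] with ω hω
      exact run_eq_of_mem_sequentialPaths α β hω s0 s
    rw [runKernel_apply, randomMap_apply _ (measurable_run α β n m n), h1,
      ← Measure.map_add _ _ (measurable_run_right α β s n), Measure.restrict_add_restrict_compl hG]
  · rw [Measure.map_apply (measurable_run_right α β s0 n) MeasurableSet.univ, Set.preimage_univ,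
      Measure.restrict_apply_univ]
    exact pathLaw_sequentialPaths_ne_zero p n m

end Uniqueness

/-! ### Movement of the rank of a surviving node, and replacement of all nodes -/

section Ranks

/-- The law of the sequences of deleted nodes and of initial ranks. -/
noncomputable def rankLaw (n : ℕ) : Measure ((ℕ → Fin n) × (ℕ → Fin n)) :=
  (seqLaw (unif n)).prod (seqLaw (unif n))

instance (n : ℕ) [NeZero n] : IsProbabilityMeasure (rankLaw n) := by
  unfold rankLaw; infer_instance

theorem lintegral_rankLaw {n : ℕ} [NeZero n] {f : (ℕ → Fin n) × (ℕ → Fin n) → ENNReal}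
    (hf : Measurable f) :
    ∫⁻ x, f x ∂(rankLaw n) =
      ∫⁻ y, ∫⁻ x, f (seqCons y.1 x.1, seqCons y.2 x.2) ∂(rankLaw n)
        ∂((unif n).prod (unif n)) :=
  lintegral_prod_of_decomp measurable_seqCons measurable_seqCons
    (fun _ hf => lintegral_seqLaw _ hf) (fun _ hf => lintegral_seqLaw _ hf) hf

theorem unif_real {n : ℕ} (S : Set (Fin n)) [DecidablePred (· ∈ S)] :
    (unif n).real S = ((Finset.univ.filter (· ∈ S)).card : ℝ) / n := by
  have h : (Finset.univ.filter (· ∈ S) : Set (Fin n)) = S := by ext; simp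
  rw [measureReal_def, uniformOn_univ, Fintype.card_fin, ENNReal.toReal_div]
  conv_lhs => rw [← h]
  rw [Measure.count_apply_finset]
  simp

theorem lintegral_unif_ofReal {n : ℕ} [NeZero n] {g : Fin n → ℝ} (hg : ∀ i, 0 ≤ g i) :
    ∫⁻ i, ENNReal.ofReal (g i) ∂(unif n) = ENNReal.ofReal ((∑ i, g i) / n) := by
  have hn : 0 < n := Nat.pos_of_ne_zero (NeZero.ne n)
  rw [lintegral_fintype, Finset.sum_div, ENNReal.ofReal_sum_of_nonneg fun i _ => by
    have := hg i
    positivity]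
  refine Finset.sum_congr rfl fun i _ => ?_
  rw [uniformOn_univ, Measure.count_singleton, Fintype.card_fin, one_div, div_eq_mul_inv,
    ENNReal.ofReal_mul (hg i), ENNReal.ofReal_inv_of_pos (by exact_mod_cast hn),
    ENNReal.ofReal_natCast]

theorem measurable_rankAt {n : ℕ} (σ : Equiv.Perm (Fin n)) (t : ℕ) :
    Measurable fun x : (ℕ → Fin n) × (ℕ → Fin n) => (rankAt σ x.1 x.2 t : Fin n → Fin n) := by
  induction t with
  | zero => exact measurable_const (a := (σ : Fin n → Fin n))
  | succ t ih =>
    have h : Measurable fun y : (Fin n → Fin n) × Fin n × Fin n =>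
        fun a => moveRank (y.1 y.2.1) y.2.2 (y.1 a) := measurable_of_countable _
    have h0 : Measurable fun x : (ℕ → Fin n) × (ℕ → Fin n) =>
        ((rankAt σ x.1 x.2 t : Fin n → Fin n), x.1 t, x.2 t) :=
      ih.prodMk (((measurable_pi_apply t).comp measurable_fst).prodMk
        ((measurable_pi_apply t).comp measurable_snd))
    exact h.comp h0

theorem rankAt_seqCons {n : ℕ} (σ : Equiv.Perm (Fin n)) (d r : Fin n) (D R : ℕ → Fin n) (t : ℕ) :
    rankAt σ (seqCons d D) (seqCons r R) (t + 1) =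
      rankAt (σ.trans (moveRank (σ d) r)) D R t := by
  induction t with
  | zero => rfl
  | succ t ih => rw [rankAt, ih]; rfl

theorem moveRankVal_sub {n : ℕ} {d R x : Fin n} (h : d ≠ x) :
    ((moveRankVal d R x : ℕ) : ℝ) - (x : ℕ) =
      (if (R : ℕ) ≤ x - (if d < x then 1 else 0) then 1 else 0) - (if d < x then 1 else 0) := by
  have h1 : (x : Fin n) ≠ d := h.symm
  simp only [moveRankVal, if_neg h1]
  by_cases hd : d < x
  · have h2 : 1 ≤ (x : ℕ) := by have : (d : ℕ) < x := hd; omega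
    simp only [if_pos hd]
    split_ifs
    · simp
    · rw [add_zero, Nat.cast_sub h2]
      simp
  · simp only [if_neg hd]
    split_ifs <;> simp

/-- The drift of a rank. The total over fewer than `n ^ 2` pairs is at most `n - 1` in absolute
value, so after division by `n ^ 2` the drift is below `1 / n`. -/
theorem sum_moveRankVal_sub {n : ℕ} (x : Fin n) :
    ∑ d ∈ Finset.univ.erase x, ∑ R : Fin n, (((moveRankVal d R x : ℕ) : ℝ) - (x : ℕ)) =
      (n : ℝ) - 1 - 2 * (x : ℕ) := by
  have hn : 1 ≤ n := by have := x.isLt; omega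
  have h1 (d : Fin n) (hd : d ∈ Finset.univ.erase x) :
      ∑ R : Fin n, (((moveRankVal d R x : ℕ) : ℝ) - (x : ℕ)) =
        ((x : ℕ) + 1 : ℝ) - ((n : ℝ) + 1) * (if d < x then 1 else 0) := by
    have hdx : d ≠ x := Finset.ne_of_mem_erase hd
    have h2 (y : ℕ) (hy : y < n) : ∑ R : Fin n, (if (R : ℕ) ≤ y then (1 : ℝ) else 0) = y + 1 := by
      have : (Finset.univ.filter fun R : Fin n => (R : ℕ) ≤ y) = Finset.Iic ⟨y, hy⟩ := by
        ext R; simp [Fin.le_def]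
      rw [Finset.sum_boole, this, Fin.card_Iic]
      simp
    simp only [moveRankVal_sub hdx, Finset.sum_sub_distrib]
    rw [h2 _ (by have := x.isLt; omega)]
    by_cases hlt : d < x
    · have h3 : 1 ≤ (x : ℕ) := by have : (d : ℕ) < x := hlt; omega
      simp only [if_pos hlt]
      push_cast [h3]
      simp
    · simp [hlt]
  rw [Finset.sum_congr rfl h1, Finset.sum_sub_distrib, ← Finset.mul_sum, Finset.sum_boole]
  have h4 : ((Finset.univ.erase x).filter fun d => d < x) = Finset.Iio x := by
    ext d
    simp only [Finset.mem_filter, Finset.mem_erase, Finset.mem_univ, and_true, Finset.mem_Iio]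
    exact ⟨fun h => h.2, fun h => ⟨h.ne, h⟩⟩
  rw [h4, Fin.card_Iio, Finset.sum_const, Finset.card_erase_of_mem (Finset.mem_univ x),
    Finset.card_univ, Fintype.card_fin]
  simp only [nsmul_eq_mul]
  push_cast [hn]
  ring

/-- In `e ^ y ≤ 1 + y + y ^ 2` the linear term gives the drift `|l| / n`, and the quadratic one at
most `l ^ 2`, because a rank moves by at most one. The pairs with `d = x` are absent since the node
would die. -/
theorem sum_exp_moveRankVal_le {n : ℕ} (x : Fin n) {l : ℝ} (hl : |l| ≤ 1) :
    (∑ d ∈ Finset.univ.erase x, ∑ R : Fin n,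
        Real.exp (l * (((moveRankVal d R x : ℕ) : ℝ) - (x : ℕ)))) / n / n ≤
      Real.exp (|l| / n + l ^ 2) := by
  have hn : 1 ≤ n := by have := x.isLt; omega
  have hn0 : (0 : ℝ) < n := by exact_mod_cast hn
  have h1 (d : Fin n) (hd : d ∈ Finset.univ.erase x) (R : Fin n) :
      Real.exp (l * (((moveRankVal d R x : ℕ) : ℝ) - (x : ℕ))) ≤
        1 + l ^ 2 + l * (((moveRankVal d R x : ℕ) : ℝ) - (x : ℕ)) := by
    set y : ℝ := ((moveRankVal d R x : ℕ) : ℝ) - (x : ℕ) with hy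
    have hy1 : |y| ≤ 1 := by
      rw [hy, moveRankVal_sub (Finset.ne_of_mem_erase hd)]
      split_ifs <;> norm_num
    have h2 : |l * y| ≤ 1 := by
      rw [abs_mul]; exact mul_le_one₀ hl (abs_nonneg _) hy1
    have h3 : (l * y) ^ 2 ≤ l ^ 2 := by
      rw [mul_pow]
      have : y ^ 2 ≤ 1 := (sq_le_one_iff_abs_le_one y).mpr hy1
      nlinarith [sq_nonneg l]
    linarith [exp_le_one_add_add_sq h2]
  have h2 : ∑ d ∈ Finset.univ.erase x, ∑ R : Fin n,
        Real.exp (l * (((moveRankVal d R x : ℕ) : ℝ) - (x : ℕ))) ≤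
      ((n : ℝ) - 1) * n * (1 + l ^ 2) + l * ((n : ℝ) - 1 - 2 * (x : ℕ)) := by
    refine (Finset.sum_le_sum fun d hd => Finset.sum_le_sum fun R _ => h1 d hd R).trans ?_
    simp only [Finset.sum_add_distrib, ← Finset.mul_sum]
    rw [sum_moveRankVal_sub]
    simp only [Finset.sum_const, Finset.card_erase_of_mem (Finset.mem_univ x), Finset.card_univ,
      Fintype.card_fin, nsmul_eq_mul]
    push_cast [hn]
    exact le_of_eq (by ring)
  have h3 : l * ((n : ℝ) - 1 - 2 * (x : ℕ)) ≤ |l| * n := by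
    refine (le_abs_self _).trans ?_
    rw [abs_mul]
    refine mul_le_mul_of_nonneg_left ?_ (abs_nonneg l)
    have h4 : ((x : ℕ) : ℝ) + 1 ≤ n := by exact_mod_cast x.isLt
    have h5 : (0 : ℝ) ≤ (x : ℕ) := Nat.cast_nonneg _
    rw [abs_le]
    constructor <;> linarith
  have h4 : ((n : ℝ) - 1) * n * (1 + l ^ 2) + |l| * n ≤ (|l| / n + l ^ 2 + 1) * n * n := by
    have : |l| / n * n = |l| := div_mul_cancel₀ _ hn0.ne'
    nlinarith [sq_nonneg l, abs_nonneg l]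
  rw [div_div, div_le_iff₀ (by positivity)]
  calc _ ≤ (|l| / n + l ^ 2 + 1) * n * n := by linarith
    _ ≤ Real.exp (|l| / n + l ^ 2) * n * n := by
      gcongr
      exact Real.add_one_le_exp _
    _ = _ := by ring

theorem lintegral_exp_moveRank_le {n : ℕ} [NeZero n] (σ : Equiv.Perm (Fin n)) (i : Fin n) {l : ℝ}
    (hl : |l| ≤ 1) :
    ∫⁻ y, (if y.1 = i then 0 else
        ENNReal.ofReal (Real.exp (l * (((moveRank (σ y.1) y.2 (σ i) : ℕ) : ℝ) - (σ i : ℕ)))))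
        ∂((unif n).prod (unif n)) ≤ ENNReal.ofReal (Real.exp (|l| / n + l ^ 2)) := by
  let g : Fin n → Fin n → ℝ := fun d r => if d = i then 0 else
    Real.exp (l * (((moveRank (σ d) r (σ i) : ℕ) : ℝ) - (σ i : ℕ)))
  have hg (d r : Fin n) : 0 ≤ g d r := by
    simp only [g]; split_ifs <;> positivity
  have h1 (y : Fin n × Fin n) : (if y.1 = i then 0 else
        ENNReal.ofReal (Real.exp (l * (((moveRank (σ y.1) y.2 (σ i) : ℕ) : ℝ) - (σ i : ℕ))))) =
      ENNReal.ofReal (g y.1 y.2) := by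
    simp only [g]; split_ifs <;> simp
  simp only [h1]
  rw [lintegral_prod _ (measurable_of_countable _).aemeasurable]
  simp only [lintegral_unif_ofReal (hg _)]
  rw [lintegral_unif_ofReal fun d => div_nonneg (Finset.sum_nonneg fun r _ => hg d r)
    (Nat.cast_nonneg n)]
  refine ENNReal.ofReal_le_ofReal ?_
  rw [← Finset.sum_div]
  refine le_trans (le_of_eq ?_) (sum_exp_moveRankVal_le (σ i) hl)
  congr 2
  rw [← Finset.sum_erase (a := i) Finset.univ (by simp [g])]
  -- A uniform label has a uniform rank, whatever the ranking `σ` is.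
  refine Finset.sum_bij' (fun d _ => σ d) (fun d _ => σ.symm d) ?_ ?_ ?_ ?_ ?_
  · intro d hd; simpa using hd
  · intro d hd
    have := Finset.ne_of_mem_erase hd
    simp only [Finset.mem_erase, Finset.mem_univ, and_true]
    rintro rfl
    simp at this
  · intro d _; simp
  · intro d _; simp
  · intro d hd
    have hd' : d ≠ i := Finset.ne_of_mem_erase hd
    refine Finset.sum_congr rfl fun r _ => ?_
    simp only [g, if_neg hd']
    rfl

theorem measurableSet_forall_ne {n : ℕ} (i : Fin n) (t : ℕ) :
    MeasurableSet {x : (ℕ → Fin n) × (ℕ → Fin n) | ∀ u < t, x.1 u ≠ i} := by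
  simp only [Set.ofPred_forall]
  refine MeasurableSet.iInter fun u => MeasurableSet.iInter fun _ => ?_
  have h : Measurable fun x : (ℕ → Fin n) × (ℕ → Fin n) => x.1 u :=
    (measurable_pi_apply u).comp measurable_fst
  exact h (Set.to_countable {j | j ≠ i}).measurableSet

open scoped Classical in
/-- The exponential moments of the displacement of the rank of a node that survives. -/
theorem lintegral_exp_rankAt_le {n : ℕ} [NeZero n] (i : Fin n) {l : ℝ} (hl : |l| ≤ 1) (t : ℕ)
    (σ : Equiv.Perm (Fin n)) :
    ∫⁻ x, (if ∀ u < t, x.1 u ≠ i then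
        ENNReal.ofReal (Real.exp (l * (((rankAt σ x.1 x.2 t i : ℕ) : ℝ) - (σ i : ℕ)))) else 0)
        ∂(rankLaw n) ≤ ENNReal.ofReal (Real.exp (t * (|l| / n + l ^ 2))) := by
  have hmeas (t : ℕ) (σ : Equiv.Perm (Fin n)) : Measurable fun x : (ℕ → Fin n) × (ℕ → Fin n) =>
      (if ∀ u < t, x.1 u ≠ i then
        ENNReal.ofReal (Real.exp (l * (((rankAt σ x.1 x.2 t i : ℕ) : ℝ) - (σ i : ℕ)))) else 0) := by
    refine Measurable.ite (measurableSet_forall_ne i t) ?_ measurable_const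
    have : Measurable fun r : Fin n → Fin n =>
        ENNReal.ofReal (Real.exp (l * (((r i : ℕ) : ℝ) - (σ i : ℕ)))) := measurable_of_countable _
    exact this.comp (measurable_rankAt σ t)
  induction t generalizing σ with
  | zero => simp [rankAt]
  | succ t ih =>
    rw [lintegral_rankLaw (hmeas (t + 1) σ)]
    -- The displacement telescopes over the first step and the remaining ones, so its exponential
    -- factors.
    have h1 (y : Fin n × Fin n) (x : (ℕ → Fin n) × (ℕ → Fin n)) :
        (if ∀ u < t + 1, seqCons y.1 x.1 u ≠ i then
          ENNReal.ofReal (Real.exp (l * (((rankAt σ (seqCons y.1 x.1) (seqCons y.2 x.2) (t + 1) i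
            : ℕ) : ℝ) - (σ i : ℕ)))) else 0) =
        (if y.1 = i then 0 else
          ENNReal.ofReal (Real.exp (l * (((moveRank (σ y.1) y.2 (σ i) : ℕ) : ℝ) - (σ i : ℕ))))) *
        (if ∀ u < t, x.1 u ≠ i then ENNReal.ofReal (Real.exp (l *
          (((rankAt (σ.trans (moveRank (σ y.1) y.2)) x.1 x.2 t i : ℕ) : ℝ) -
            ((σ.trans (moveRank (σ y.1) y.2)) i : ℕ)))) else 0) := by
      have h2 : (∀ u < t + 1, seqCons y.1 x.1 u ≠ i) ↔ y.1 ≠ i ∧ ∀ u < t, x.1 u ≠ i := by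
        constructor
        · exact fun h => ⟨h 0 (Nat.succ_pos t), fun u hu => h (u + 1) (Nat.succ_lt_succ hu)⟩
        · rintro ⟨h3, h4⟩ (_ | u) hu
          · exact h3
          · exact h4 u (Nat.lt_of_succ_lt_succ hu)
      rw [rankAt_seqCons]
      by_cases h3 : y.1 = i
      · rw [if_neg fun h => (h2.mp h).1 h3, if_pos h3, zero_mul]
      by_cases h4 : ∀ u < t, x.1 u ≠ i
      · rw [if_pos (h2.mpr ⟨h3, h4⟩), if_neg h3, if_pos h4,
          ← ENNReal.ofReal_mul (Real.exp_pos _).le,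
          ← Real.exp_add, Equiv.trans_apply]
        congr 2
        ring
      · rw [if_neg fun h => h4 (h2.mp h).2, if_neg h4, mul_zero]
    simp only [h1]
    have h5 (y : Fin n × Fin n) := lintegral_const_mul (μ := rankLaw n) (if y.1 = i then 0 else
          ENNReal.ofReal (Real.exp (l * (((moveRank (σ y.1) y.2 (σ i) : ℕ) : ℝ) - (σ i : ℕ)))))
          (hmeas t (σ.trans (moveRank (σ y.1) y.2)))
    simp only [h5]
    -- The inductive bound does not depend on the ranking after the first step, so it can be taken
    -- out of the integral.
    refine (lintegral_mono fun y => mul_le_mul_right (ih _) _).trans ?_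
    rw [lintegral_mul_const _ (measurable_of_countable _)]
    refine (mul_le_mul_left (lintegral_exp_moveRank_le σ i hl) _).trans ?_
    rw [← ENNReal.ofReal_mul (Real.exp_pos _).le, ← Real.exp_add]
    refine ENNReal.ofReal_le_ofReal (Real.exp_le_exp.mpr (le_of_eq ?_))
    push_cast
    ring

/-- The rank of a node that survives `t` steps moves little. -/
theorem rankLaw_displacement_le {n : ℕ} [NeZero n] (i : Fin n) {l : ℝ} (hl0 : 0 ≤ l)
    (hl : l ≤ 1) (t : ℕ) (σ : Equiv.Perm (Fin n)) (Δ : ℝ) :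
    rankLaw n {x | (∀ u < t, x.1 u ≠ i) ∧
        Δ < |((rankAt σ x.1 x.2 t i : ℕ) : ℝ) - (σ i : ℕ)|} ≤
      ENNReal.ofReal (2 * Real.exp (-(l * Δ) + t * (l / n + l ^ 2))) := by
  classical
  set c : ENNReal := ENNReal.ofReal (Real.exp (-(l * Δ))) with hc
  let f (l : ℝ) (x : (ℕ → Fin n) × (ℕ → Fin n)) : ENNReal := if ∀ u < t, x.1 u ≠ i then
    ENNReal.ofReal (Real.exp (l * (((rankAt σ x.1 x.2 t i : ℕ) : ℝ) - (σ i : ℕ)))) else 0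
  have hf (l : ℝ) : Measurable (f l) := by
    refine Measurable.ite (measurableSet_forall_ne i t) ?_ measurable_const
    have : Measurable fun r : Fin n → Fin n =>
        ENNReal.ofReal (Real.exp (l * (((r i : ℕ) : ℝ) - (σ i : ℕ)))) := measurable_of_countable _
    exact this.comp (measurable_rankAt σ t)
  have hbound (a : ℝ) (ha : |a| = l) :
      ∫⁻ x, f a x ∂(rankLaw n) ≤ ENNReal.ofReal (Real.exp (t * (l / n + l ^ 2))) := by
    have h := lintegral_exp_rankAt_le i (l := a) (by rw [ha]; exact hl) t σ
    rw [ha, ← sq_abs, ha] at h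
    exact h
  have hset : MeasurableSet {x : (ℕ → Fin n) × (ℕ → Fin n) | (∀ u < t, x.1 u ≠ i) ∧
        Δ < |((rankAt σ x.1 x.2 t i : ℕ) : ℝ) - (σ i : ℕ)|} := by
    refine (measurableSet_forall_ne i t).inter ?_
    exact (measurable_rankAt σ t) (Set.to_countable
      {r : Fin n → Fin n | Δ < |((r i : ℕ) : ℝ) - (σ i : ℕ)|}).measurableSet
  rw [← lintegral_indicator_one hset]
  -- Markov's inequality for both signs of the displacement at once.
  calc _ ≤ ∫⁻ x, c * (f l x + f (-l) x) ∂(rankLaw n) := by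
        refine lintegral_mono fun x => ?_
        rw [Set.indicator_apply]
        split_ifs with hx
        swap
        · exact zero_le
        obtain ⟨h1, h2⟩ := hx
        simp only [f, if_pos h1, Pi.one_apply]
        rw [← ENNReal.ofReal_add (Real.exp_pos _).le (Real.exp_pos _).le, hc,
          ← ENNReal.ofReal_mul (Real.exp_pos _).le, ← ENNReal.ofReal_one]
        refine ENNReal.ofReal_le_ofReal ?_
        rw [mul_add, ← Real.exp_add, ← Real.exp_add]
        set z : ℝ := ((rankAt σ x.1 x.2 t i : ℕ) : ℝ) - (σ i : ℕ)
        rcases lt_abs.mp h2 with h3 | h3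
        · have : 1 ≤ Real.exp (-(l * Δ) + l * z) := Real.one_le_exp (by nlinarith)
          linarith [Real.exp_pos (-(l * Δ) + -l * z)]
        · have : 1 ≤ Real.exp (-(l * Δ) + -l * z) := Real.one_le_exp (by nlinarith)
          linarith [Real.exp_pos (-(l * Δ) + l * z)]
    _ = c * (∫⁻ x, f l x ∂(rankLaw n) + ∫⁻ x, f (-l) x ∂(rankLaw n)) := by
        rw [← lintegral_add_left (hf l)]
        exact lintegral_const_mul _ ((hf l).add (hf (-l)))
    _ ≤ c * (ENNReal.ofReal (Real.exp (t * (l / n + l ^ 2))) +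
          ENNReal.ofReal (Real.exp (t * (l / n + l ^ 2)))) := by
        gcongr
        · exact hbound l (abs_of_nonneg hl0)
        · exact hbound (-l) (by rw [abs_neg, abs_of_nonneg hl0])
    _ = _ := by
        rw [hc, ← ENNReal.ofReal_add (Real.exp_pos _).le (Real.exp_pos _).le,
          ← ENNReal.ofReal_mul (Real.exp_pos _).le, Real.exp_add]
        congr 1
        ring

/-- The node that is born in step `t₀` survives the next `t` steps and its rank moves by more
than `Δ`. -/
def rankMoves {n : ℕ} (σ : Equiv.Perm (Fin n)) (Δ : ℝ) (t₀ t : ℕ) :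
    Set ((ℕ → Fin n) × (ℕ → Fin n)) :=
  {x | (∀ u, t₀ < u → u ≤ t₀ + t → x.1 u ≠ x.1 t₀) ∧
    Δ < |((rankAt σ x.1 x.2 (t₀ + 1 + t) (x.1 t₀) : ℕ) : ℝ) - (x.2 t₀ : ℕ)|}

theorem measurableSet_rankMoves {n : ℕ} (σ : Equiv.Perm (Fin n)) (Δ : ℝ) (t₀ t : ℕ) :
    MeasurableSet (rankMoves σ Δ t₀ t) := by
  refine MeasurableSet.inter ?_ ?_
  · change MeasurableSet {x : (ℕ → Fin n) × (ℕ → Fin n) |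
      ∀ u, t₀ < u → u ≤ t₀ + t → x.1 u ≠ x.1 t₀}
    simp only [Set.ofPred_forall]
    refine MeasurableSet.iInter fun u => MeasurableSet.iInter fun _ => MeasurableSet.iInter fun _ =>
      ?_
    have h : Measurable fun x : (ℕ → Fin n) × (ℕ → Fin n) => (x.1 u, x.1 t₀) :=
      ((measurable_pi_apply u).comp measurable_fst).prodMk
        ((measurable_pi_apply t₀).comp measurable_fst)
    exact h (Set.to_countable {y : Fin n × Fin n | y.1 ≠ y.2}).measurableSet
  · have h : Measurable fun x : (ℕ → Fin n) × (ℕ → Fin n) =>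
        ((rankAt σ x.1 x.2 (t₀ + 1 + t) : Fin n → Fin n), x.1 t₀, x.2 t₀) :=
      (measurable_rankAt σ _).prodMk (((measurable_pi_apply t₀).comp measurable_fst).prodMk
        ((measurable_pi_apply t₀).comp measurable_snd))
    exact h (Set.to_countable {y : (Fin n → Fin n) × Fin n × Fin n |
      Δ < |((y.1 y.2.1 : ℕ) : ℝ) - (y.2.2 : ℕ)|}).measurableSet

/-- After conditioning on the steps up to `t₀`, the new node has a fixed label and rank `R t₀`, and
the displacement bound holds from every ranking. -/
theorem rankLaw_rankMoves_le {n : ℕ} [NeZero n] {l : ℝ} (hl0 : 0 ≤ l) (hl : l ≤ 1)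
    (σ : Equiv.Perm (Fin n)) (Δ : ℝ) (t₀ t : ℕ) :
    rankLaw n (rankMoves σ Δ t₀ t) ≤
      ENNReal.ofReal (2 * Real.exp (-(l * Δ) + t * (l / n + l ^ 2))) := by
  set b := ENNReal.ofReal (2 * Real.exp (-(l * Δ) + t * (l / n + l ^ 2))) with hb
  have hcons (t₀ : ℕ) (σ : Equiv.Perm (Fin n)) : rankLaw n (rankMoves σ Δ t₀ t) =
      ∫⁻ y, rankLaw n {x | (seqCons y.1 x.1, seqCons y.2 x.2) ∈ rankMoves σ Δ t₀ t}
        ∂((unif n).prod (unif n)) := by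
    rw [← lintegral_indicator_one (measurableSet_rankMoves σ Δ t₀ t),
      lintegral_rankLaw (measurable_one.indicator (measurableSet_rankMoves σ Δ t₀ t))]
    refine lintegral_congr fun y => ?_
    have h : Measurable fun x : (ℕ → Fin n) × (ℕ → Fin n) =>
        (seqCons y.1 x.1, seqCons y.2 x.2) :=
      (measurable_seqCons.comp (measurable_const.prodMk measurable_fst)).prodMk
        (measurable_seqCons.comp (measurable_const.prodMk measurable_snd))
    exact lintegral_indicator_one (h (measurableSet_rankMoves σ Δ t₀ t))
  have hint {g : Fin n × Fin n → ENNReal} (hg : ∀ y, g y ≤ b) :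
      ∫⁻ y, g y ∂((unif n).prod (unif n)) ≤ b := by
    refine (lintegral_mono hg).trans ?_
    simp
  induction t₀ generalizing σ with
  | zero =>
    rw [hcons]
    refine hint fun y => ?_
    refine le_trans (measure_mono fun x hx => ?_)
      (rankLaw_displacement_le y.1 hl0 hl t (σ.trans (moveRank (σ y.1) y.2)) Δ)
    obtain ⟨h1, h2⟩ := hx
    refine ⟨fun u hu => h1 (u + 1) (Nat.succ_pos u) (by omega), ?_⟩
    rw [show 0 + 1 + t = t + 1 by omega, rankAt_seqCons] at h2
    rwa [Equiv.trans_apply, moveRank_apply_self]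
  | succ t₀ ih =>
    rw [hcons]
    refine hint fun y => ?_
    refine le_trans (measure_mono fun x hx => ?_) (ih (σ.trans (moveRank (σ y.1) y.2)))
    obtain ⟨h1, h2⟩ := hx
    refine ⟨fun u hu hu' => h1 (u + 1) (by omega) (by omega), ?_⟩
    rwa [show t₀ + 1 + 1 + t = t₀ + 1 + t + 1 by omega, rankAt_seqCons] at h2

/-- Some node is not replaced within `T` steps. -/
def notReplaced (n T : ℕ) : Set (ℕ → Fin n) := {D | ∃ i, ∀ t < T, D t ≠ i}

theorem measurableSet_notReplaced (n T : ℕ) : MeasurableSet (notReplaced n T) := by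
  simp only [notReplaced, Set.ofPred_exists, Set.ofPred_forall]
  refine MeasurableSet.iUnion fun i => MeasurableSet.iInter fun t =>
    MeasurableSet.iInter fun _ => ?_
  have h : Measurable fun D : ℕ → Fin n => D t := measurable_pi_apply t
  exact h (Set.to_countable {j | j ≠ i}).measurableSet

/-- Coupon collector: a union bound over the labels with `(1 - 1 / n) ^ T ≤ exp (-T / n)`. -/
theorem seqLaw_notReplaced_le (n T : ℕ) [NeZero n] :
    seqLaw (unif n) (notReplaced n T) ≤ ENNReal.ofReal (n * Real.exp (-(T / n))) := by
  have hn : 0 < n := Nat.pos_of_ne_zero (NeZero.ne n)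
  have hn0 : (0 : ℝ) < n := by exact_mod_cast hn
  have h1 (i : Fin n) : seqLaw (unif n) {D | ∀ t < T, D t ≠ i} ≤
      ENNReal.ofReal (Real.exp (-(T / n))) := by
    have h2 : {D : ℕ → Fin n | ∀ t < T, D t ≠ i} =
        Set.pi ((Finset.range T : Finset ℕ) : Set ℕ) fun _ => {i}ᶜ := by
      ext D; simp [Set.mem_pi]
    rw [h2, seqLaw, Measure.infinitePi_pi _ fun _ _ => (MeasurableSet.singleton i).compl,
      Finset.prod_const, Finset.card_range]
    have h3 : unif n {i}ᶜ ≤ ENNReal.ofReal (Real.exp (-(1 / n))) := by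
      rw [← ENNReal.ofReal_toReal (measure_ne_top (unif n) {i}ᶜ)]
      refine ENNReal.ofReal_le_ofReal ?_
      change (unif n).real {i}ᶜ ≤ _
      rw [probReal_compl_eq_one_sub (MeasurableSet.singleton i)]
      classical
      rw [unif_real]
      simp only [Set.mem_singleton_iff, Finset.filter_eq', Finset.mem_univ, if_true,
        Finset.card_singleton, Nat.cast_one]
      linarith [Real.add_one_le_exp (-(1 / (n : ℝ)))]
    refine (pow_le_pow_left' h3 T).trans (le_of_eq ?_)
    rw [← ENNReal.ofReal_pow (Real.exp_pos _).le, ← Real.exp_nat_mul]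
    congr 2
    ring
  have h4 : notReplaced n T = ⋃ i : Fin n, {D | ∀ t < T, D t ≠ i} := by
    ext D; simp [notReplaced]
  rw [h4]
  refine (measure_iUnion_fintype_le _ _).trans ((Finset.sum_le_sum fun i _ => h1 i).trans ?_)
  rw [Finset.sum_const, Finset.card_univ, Fintype.card_fin, nsmul_eq_mul,
    ENNReal.ofReal_mul hn0.le, ENNReal.ofReal_natCast]

end Ranks

/-! ### Degrees when deletions and initial ranks are fixed -/

section Degrees

/-- The births of a node `j` that lead to an edge between `i` and `j`, if `y` is the birth of
`i`. The rank of the older one of the two nodes is `r` when the younger one is born. -/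
def nbrSet (α β : ℝ) {n m : ℕ} (i j : Fin n) (younger : Bool) (r : ℕ) (y : Birth n m) :
    Set (Birth n m) :=
  {b | b.1 ∈ influenceRegion α β n y.1 r ∧ (if younger then b.2 i else y.2 j) = true}

theorem measurableSet_nbrSet_joint (α β : ℝ) {n m : ℕ} (i j : Fin n) (g : Bool) (r : ℕ) :
    MeasurableSet {x : Birth n m × Birth n m | x.2 ∈ nbrSet α β i j g r x.1} := by
  refine MeasurableSet.inter ?_ ?_
  · exact measurableSet_le (measurable_snd.fst.dist measurable_fst.fst) measurable_const
  · have h : Measurable fun x : Birth n m × Birth n m => if g then x.2.2 i else x.1.2 j := by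
      cases g
      · exact (measurable_pi_apply j).comp measurable_fst.snd
      · exact (measurable_pi_apply i).comp measurable_snd.snd
    exact h (MeasurableSet.singleton true)

theorem measurableSet_nbrSet (α β : ℝ) {n m : ℕ} (i j : Fin n) (g : Bool) (r : ℕ)
    (y : Birth n m) : MeasurableSet (nbrSet α β i j g r y) :=
  (measurable_prodMk_left (x := y)) (measurableSet_nbrSet_joint α β i j g r)

theorem volume_real_influenceRegion {α β : ℝ} (hα : 0 ≤ α) (hβ : 0 ≤ β) {m n r : ℕ} (hm : 1 ≤ m)
    (hn : 1 ≤ n) (hr : 1 ≤ r) (x : Torus m) :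
    volume.real (influenceRegion α β n x r) = (r : ℝ) ^ (-α) * (n : ℝ) ^ (-β) := by
  rw [measureReal_def, volume_influenceRegion hα hβ hm hn hr, ENNReal.toReal_ofReal]
  positivity

theorem birthLaw_nbrSet_younger {α β : ℝ} (hα : 0 ≤ α) (hβ : 0 ≤ β) (p : unitInterval)
    {m n r : ℕ} (hm : 1 ≤ m) (hn : 1 ≤ n) (hr : 1 ≤ r) (i j : Fin n) (y : Birth n m) :
    (birthLaw p n m).real (nbrSet α β i j true r y) = p * ((r : ℝ) ^ (-α) * (n : ℝ) ^ (-β)) := by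
  have h : nbrSet α β i j true r y =
      influenceRegion α β n y.1 r ×ˢ {c : Fin n → Bool | c i = true} := by
    ext b; simp [nbrSet]
  have h2 : (Measure.pi fun _ : Fin n => bernoulliMeasure true false p).real
      {c : Fin n → Bool | c i = true} = p := by
    have h3 := (measurePreserving_eval (fun _ : Fin n => bernoulliMeasure true false p)
      i).measure_preimage (MeasurableSet.singleton true).nullMeasurableSet
    rw [measureReal_def]
    change ((Measure.pi fun _ : Fin n => bernoulliMeasure true false p)
      (Function.eval i ⁻¹' {true})).toReal = p
    rw [h3, bernoulliMeasure_apply p (MeasurableSet.singleton true)]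
    simp
  rw [h, birthLaw, measureReal_prod_prod, h2, volume_real_influenceRegion hα hβ hm hn hr, mul_comm]

/-- The coin is dropped: for an older `j` it belongs to the fixed birth `y` of `i` and supplies no
factor `p`. -/
theorem birthLaw_nbrSet_le {α β : ℝ} (hα : 0 ≤ α) (hβ : 0 ≤ β) (p : unitInterval)
    {m n r : ℕ} (hm : 1 ≤ m) (hn : 1 ≤ n) (hr : 1 ≤ r) (i j : Fin n) (g : Bool) (y : Birth n m) :
    (birthLaw p n m).real (nbrSet α β i j g r y) ≤ (r : ℝ) ^ (-α) * (n : ℝ) ^ (-β) := by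
  have h : nbrSet α β i j g r y ⊆ influenceRegion α β n y.1 r ×ˢ Set.univ :=
    fun b hb => ⟨hb.1, trivial⟩
  refine (measureReal_mono h).trans (le_of_eq ?_)
  rw [birthLaw, measureReal_prod_prod, probReal_univ, mul_one,
    volume_real_influenceRegion hα hβ hm hn hr]

/-- The expected number of neighbours of `i` among the nodes with `younger j = true`. -/
noncomputable def youngMean (α β p : ℝ) {n : ℕ} (i : Fin n) (g : Fin n → Bool) (r : Fin n → ℕ) :
    ℝ :=
  ∑ j, if j ≠ i ∧ g j = true then p * ((r j : ℝ) ^ (-α) * (n : ℝ) ^ (-β)) else 0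

/-- A bound for the expected number of neighbours of `i` among the nodes with
`younger j = false`. -/
noncomputable def oldMean (α β : ℝ) {n : ℕ} (i : Fin n) (g : Fin n → Bool) (r : Fin n → ℕ) :
    ℝ :=
  ∑ j, if j ≠ i ∧ g j = false then (r j : ℝ) ^ (-α) * (n : ℝ) ^ (-β) else 0

open scoped Classical in
/-- The number of neighbours of `i`. -/
noncomputable def nbrCount (α β : ℝ) {n m : ℕ} (i : Fin n) (g : Fin n → Bool) (r : Fin n → ℕ)
    (Y : Fin n → Birth n m) : ℕ :=
  (Finset.univ.filter fun j => j ≠ i ∧ Y j ∈ nbrSet α β i j (g j) (r j) (Y i)).card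

theorem measurable_nbrCount (α β : ℝ) {n m : ℕ} (i : Fin n) (g : Fin n → Bool) (r : Fin n → ℕ) :
    Measurable (nbrCount α β i g r : (Fin n → Birth n m) → ℕ) := by
  classical
  have h : (nbrCount α β i g r : (Fin n → Birth n m) → ℕ) = fun Y =>
      ∑ j, if j ≠ i ∧ Y j ∈ nbrSet α β i j (g j) (r j) (Y i) then 1 else 0 := by
    funext Y
    rw [nbrCount, Finset.card_filter]
  rw [h]
  refine Finset.measurable_sum _ fun j _ => Measurable.ite ?_ measurable_const measurable_const
  refine (MeasurableSet.const _).inter ?_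
  have : Measurable fun Y : Fin n → Birth n m => (Y i, Y j) :=
    (measurable_pi_apply i).prodMk (measurable_pi_apply j)
  exact this (measurableSet_nbrSet_joint α β i j (g j) (r j))

/-- With the birth `y` of `i` fixed, the degree is a sum of indicators that each involve the birth
of one other node, hence of independent ones. -/
theorem nbrCount_insertNth (α β : ℝ) {N m : ℕ} (i : Fin (N + 1)) (g : Fin (N + 1) → Bool)
    (r : Fin (N + 1) → ℕ) (y : Birth (N + 1) m) (z : Fin N → Birth (N + 1) m) :
    (nbrCount α β i g r (i.insertNth (α := fun _ => Birth (N + 1) m) y z) : ℝ) =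
      ∑ j, (nbrSet α β i (i.succAbove j) (g (i.succAbove j)) (r (i.succAbove j)) y).indicator
        (1 : Birth (N + 1) m → ℝ) (z j) := by
  classical
  rw [nbrCount, Finset.card_filter, Fin.sum_univ_succAbove _ i]
  simp [Set.indicator_apply, Fin.succAbove_ne]

theorem pi_nbrCount_ge_le {α β : ℝ} (hα : 0 ≤ α) (hβ : 0 ≤ β) (p : unitInterval)
    {m n : ℕ} (hm : 1 ≤ m) (hn : 1 ≤ n) (i : Fin n) (g : Fin n → Bool) (r : Fin n → ℕ)
    (hr : ∀ j, 1 ≤ r j) {M s l : ℝ} (hM : youngMean α β p i g r + oldMean α β i g r ≤ M)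
    (hl0 : 0 ≤ l) (hl1 : l ≤ 1) :
    (Measure.pi fun _ : Fin n => birthLaw p n m) {Y | M + s ≤ nbrCount α β i g r Y} ≤
      ENNReal.ofReal (Real.exp (-(l * s) + l ^ 2 * M)) := by
  obtain ⟨N, rfl⟩ : ∃ N, n = N + 1 := ⟨n - 1, by omega⟩
  have hmeas : MeasurableSet {Y : Fin (N + 1) → Birth (N + 1) m |
      M + s ≤ nbrCount α β i g r Y} :=
    measurable_nbrCount α β i g r (Set.to_countable {c : ℕ | M + s ≤ c}).measurableSet
  refine pi_le_of_forall_insertNth_le _ i hmeas fun y => ?_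
  simp only [Set.mem_ofPred_eq, nbrCount_insertNth]
  have h := measureReal_sum_indicator_ge_le (fun _ : Fin N => birthLaw p (N + 1) m)
    (S := fun j => nbrSet α β i (i.succAbove j) (g (i.succAbove j)) (r (i.succAbove j)) y)
    (fun j => measurableSet_nbrSet _ _ _ _ _ _ _) (M := M) (s := s) (l := l) ?_ hl0 hl1
  · rw [← ENNReal.ofReal_toReal (measure_ne_top _ _)]
    exact ENNReal.ofReal_le_ofReal h
  · refine le_trans ?_ hM
    rw [youngMean, oldMean, Fin.sum_univ_succAbove _ i, Fin.sum_univ_succAbove _ i]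
    simp only [ne_eq, not_true_eq_false, false_and, if_false, zero_add, Fin.succAbove_ne,
      not_false_eq_true, true_and, ← Finset.sum_add_distrib]
    refine Finset.sum_le_sum fun j _ => ?_
    cases hg : g (i.succAbove j) with
    | true =>
      rw [birthLaw_nbrSet_younger hα hβ p hm hn (hr _)]
      simp
    | false =>
      have := birthLaw_nbrSet_le hα hβ p hm hn (hr (i.succAbove j)) i (i.succAbove j) false y
      simpa using this

/-- Older nodes add nonnegative terms to the mean, so the younger ones suffice for a lower bound. -/
theorem pi_nbrCount_le_le {α β : ℝ} (hα : 0 ≤ α) (hβ : 0 ≤ β) (p : unitInterval)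
    {m n : ℕ} (hm : 1 ≤ m) (hn : 1 ≤ n) (i : Fin n) (g : Fin n → Bool) (r : Fin n → ℕ)
    (hr : ∀ j, 1 ≤ r j) {M s l : ℝ} (hM0 : 0 ≤ M) (hM : M ≤ youngMean α β p i g r)
    (hl0 : 0 ≤ l) (hl1 : l ≤ 1) :
    (Measure.pi fun _ : Fin n => birthLaw p n m) {Y | (nbrCount α β i g r Y : ℝ) ≤ M - s} ≤
      ENNReal.ofReal (Real.exp (-(l * s) + l ^ 2 * M)) := by
  obtain ⟨N, rfl⟩ : ∃ N, n = N + 1 := ⟨n - 1, by omega⟩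
  have hmeas : MeasurableSet {Y : Fin (N + 1) → Birth (N + 1) m |
      (nbrCount α β i g r Y : ℝ) ≤ M - s} :=
    measurable_nbrCount α β i g r (Set.to_countable {c : ℕ | (c : ℝ) ≤ M - s}).measurableSet
  refine pi_le_of_forall_insertNth_le _ i hmeas fun y => ?_
  simp only [Set.mem_ofPred_eq, nbrCount_insertNth]
  have h := measureReal_sum_indicator_le_le (fun _ : Fin N => birthLaw p (N + 1) m)
    (S := fun j => nbrSet α β i (i.succAbove j) (g (i.succAbove j)) (r (i.succAbove j)) y)
    (fun j => measurableSet_nbrSet _ _ _ _ _ _ _) (M := M) (s := s) (l := l) hM0 ?_ hl0 hl1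
  · rw [← ENNReal.ofReal_toReal (measure_ne_top _ _)]
    exact ENNReal.ofReal_le_ofReal h
  · refine hM.trans ?_
    rw [youngMean, Fin.sum_univ_succAbove _ i]
    simp only [ne_eq, not_true_eq_false, false_and, if_false, zero_add, Fin.succAbove_ne,
      not_false_eq_true, true_and]
    refine Finset.sum_le_sum fun j _ => ?_
    cases hg : g (i.succAbove j) with
    | true =>
      rw [birthLaw_nbrSet_younger hα hβ p hm hn (hr _)]
      simp
    | false => simp

/-- The rank of the older one of the nodes `i` and `j` at the birth of the younger one. -/
noncomputable def olderRank {n : ℕ} (σ : Equiv.Perm (Fin n)) (D R : ℕ → Fin n) (τ : Fin n → ℕ)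
    (i j : Fin n) : ℕ :=
  if τ i < τ j then (rankAt σ D R (τ j) i : ℕ) + 1 else (rankAt σ D R (τ i) j : ℕ) + 1

theorem LastDel.injective {n T : ℕ} {D : ℕ → Fin n} {τ : Fin n → ℕ}
    (hτ : ∀ i, LastDel D i (τ i) T) : Function.Injective τ := fun i j h => by
  rw [← (hτ i).2.1, h, (hτ j).2.1]

theorem adj_run_iff_mem_nbrSet (α β : ℝ) {n m : ℕ} (s : State n m) (ω : Path n m) {T : ℕ}
    {τ : Fin n → ℕ} (hτ : ∀ i, LastDel ω.2.1 i (τ i) T) {i j : Fin n} (hij : j ≠ i) :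
    (run α β s ω T).graph.Adj i j ↔
      ω.1 (τ j) ∈ nbrSet α β i j (decide (τ i < τ j)) (olderRank s.rank ω.2.1 ω.2.2 τ i j)
        (ω.1 (τ i)) := by
  rcases lt_trichotomy (τ i) (τ j) with h | h | h
  · rw [adj_run α β s ω (hτ i) (hτ j) h]
    simp [nbrSet, olderRank, h]
  · exact absurd (LastDel.injective hτ h).symm hij
  · rw [SimpleGraph.adj_comm, adj_run α β s ω (hτ j) (hτ i) h]
    simp only [nbrSet, olderRank, h.not_gt, if_false, influenceRegion, Set.mem_ofPred_eq,
      decide_false, Bool.false_eq_true]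
    -- If `i` is the younger node, the ball is centred at `j`; by symmetry the condition still
    -- concerns the point of `j`, for fixed `i`.
    rw [Metric.mem_closedBall_comm]

open scoped Classical in
theorem degree_run (α β : ℝ) {n m : ℕ} (s : State n m) (ω : Path n m) {T : ℕ}
    {τ : Fin n → ℕ} (hτ : ∀ i, LastDel ω.2.1 i (τ i) T) (i : Fin n) :
    (run α β s ω T).graph.degree i =
      nbrCount α β i (fun j => decide (τ i < τ j)) (olderRank s.rank ω.2.1 ω.2.2 τ i)
        (fun j => ω.1 (τ j)) := by
  rw [nbrCount, ← SimpleGraph.card_neighborFinset_eq_degree]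
  congr 1
  ext j
  simp only [SimpleGraph.mem_neighborFinset, Finset.mem_filter, Finset.mem_univ, true_and]
  by_cases h : j = i
  · simp [h]
  · rw [adj_run_iff_mem_nbrSet α β s ω hτ h]
    simp [h]

theorem measurable_comp_right {ι X : Type*} [MeasurableSpace X] (τ : ι → ℕ) :
    Measurable fun (B : ℕ → X) (i : ι) => B (τ i) :=
  measurable_pi_lambda _ fun _ => measurable_pi_apply _

-- The times `τ j` are distinct and are fixed along with `D`, so the births that matter are i.i.d.
-- and the bound for `nbrCount` applies.
open scoped Classical in
theorem seqLaw_degree_ge_le {α β : ℝ} (hα : 0 ≤ α) (hβ : 0 ≤ β) (p : unitInterval)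
    {m n : ℕ} (hm : 1 ≤ m) (hn : 1 ≤ n) (s : State n m) (D R : ℕ → Fin n) {T : ℕ}
    {τ : Fin n → ℕ} (hτ : ∀ i, LastDel D i (τ i) T) (i : Fin n) {M u l : ℝ}
    (hM : youngMean α β p i (fun j => decide (τ i < τ j)) (olderRank s.rank D R τ i) +
      oldMean α β i (fun j => decide (τ i < τ j)) (olderRank s.rank D R τ i) ≤ M)
    (hl0 : 0 ≤ l) (hl1 : l ≤ 1) :
    seqLaw (birthLaw p n m) {B | M + u ≤ ((run α β s (B, D, R) T).graph.degree i : ℝ)} ≤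
      ENNReal.ofReal (Real.exp (-(l * u) + l ^ 2 * M)) := by
  refine le_trans (le_of_eq ?_) (pi_nbrCount_ge_le hα hβ p hm hn i _ _ (fun j => ?_) hM hl0 hl1)
  · rw [← map_precomp_seqLaw (birthLaw p n m) (LastDel.injective hτ),
      Measure.map_apply (measurable_comp_right τ)]
    · congr 1
      ext B
      simp only [Set.mem_ofPred_eq, Set.mem_preimage]
      rw [degree_run α β s (B, D, R) hτ i]
    · exact measurable_nbrCount α β i _ _ (Set.to_countable {c : ℕ | M + u ≤ c}).measurableSet
  · unfold olderRank; split_ifs <;> omega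

open scoped Classical in
theorem seqLaw_degree_le_le {α β : ℝ} (hα : 0 ≤ α) (hβ : 0 ≤ β) (p : unitInterval)
    {m n : ℕ} (hm : 1 ≤ m) (hn : 1 ≤ n) (s : State n m) (D R : ℕ → Fin n) {T : ℕ}
    {τ : Fin n → ℕ} (hτ : ∀ i, LastDel D i (τ i) T) (i : Fin n) {M u l : ℝ} (hM0 : 0 ≤ M)
    (hM : M ≤ youngMean α β p i (fun j => decide (τ i < τ j)) (olderRank s.rank D R τ i))
    (hl0 : 0 ≤ l) (hl1 : l ≤ 1) :
    seqLaw (birthLaw p n m) {B | ((run α β s (B, D, R) T).graph.degree i : ℝ) ≤ M - u} ≤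
      ENNReal.ofReal (Real.exp (-(l * u) + l ^ 2 * M)) := by
  refine le_trans (le_of_eq ?_)
    (pi_nbrCount_le_le hα hβ p hm hn i _ _ (fun j => ?_) hM0 hM hl0 hl1)
  · rw [← map_precomp_seqLaw (birthLaw p n m) (LastDel.injective hτ),
      Measure.map_apply (measurable_comp_right τ)]
    · congr 1
      ext B
      simp only [Set.mem_ofPred_eq, Set.mem_preimage]
      rw [degree_run α β s (B, D, R) hτ i]
    · exact measurable_nbrCount α β i _ _ (Set.to_countable {c : ℕ | (c : ℝ) ≤ M - u}).measurableSet
  · unfold olderRank; split_ifs <;> omega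

end Degrees

/-! ### Ages, power sums and the number of small initial ranks -/

section Counts

/-- The number of nodes that are younger than `i`. -/
def youngerCount {n : ℕ} (τ : Fin n → ℕ) (i : Fin n) : ℕ :=
  (Finset.univ.filter fun j => τ i < τ j).card

theorem youngerCount_lt {n : ℕ} (τ : Fin n → ℕ) (i : Fin n) : youngerCount τ i < n := by
  have h : (Finset.univ.filter fun j => τ i < τ j) ⊂ Finset.univ :=
    Finset.filter_ssubset.mpr ⟨i, Finset.mem_univ i, lt_irrefl _⟩
  simpa [youngerCount] using Finset.card_lt_card h

theorem youngerCount_lt_of_lt {n : ℕ} {τ : Fin n → ℕ} {i j : Fin n} (h : τ i < τ j) :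
    youngerCount τ j < youngerCount τ i := by
  refine Finset.card_lt_card (Finset.ssubset_iff_of_subset (fun a ha => ?_) |>.mpr ⟨j, ?_, ?_⟩)
  · simp only [Finset.mem_filter, Finset.mem_univ, true_and] at ha ⊢
    exact h.trans ha
  · simpa using h
  · simp

/-- Birth times are distinct, so the number of younger nodes takes each value below `n` exactly
once. -/
theorem sum_youngerCount {n : ℕ} {τ : Fin n → ℕ} (hτ : Function.Injective τ) (f : ℕ → ℝ) :
    ∑ i, f (youngerCount τ i) = ∑ a ∈ Finset.range n, f a := by
  have hinj : Function.Injective fun i : Fin n =>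
      (⟨youngerCount τ i, youngerCount_lt τ i⟩ : Fin n) := by
    intro i j h
    have h1 : youngerCount τ i = youngerCount τ j := congrArg Fin.val h
    rcases lt_trichotomy (τ i) (τ j) with h2 | h2 | h2
    · exact absurd h1 (youngerCount_lt_of_lt h2).ne'
    · exact hτ h2
    · exact absurd h1 (youngerCount_lt_of_lt h2).ne
  rw [← Fin.sum_univ_eq_sum_range]
  exact Function.Bijective.sum_comp (Finite.injective_iff_bijective.mp hinj)
    (fun a : Fin n => f a)

/-- A Riemann sum below `∫ y ^ q`. With `q = 1 / α` the limit `1 / (q + 1)` is the constant `α / (α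
+ 1)` of the theorem. -/
theorem sum_rpow_le {q : ℝ} (hq : 0 ≤ q) {n : ℕ} (hn : 1 ≤ n) :
    ∑ a ∈ Finset.range n, ((a : ℝ) / n) ^ q ≤ n / (q + 1) := by
  have hn0 : (0 : ℝ) < n := by exact_mod_cast hn
  have hm : MonotoneOn (fun y : ℝ => y ^ q) (Set.Icc 0 (0 + n)) := fun a ha b _ hab =>
    Real.rpow_le_rpow ha.1 hab hq
  have h := hm.sum_le_integral
  simp only [zero_add] at h
  rw [integral_rpow (Or.inl (by linarith)), Real.zero_rpow (by linarith), sub_zero] at h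
  have h2 : ∑ a ∈ Finset.range n, ((a : ℝ) / n) ^ q =
      (∑ a ∈ Finset.range n, (a : ℝ) ^ q) / (n : ℝ) ^ q := by
    rw [Finset.sum_div]
    exact Finset.sum_congr rfl fun a _ => Real.div_rpow (Nat.cast_nonneg a) hn0.le q
  rw [h2, div_le_iff₀ (by positivity)]
  refine h.trans (le_of_eq ?_)
  rw [Real.rpow_add_one hn0.ne']
  ring

theorem le_sum_rpow {q : ℝ} (hq : 0 < q) {n : ℕ} (hn : 1 ≤ n) :
    n / (q + 1) - 1 ≤ ∑ a ∈ Finset.range n, ((a : ℝ) / n) ^ q := by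
  have hn0 : (0 : ℝ) < n := by exact_mod_cast hn
  have hm : MonotoneOn (fun y : ℝ => y ^ q) (Set.Icc 0 (0 + n)) := fun a ha b _ hab =>
    Real.rpow_le_rpow ha.1 hab hq.le
  have h := hm.integral_le_sum
  simp only [zero_add] at h
  rw [integral_rpow (Or.inl (by linarith)), Real.zero_rpow (by linarith), sub_zero] at h
  have h3 : ∑ a ∈ Finset.range n, ((a + 1 : ℕ) : ℝ) ^ q =
      ∑ a ∈ Finset.range n, (a : ℝ) ^ q + (n : ℝ) ^ q := by
    rw [← Finset.sum_range_succ (fun a : ℕ => (a : ℝ) ^ q),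
      Finset.sum_range_succ' (fun a : ℕ => (a : ℝ) ^ q)]
    simp [Real.zero_rpow hq.ne']
  rw [h3] at h
  have h2 : ∑ a ∈ Finset.range n, ((a : ℝ) / n) ^ q =
      (∑ a ∈ Finset.range n, (a : ℝ) ^ q) / (n : ℝ) ^ q := by
    rw [Finset.sum_div]
    exact Finset.sum_congr rfl fun a _ => Real.div_rpow (Nat.cast_nonneg a) hn0.le q
  rw [h2, le_div_iff₀ (by positivity)]
  refine le_trans (le_of_eq ?_) (sub_le_iff_le_add.mpr h)
  rw [Real.rpow_add_one hn0.ne']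
  ring

theorem sum_rpow_neg_le {α : ℝ} (hα0 : 0 < α) (hα1 : α < 1) {n : ℕ} (hn : 1 ≤ n) :
    ∑ a ∈ Finset.range n, ((a : ℝ) + 1) ^ (-α) ≤ (n : ℝ) ^ (1 - α) / (1 - α) := by
  obtain ⟨N, rfl⟩ : ∃ N, n = N + 1 := ⟨n - 1, by omega⟩
  have hm : AntitoneOn (fun y : ℝ => y ^ (-α)) (Set.Icc 1 (1 + N)) := fun a ha b _ hab =>
    Real.rpow_le_rpow_of_nonpos (lt_of_lt_of_le one_pos ha.1) hab (by linarith)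
  have h := hm.sum_le_integral
  rw [integral_rpow (Or.inl (by linarith))] at h
  rw [Finset.sum_range_succ']
  have h1 : ∑ a ∈ Finset.range N, (((a + 1 : ℕ) : ℝ) + 1) ^ (-α) =
      ∑ a ∈ Finset.range N, (1 + ((a + 1 : ℕ) : ℝ)) ^ (-α) :=
    Finset.sum_congr rfl fun a _ => by rw [add_comm]
  rw [h1]
  -- The term `a = 0`, which equals one, is absorbed by the lower limit `-1 / (1 - α)` of the
  -- integral.
  have h2 : (1 : ℝ) ≤ 1 / (1 - α) := by
    rw [le_div_iff₀ (by linarith)]; linarith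
  have h3 : -α + 1 = 1 - α := by ring
  rw [h3, Real.one_rpow, sub_div] at h
  have h4 : ((N + 1 : ℕ) : ℝ) = 1 + N := by push_cast; ring
  rw [h4]
  simp only [Nat.cast_zero, zero_add, Real.one_rpow]
  linarith

theorem unif_real_le {n : ℕ} [NeZero n] {y : ℝ} (hy : 0 ≤ y) :
    (unif n).real {r : Fin n | ((r : ℕ) : ℝ) + 1 ≤ y} ≤ y / n := by
  classical
  rw [unif_real]
  refine div_le_div_of_nonneg_right ?_ (Nat.cast_nonneg n)
  have h : (Finset.univ.filter fun r : Fin n => r ∈ {r : Fin n | ((r : ℕ) : ℝ) + 1 ≤ y}).card ≤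
      (Finset.range ⌊y⌋₊).card := by
    refine Finset.card_le_card_of_injOn (fun r => (r : ℕ)) (fun r hr => ?_)
      (fun a _ b _ h => Fin.ext h)
    have hr' : ((r : ℕ) : ℝ) + 1 ≤ y := by simpa using hr
    simp only [Finset.coe_range, Set.mem_Iio]
    exact Nat.lt_of_succ_le (Nat.le_floor (by push_cast; exact hr'))
  rw [Finset.card_range] at h
  exact (Nat.cast_le.mpr h).trans (Nat.floor_le hy)

theorem le_unif_real {n : ℕ} [NeZero n] {y : ℝ} (hy : y ≤ n) :
    (y - 1) / n ≤ (unif n).real {r : Fin n | ((r : ℕ) : ℝ) + 1 ≤ y} := by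
  classical
  rw [unif_real]
  refine div_le_div_of_nonneg_right ?_ (Nat.cast_nonneg n)
  -- Negative `y` has to be admitted, since lower thresholds of young nodes can be negative.
  rcases lt_or_ge y 0 with h0 | h0
  · exact le_trans (by linarith) (Nat.cast_nonneg _)
  have hfl : ⌊y⌋₊ ≤ n := Nat.floor_le_of_le hy
  have h : (Finset.range ⌊y⌋₊).card ≤
      (Finset.univ.filter fun r : Fin n => r ∈ {r : Fin n | ((r : ℕ) : ℝ) + 1 ≤ y}).card := by
    refine Finset.card_le_card_of_surjOn (fun r => (r : ℕ)) (fun a ha => ?_)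
    have ha' : a < ⌊y⌋₊ := by simpa using ha
    refine ⟨⟨a, ha'.trans_le hfl⟩, ?_, rfl⟩
    simp only [Finset.coe_filter, Finset.mem_univ, true_and, Set.mem_ofPred_eq]
    have h1 : ((a + 1 : ℕ) : ℝ) ≤ y := (Nat.cast_le.mpr ha').trans (Nat.floor_le h0)
    exact_mod_cast h1
  rw [Finset.card_range] at h
  have h2 : ((⌊y⌋₊ : ℕ) : ℝ) ≤ _ := Nat.cast_le.mpr h
  linarith [Nat.lt_floor_add_one y]

open scoped Classical in
/-- The number of nodes whose initial rank is at most a prescribed bound. -/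
noncomputable def rankCount {n : ℕ} (τ : Fin n → ℕ) (θ : Fin n → ℝ) (R : ℕ → Fin n) : ℕ :=
  (Finset.univ.filter fun i => ((R (τ i) : ℕ) : ℝ) + 1 ≤ θ i).card

theorem rankCount_eq_sum {n : ℕ} (τ : Fin n → ℕ) (θ : Fin n → ℝ) (R : ℕ → Fin n) :
    (rankCount τ θ R : ℝ) =
      ∑ i, {r : Fin n | ((r : ℕ) : ℝ) + 1 ≤ θ i}.indicator (1 : Fin n → ℝ) (R (τ i)) := by
  classical
  rw [rankCount, Finset.card_filter]
  simp [Set.indicator_apply]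

theorem seqLaw_map_apply {n : ℕ} [NeZero n] {τ : Fin n → ℕ} (hτ : Function.Injective τ)
    (A : Set (Fin n → Fin n)) :
    seqLaw (unif n) {R | (fun i => R (τ i)) ∈ A} = (Measure.pi fun _ : Fin n => unif n) A := by
  rw [← map_precomp_seqLaw (unif n) hτ,
    Measure.map_apply (measurable_comp_right τ) (Set.to_countable A).measurableSet]
  rfl

theorem measurableSet_comp_right {n : ℕ} (τ : Fin n → ℕ) (A : Set (Fin n → Fin n)) :
    MeasurableSet {R : ℕ → Fin n | (fun i => R (τ i)) ∈ A} :=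
  measurable_comp_right τ (Set.to_countable A).measurableSet

theorem seqLaw_rankCount_ge_le {n : ℕ} [NeZero n] {τ : Fin n → ℕ} (hτ : Function.Injective τ)
    {θ : Fin n → ℝ} (hθ : ∀ i, 0 ≤ θ i) {M u l : ℝ} (hM : ∑ i, θ i / n ≤ M)
    (hl0 : 0 ≤ l) (hl1 : l ≤ 1) :
    seqLaw (unif n) {R | M + u ≤ rankCount τ θ R} ≤
      ENNReal.ofReal (Real.exp (-(l * u) + l ^ 2 * M)) := by
  have h := measureReal_sum_indicator_ge_le (fun _ : Fin n => unif n)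
    (S := fun i => {r : Fin n | ((r : ℕ) : ℝ) + 1 ≤ θ i}) (M := M) (s := u) (l := l)
    (fun i => (Set.to_countable _).measurableSet)
    ((Finset.sum_le_sum fun i _ => unif_real_le (hθ i)).trans hM) hl0 hl1
  simp only [rankCount_eq_sum]
  refine (le_of_eq (seqLaw_map_apply hτ {z | M + u ≤
    ∑ i, {r : Fin n | ((r : ℕ) : ℝ) + 1 ≤ θ i}.indicator (1 : Fin n → ℝ) (z i)})).trans ?_
  rw [← ENNReal.ofReal_toReal (measure_ne_top _ _)]
  exact ENNReal.ofReal_le_ofReal h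

theorem seqLaw_rankCount_le_le {n : ℕ} [NeZero n] {τ : Fin n → ℕ} (hτ : Function.Injective τ)
    {θ : Fin n → ℝ} (hθ : ∀ i, θ i ≤ n) {M u l : ℝ} (hM0 : 0 ≤ M)
    (hM : M ≤ ∑ i, (θ i - 1) / n) (hl0 : 0 ≤ l) (hl1 : l ≤ 1) :
    seqLaw (unif n) {R | (rankCount τ θ R : ℝ) ≤ M - u} ≤
      ENNReal.ofReal (Real.exp (-(l * u) + l ^ 2 * M)) := by
  have h := measureReal_sum_indicator_le_le (fun _ : Fin n => unif n)
    (S := fun i => {r : Fin n | ((r : ℕ) : ℝ) + 1 ≤ θ i}) (M := M) (s := u) (l := l)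
    (fun i => (Set.to_countable _).measurableSet) hM0
    (hM.trans (Finset.sum_le_sum fun i _ => le_unif_real (hθ i))) hl0 hl1
  simp only [rankCount_eq_sum]
  refine (le_of_eq (seqLaw_map_apply hτ {z |
    ∑ i, {r : Fin n | ((r : ℕ) : ℝ) + 1 ≤ θ i}.indicator (1 : Fin n → ℝ) (z i) ≤ M - u})).trans ?_
  rw [← ENNReal.ofReal_toReal (measure_ne_top _ _)]
  exact ENNReal.ofReal_le_ofReal h

theorem measurableSet_rankCount {n : ℕ} (τ : Fin n → ℕ) (θ : Fin n → ℝ) (Q : ℕ → Prop) :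
    MeasurableSet {R : ℕ → Fin n | Q (rankCount τ θ R)} := by
  classical
  exact measurableSet_comp_right τ
    {z | Q (Finset.univ.filter fun i => ((z i : ℕ) : ℝ) + 1 ≤ θ i).card}

end Counts

/-! ### Bounds for the expected degree -/

section Means

/-- All the relevant ranks are taken at the same time, the birth of `i`, so they are distinct and
the sum is at most the one over all ranks. -/
theorem oldMean_le {α β : ℝ} (hα0 : 0 < α) (hα1 : α < 1) {n : ℕ} (hn : 1 ≤ n)
    (σ : Equiv.Perm (Fin n)) (D R : ℕ → Fin n) (τ : Fin n → ℕ) (i : Fin n) :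
    oldMean α β i (fun j => decide (τ i < τ j)) (olderRank σ D R τ i) ≤
      (n : ℝ) ^ (1 - α - β) / (1 - α) := by
  have hn0 : (0 : ℝ) < n := by exact_mod_cast hn
  have h1 : oldMean α β i (fun j => decide (τ i < τ j)) (olderRank σ D R τ i) ≤
      ∑ j, (((rankAt σ D R (τ i) j : ℕ) : ℝ) + 1) ^ (-α) * (n : ℝ) ^ (-β) := by
    refine Finset.sum_le_sum fun j _ => ?_
    split_ifs with h
    · have h2 : ¬ τ i < τ j := by simpa using h.2
      rw [olderRank, if_neg h2]
      push_cast
      exact le_rfl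
    · positivity
  refine h1.trans ?_
  rw [← Finset.sum_mul,
    Equiv.sum_comp (rankAt σ D R (τ i)) (fun a : Fin n => (((a : ℕ) : ℝ) + 1) ^ (-α)),
    Fin.sum_univ_eq_sum_range (fun a : ℕ => ((a : ℝ) + 1) ^ (-α))]
  refine (mul_le_mul_of_nonneg_right (sum_rpow_neg_le hα0 hα1 hn) (by positivity)).trans
    (le_of_eq ?_)
  rw [div_mul_eq_mul_div, ← Real.rpow_add hn0, sub_eq_add_neg (1 - α) β]

theorem olderRank_mem {n : ℕ} {σ : Equiv.Perm (Fin n)} {D R : ℕ → Fin n} {τ : Fin n → ℕ} {T : ℕ}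
    (hτ : ∀ i, LastDel D i (τ i) T) {Δ : ℝ}
    (hW : ∀ t₀ < T, ∀ t < T, (D, R) ∉ rankMoves σ Δ t₀ t) {i j : Fin n} (hij : τ i < τ j) :
    ((R (τ i) : ℕ) : ℝ) + 1 - Δ ≤ olderRank σ D R τ i j ∧
      (olderRank σ D R τ i j : ℝ) ≤ ((R (τ i) : ℕ) : ℝ) + 1 + Δ := by
  have hj := (hτ j).1
  -- The node `i` has its rank `R (τ i)` at time `τ i + 1`; this is the number of steps from then to
  -- the birth of `j`.
  have h := hW (τ i) (hτ i).1 (τ j - (τ i + 1)) (by omega)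
  have h1 : |((rankAt σ D R (τ j) i : ℕ) : ℝ) - (R (τ i) : ℕ)| ≤ Δ := by
    by_contra hlt
    refine h ⟨fun u hu hu' => ?_, ?_⟩
    · dsimp only
      rw [(hτ i).2.1]
      exact (hτ i).2.2 u hu (by omega)
    · dsimp only
      rw [(hτ i).2.1, show τ i + 1 + (τ j - (τ i + 1)) = τ j by omega]
      exact not_le.mp hlt
  rw [olderRank, if_pos hij]
  push_cast
  rw [abs_le] at h1
  constructor <;> linarith [h1.1, h1.2]

theorem youngMean_eq {α β p : ℝ} {n : ℕ} (τ : Fin n → ℕ) (i : Fin n) (r : Fin n → ℕ) :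
    youngMean α β p i (fun j => decide (τ i < τ j)) r =
      ∑ j ∈ Finset.univ.filter (fun j => τ i < τ j), p * ((r j : ℝ) ^ (-α) * (n : ℝ) ^ (-β)) := by
  rw [youngMean, Finset.sum_filter]
  refine Finset.sum_congr rfl fun j _ => ?_
  by_cases h : τ i < τ j
  · have : j ≠ i := fun hji => by subst hji; exact lt_irrefl _ h
    simp [h, this]
  · simp [h]

theorem youngMean_le {α β p : ℝ} (hα : 0 ≤ α) (hp : 0 ≤ p) {n : ℕ} {τ : Fin n → ℕ} {i : Fin n}
    {r : Fin n → ℕ} {y : ℝ} (hy : 0 < y) (hr : ∀ j, τ i < τ j → y ≤ r j) :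
    youngMean α β p i (fun j => decide (τ i < τ j)) r ≤
      youngerCount τ i * (p * (y ^ (-α) * (n : ℝ) ^ (-β))) := by
  rw [youngMean_eq, youngerCount, ← nsmul_eq_mul]
  refine Finset.sum_le_card_nsmul _ _ _ fun j hj => ?_
  have h : τ i < τ j := by simpa using hj
  have := Real.rpow_le_rpow_of_nonpos hy (hr j h) (neg_nonpos.mpr hα)
  gcongr

theorem le_youngMean {α β p : ℝ} (hα : 0 ≤ α) (hp : 0 ≤ p) {n : ℕ} {τ : Fin n → ℕ} {i : Fin n}
    {r : Fin n → ℕ} {y : ℝ} (h1 : ∀ j, 1 ≤ r j) (hr : ∀ j, τ i < τ j → (r j : ℝ) ≤ y) :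
    youngerCount τ i * (p * (y ^ (-α) * (n : ℝ) ^ (-β))) ≤
      youngMean α β p i (fun j => decide (τ i < τ j)) r := by
  rw [youngMean_eq, youngerCount, ← nsmul_eq_mul]
  refine Finset.card_nsmul_le_sum _ _ _ fun j hj => ?_
  have h : τ i < τ j := by simpa using hj
  have h0 : (0 : ℝ) < r j := by exact_mod_cast h1 j
  have := Real.rpow_le_rpow_of_nonpos h0 (hr j h) (neg_nonpos.mpr hα)
  gcongr

end Means

/-! ### Initial ranks that decide whether the degree reaches k -/

section Estimates

/-- With `w = (a / n) ^ (1 / α)` the left side is `k (x w / y) ^ α`. As `w ≤ 1`, `y ≥ x w (1 + 8 η /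
α)`; the rest is `(1 + 8 η / α) ^ α ≥ 1 + 4 η` and `(1 - 2 η) (1 + 4 η) ≥ 1` for `η ≤ 1 / 4`. -/
theorem youngMean_bound_le {α β p η x y a n k : ℝ} (hα0 : 0 < α) (hη0 : 0 < η) (hη : η ≤ α / 4)
    (hη4 : η ≤ 1 / 4) (hx : 0 < x) (hn : 0 < n) (ha0 : 0 ≤ a) (han : a ≤ n) (hk : 0 ≤ k)
    (hkx : k * x ^ α = p * n ^ (1 - β))
    (hy : x * ((a / n) ^ (1 / α) + 8 / α * η) ≤ y) :
    a * (p * (y ^ (-α) * n ^ (-β))) ≤ (1 - 2 * η) * k := by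
  set w := (a / n) ^ (1 / α) with hw
  have haw : a = n * w ^ α := by
    rw [hw, ← Real.rpow_mul (by positivity), one_div_mul_cancel hα0.ne', Real.rpow_one]
    field_simp
  have hw0 : 0 ≤ w := by positivity
  have hw1 : w ≤ 1 := Real.rpow_le_one (by positivity) ((div_le_one hn).mpr han) (by positivity)
  have hy0 : 0 < y := lt_of_lt_of_le (by positivity) hy
  have h1 : (1 + 4 * η) ≤ (1 + 8 / α * η) ^ α := by
    have h2 : 4 * η * (1 / α) ≤ 1 := by
      rw [mul_one_div, div_le_one hα0]; linarith
    have h2' : 0 ≤ 4 * η * (1 / α) := by positivity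
    have h3 : (1 + 4 * η) ^ (1 / α) ≤ 1 + 8 / α * η := by
      calc (1 + 4 * η) ^ (1 / α) ≤ Real.exp (4 * η) ^ (1 / α) := by
            refine Real.rpow_le_rpow (by positivity) ?_ (by positivity)
            linarith [Real.add_one_le_exp (4 * η)]
        _ = Real.exp (4 * η * (1 / α)) := (Real.exp_mul _ _).symm
        _ ≤ 1 + 4 * η * (1 / α) + (4 * η * (1 / α)) ^ 2 :=
            exp_le_one_add_add_sq (abs_le.mpr ⟨by linarith, h2⟩)
        _ ≤ 1 + 8 / α * η := by
            have : 8 / α * η = 2 * (4 * η * (1 / α)) := by ring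
            nlinarith
    calc 1 + 4 * η = ((1 + 4 * η) ^ (1 / α)) ^ α := by
          rw [← Real.rpow_mul (by positivity), one_div_mul_cancel hα0.ne', Real.rpow_one]
      _ ≤ _ := Real.rpow_le_rpow (by positivity) h3 hα0.le
  have h4 : (x * w) ^ α * (1 + 4 * η) ≤ y ^ α := by
    calc (x * w) ^ α * (1 + 4 * η) ≤ (x * w) ^ α * (1 + 8 / α * η) ^ α := by gcongr
      _ = (x * w * (1 + 8 / α * η)) ^ α := (Real.mul_rpow (by positivity) (by positivity)).symm
      _ ≤ y ^ α := by
          refine Real.rpow_le_rpow (by positivity) (le_trans ?_ hy) hα0.le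
          have : w * (8 / α * η) ≤ 1 * (8 / α * η) := by gcongr
          nlinarith
  have h5 : a * (p * (y ^ (-α) * n ^ (-β))) = k * (x * w) ^ α / y ^ α := by
    rw [Real.mul_rpow hx.le hw0, Real.rpow_neg hy0.le, ← mul_assoc k, hkx, haw,
      show (1 - β) = 1 + -β by ring, Real.rpow_add hn, Real.rpow_one]
    ring
  rw [h5, div_le_iff₀ (by positivity)]
  have h6 : 0 ≤ (x * w) ^ α := by positivity
  have h7 : (x * w) ^ α ≤ (1 - 2 * η) * y ^ α := by
    have : (1 - 2 * η) * ((x * w) ^ α * (1 + 4 * η)) ≤ (1 - 2 * η) * y ^ α :=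
      mul_le_mul_of_nonneg_left h4 (by linarith)
    have h8 : 0 ≤ (x * w) ^ α * (2 * η - 8 * η ^ 2) := mul_nonneg h6 (by nlinarith)
    nlinarith
  nlinarith

/-- The same formula `k (x w / y) ^ α`, now with `y ≤ x w (1 - η / α)` and `(1 - η / α) ^ α (1 + η)
≤ e ^ (-η) e ^ η = 1`. -/
theorem le_youngMean_bound {α β p η x y a n k : ℝ} (hα0 : 0 < α) (hη0 : 0 < η)
    (hx : 0 < x) (hn : 0 < n) (ha0 : 0 ≤ a) (han : a ≤ n) (hk : 0 ≤ k)
    (hkx : k * x ^ α = p * n ^ (1 - β)) (hy0 : 0 < y)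
    (hy : y ≤ x * ((a / n) ^ (1 / α) - 1 / α * η)) :
    (1 + η) * k ≤ a * (p * (y ^ (-α) * n ^ (-β))) := by
  set w := (a / n) ^ (1 / α) with hw
  have haw : a = n * w ^ α := by
    rw [hw, ← Real.rpow_mul (by positivity), one_div_mul_cancel hα0.ne', Real.rpow_one]
    field_simp
  have hw0 : 0 ≤ w := by positivity
  have hw1 : w ≤ 1 := Real.rpow_le_one (by positivity) ((div_le_one hn).mpr han) (by positivity)
  have hpos : 0 < w - 1 / α * η := by
    by_contra h
    have := mul_nonpos_of_nonneg_of_nonpos hx.le (not_lt.mp h)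
    linarith
  have hc0 : 0 < 1 - 1 / α * η := by linarith
  have h1 : (1 - 1 / α * η) ^ α * (1 + η) ≤ 1 := by
    calc (1 - 1 / α * η) ^ α * (1 + η) ≤ Real.exp (-(1 / α * η)) ^ α * Real.exp η := by
          refine mul_le_mul (Real.rpow_le_rpow hc0.le ?_ hα0.le) ?_ (by positivity) (by positivity)
          · linarith [Real.add_one_le_exp (-(1 / α * η))]
          · linarith [Real.add_one_le_exp η]
      _ = 1 := by
          rw [← Real.exp_mul, ← Real.exp_add, Real.exp_eq_one_iff]
          field_simp
          ring
  have h4 : y ^ α * (1 + η) ≤ (x * w) ^ α := by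
    calc y ^ α * (1 + η) ≤ (x * w * (1 - 1 / α * η)) ^ α * (1 + η) := by
          refine mul_le_mul_of_nonneg_right (Real.rpow_le_rpow hy0.le (hy.trans ?_) hα0.le)
            (by positivity)
          have : w * (1 / α * η) ≤ 1 * (1 / α * η) := by gcongr
          nlinarith
      _ = (x * w) ^ α * ((1 - 1 / α * η) ^ α * (1 + η)) := by
          rw [Real.mul_rpow (by positivity) hc0.le]; ring
      _ ≤ (x * w) ^ α * 1 := by gcongr
      _ = _ := mul_one _
  have h5 : a * (p * (y ^ (-α) * n ^ (-β))) = k * (x * w) ^ α / y ^ α := by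
    rw [Real.mul_rpow hx.le hw0, Real.rpow_neg hy0.le, ← mul_assoc k, hkx, haw,
      show (1 - β) = 1 + -β by ring, Real.rpow_add hn, Real.rpow_one]
    ring
  rw [h5, le_div_iff₀ (by positivity)]
  nlinarith

/-- Nodes whose initial rank exceeds this bound typically have degree less than `k`. -/
noncomputable def upperThreshold (α η x : ℝ) {n : ℕ} (τ : Fin n → ℕ) (i : Fin n) : ℝ :=
  x * (((youngerCount τ i : ℕ) / n : ℝ) ^ (1 / α) + (8 / α + 1) * η)

/-- Nodes whose initial rank is at most this bound typically have degree at least `k`. -/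
noncomputable def lowerThreshold (α η x : ℝ) {n : ℕ} (τ : Fin n → ℕ) (i : Fin n) : ℝ :=
  x * (((youngerCount τ i : ℕ) / n : ℝ) ^ (1 / α) - (1 / α + 1) * η)

open scoped Classical in
/-- Up to an unlikely event, the thresholds for the initial ranks decide about the degrees. -/
theorem seqLaw_degree_deviation_le {α β : ℝ} (hα0 : 0 < α) (hα1 : α < 1) (hβ : 0 ≤ β)
    (p : unitInterval) {m n k : ℕ} (hm : 1 ≤ m) (hn : 1 ≤ n) {η x Δ : ℝ} (hη0 : 0 < η)
    (hη : η ≤ α / 4) (hx : 0 < x)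
    (hkx : (k : ℝ) * x ^ α = p * (n : ℝ) ^ (1 - β)) (hΔ0 : 0 ≤ Δ) (hΔ : Δ ≤ η * x)
    (hold : (n : ℝ) ^ (1 - α - β) / (1 - α) ≤ η * k)
    (s : State n m) (D R : ℕ → Fin n) {T : ℕ} {τ : Fin n → ℕ} (hτ : ∀ i, LastDel D i (τ i) T)
    (hW : ∀ t₀ < T, ∀ t < T, (D, R) ∉ rankMoves s.rank Δ t₀ t) :
    seqLaw (birthLaw p n m) {B | ∃ i,
      (upperThreshold α η x τ i < ((R (τ i) : ℕ) : ℝ) + 1 ∧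
        k ≤ (run α β s (B, D, R) T).graph.degree i) ∨
      (((R (τ i) : ℕ) : ℝ) + 1 ≤ lowerThreshold α η x τ i ∧
        (run α β s (B, D, R) T).graph.degree i < k)} ≤
      ENNReal.ofReal (n * (2 * Real.exp (-(η ^ 2 * k / 8)))) := by
  have hn0 : (0 : ℝ) < n := by exact_mod_cast hn
  have hk0 : (0 : ℝ) ≤ k := Nat.cast_nonneg k
  have hη4 : η ≤ 1 / 4 := by linarith
  have hηk : 0 ≤ η ^ 2 * k := by positivity
  have hage (i : Fin n) : ((youngerCount τ i : ℕ) : ℝ) ≤ n := by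
    exact_mod_cast (youngerCount_lt τ i).le
  have hupper (i : Fin n) : seqLaw (birthLaw p n m) {B |
      upperThreshold α η x τ i < ((R (τ i) : ℕ) : ℝ) + 1 ∧
        k ≤ (run α β s (B, D, R) T).graph.degree i} ≤
      ENNReal.ofReal (Real.exp (-(η ^ 2 * k / 8))) := by
    by_cases hρ : upperThreshold α η x τ i < ((R (τ i) : ℕ) : ℝ) + 1
    swap
    · simp [hρ]
    -- The extra `η` in the threshold pays for the displacement `Δ ≤ η x` of the rank.
    have hy : x * (((youngerCount τ i : ℕ) / n : ℝ) ^ (1 / α) + 8 / α * η) ≤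
        ((R (τ i) : ℕ) : ℝ) + 1 - Δ := by
      unfold upperThreshold at hρ
      linarith
    have hy0 : 0 < ((R (τ i) : ℕ) : ℝ) + 1 - Δ := lt_of_lt_of_le (by positivity) hy
    have h1 := youngMean_le (β := β) hα0.le p.2.1 (r := olderRank s.rank D R τ i) hy0
      fun j hj => (olderRank_mem hτ hW hj).1
    have h2 := youngMean_bound_le hα0 hη0 hη hη4 hx hn0 (Nat.cast_nonneg _) (hage i) hk0 hkx hy
    have h3 := oldMean_le (β := β) hα0 hα1 hn s.rank D R τ i
    -- The mean `(1 - η) k` consists of `(1 - 2 η) k` for the younger nodes and `η k` for the older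
    -- ones.
    have h4 := seqLaw_degree_ge_le hα0.le hβ p hm hn s D R hτ i (M := (1 - η) * k) (u := η * k)
      (l := η / 2) (by linarith) (by linarith) (by linarith)
    refine le_trans (measure_mono fun B hB => ?_) (h4.trans (ENNReal.ofReal_le_ofReal
      (Real.exp_le_exp.mpr ?_)))
    · have h5 : (k : ℝ) ≤ (run α β s (B, D, R) T).graph.degree i := by exact_mod_cast hB.2
      simp only [Set.mem_ofPred_eq]
      linarith
    · nlinarith [mul_nonneg hη0.le hηk]
  have hlower (i : Fin n) : seqLaw (birthLaw p n m) {B |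
      ((R (τ i) : ℕ) : ℝ) + 1 ≤ lowerThreshold α η x τ i ∧
        (run α β s (B, D, R) T).graph.degree i < k} ≤
      ENNReal.ofReal (Real.exp (-(η ^ 2 * k / 8))) := by
    by_cases hρ : ((R (τ i) : ℕ) : ℝ) + 1 ≤ lowerThreshold α η x τ i
    swap
    · simp [hρ]
    have hy : ((R (τ i) : ℕ) : ℝ) + 1 + Δ ≤
        x * (((youngerCount τ i : ℕ) / n : ℝ) ^ (1 / α) - 1 / α * η) := by
      unfold lowerThreshold at hρ
      linarith
    have hy0 : 0 < ((R (τ i) : ℕ) : ℝ) + 1 + Δ := by positivity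
    have h1 := le_youngMean (β := β) hα0.le p.2.1 (τ := τ) (i := i)
      (r := olderRank s.rank D R τ i) (fun j => by unfold olderRank; split_ifs <;> omega)
      fun j hj => (olderRank_mem hτ hW hj).2
    have h2 := le_youngMean_bound hα0 hη0 hx hn0 (Nat.cast_nonneg _) (hage i) hk0 hkx hy0 hy
    have h4 := seqLaw_degree_le_le hα0.le hβ p hm hn s D R hτ i (M := (1 + η) * k) (u := η * k)
      (l := η / 4) (by positivity) (h2.trans h1) (by linarith) (by linarith)
    refine le_trans (measure_mono fun B hB => ?_) (h4.trans (ENNReal.ofReal_le_ofReal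
      (Real.exp_le_exp.mpr ?_)))
    · have h5 : ((run α β s (B, D, R) T).graph.degree i : ℝ) < k := by exact_mod_cast hB.2
      simp only [Set.mem_ofPred_eq]
      linarith
    · nlinarith [mul_nonneg hη0.le hηk]
  have hunion : {B | ∃ i,
      (upperThreshold α η x τ i < ((R (τ i) : ℕ) : ℝ) + 1 ∧
        k ≤ (run α β s (B, D, R) T).graph.degree i) ∨
      (((R (τ i) : ℕ) : ℝ) + 1 ≤ lowerThreshold α η x τ i ∧
        (run α β s (B, D, R) T).graph.degree i < k)} =
      ⋃ i : Fin n, ({B | upperThreshold α η x τ i < ((R (τ i) : ℕ) : ℝ) + 1 ∧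
        k ≤ (run α β s (B, D, R) T).graph.degree i} ∪
      {B | ((R (τ i) : ℕ) : ℝ) + 1 ≤ lowerThreshold α η x τ i ∧
        (run α β s (B, D, R) T).graph.degree i < k}) := by
    ext B
    simp
  rw [hunion]
  refine (measure_iUnion_fintype_le _ _).trans ?_
  calc _ ≤ ∑ _i : Fin n, ENNReal.ofReal (2 * Real.exp (-(η ^ 2 * k / 8))) := by
        refine Finset.sum_le_sum fun i _ => (measure_union_le _ _).trans ?_
        rw [two_mul, ENNReal.ofReal_add (Real.exp_pos _).le (Real.exp_pos _).le]
        exact add_le_add (hupper i) (hlower i)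
    _ = _ := by
        rw [Finset.sum_const, Finset.card_univ, Fintype.card_fin, nsmul_eq_mul,
          ENNReal.ofReal_mul hn0.le, ENNReal.ofReal_natCast]

theorem sum_upperThreshold_le {α η x : ℝ} (hα0 : 0 < α) (hx : 0 ≤ x) {n : ℕ}
    (hn : 1 ≤ n) {τ : Fin n → ℕ} (hτ : Function.Injective τ) :
    ∑ i, upperThreshold α η x τ i / n ≤ x * (α / (α + 1) + (8 / α + 1) * η) := by
  have hn0 : (0 : ℝ) < n := by exact_mod_cast hn
  have h1 := sum_youngerCount hτ fun a => (a / n : ℝ) ^ (1 / α)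
  have h2 := sum_rpow_le (q := 1 / α) (by positivity) hn
  rw [← Finset.sum_div, div_le_iff₀ hn0]
  simp only [upperThreshold, ← Finset.mul_sum, Finset.sum_add_distrib, h1]
  rw [mul_assoc x]
  refine mul_le_mul_of_nonneg_left ?_ hx
  simp only [Finset.sum_const, Finset.card_univ, Fintype.card_fin, nsmul_eq_mul]
  have h3 : (n : ℝ) / (1 / α + 1) = α / (α + 1) * n := by field_simp; ring
  rw [h3] at h2
  linarith

/-- One unit of the loss `2` comes from the Riemann sum, as `x / n ≤ 1`, the other from the `n`
terms `-1 / n`. -/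
theorem le_sum_lowerThreshold {α η x : ℝ} (hα0 : 0 < α) (hx : 0 ≤ x) {n : ℕ}
    (hn : 1 ≤ n) (hxn : x ≤ n) {τ : Fin n → ℕ} (hτ : Function.Injective τ) :
    x * (α / (α + 1) - (1 / α + 1) * η) - 2 ≤ ∑ i, (lowerThreshold α η x τ i - 1) / n := by
  have hn0 : (0 : ℝ) < n := by exact_mod_cast hn
  have h1 := sum_youngerCount hτ fun a => (a / n : ℝ) ^ (1 / α)
  have h2 := le_sum_rpow (q := 1 / α) (by positivity) hn
  rw [← Finset.sum_div, le_div_iff₀ hn0]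
  simp only [lowerThreshold, Finset.sum_sub_distrib, ← Finset.mul_sum, h1]
  simp only [Finset.sum_const, Finset.card_univ, Fintype.card_fin, nsmul_eq_mul]
  have h3 : (n : ℝ) / (1 / α + 1) = α / (α + 1) * n := by field_simp; ring
  rw [h3] at h2
  have h4 := mul_le_mul_of_nonneg_left h2 hx
  nlinarith

end Estimates

/-! ### The deviation probability after T steps -/

section Union

theorem measurableSet_graph {n m : ℕ} (Q : SimpleGraph (Fin n) → Prop) :
    MeasurableSet {s : State n m | Q s.graph} := by
  have hS : Measurable fun s : State n m => (s.pos, (s.rank : Fin n → Fin n), s.graph) :=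
    comap_measurable _
  have hG : Measurable fun s : State n m => s.graph.Adj :=
    SimpleGraph.measurable_adj.comp hS.snd.snd
  have h : {s : State n m | Q s.graph} =
      (fun s : State n m => s.graph.Adj) ⁻¹' {r | ∃ G, G.Adj = r ∧ Q G} := by
    ext s
    constructor
    · exact fun hs => ⟨s.graph, rfl, hs⟩
    · rintro ⟨G, hG, hQ⟩
      obtain rfl : G = s.graph := SimpleGraph.ext hG
      exact hQ
  rw [h]
  exact hG (Set.to_countable _).measurableSet

theorem exists_lastDel {n T : ℕ} {D : ℕ → Fin n} (hD : D ∉ notReplaced n T) :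
    ∃ τ : Fin n → ℕ, ∀ i, LastDel D i (τ i) T := by
  classical
  have h (i : Fin n) : ∃ t, LastDel D i t T := by
    have h1 : ∃ t < T, D t = i := by
      by_contra hne
      push Not at hne
      exact hD ⟨i, hne⟩
    obtain ⟨t, ht, hti⟩ := h1
    have h2 : ((Finset.range T).filter fun t => D t = i).Nonempty := ⟨t, by simp [ht, hti]⟩
    have h3 := Finset.max'_mem _ h2
    simp only [Finset.mem_filter, Finset.mem_range] at h3
    refine ⟨_, h3.1, h3.2, fun u hu hut hui => ?_⟩
    exact absurd (Finset.le_max' _ u (by simp [hut, hui])) (not_le.mpr hu)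
  choose τ hτ using h
  exact ⟨τ, hτ⟩

/-- The probability that the number of nodes of large degree deviates from its typical value after
`T` steps. -/
theorem pathLaw_deviation_le {α β : ℝ} (hα0 : 0 < α) (hα1 : α < 1) (hβ : 0 ≤ β)
    (p : unitInterval) {m n k : ℕ} (hm : 1 ≤ m) (hn : 1 ≤ n) {η x Δ : ℝ} (hη0 : 0 < η)
    (hη : η ≤ α / 4) (hx : 0 < x)
    (hkx : (k : ℝ) * x ^ α = p * (n : ℝ) ^ (1 - β)) (hΔ0 : 0 ≤ Δ) (hΔ : Δ ≤ η * x)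
    (hold : (n : ℝ) ^ (1 - α - β) / (1 - α) ≤ η * k) (hxn : x ≤ n) (hηx : 1 ≤ η * x)
    (hη2 : (8 / α + 1) * η ≤ 1 - α / (α + 1)) (hη3 : (1 / α + 3) * η ≤ α / (α + 1))
    {u l l' : ℝ} (hu : u ≤ 2 * (η * x)) (hl0 : 0 ≤ l) (hl1 : l ≤ 1) (hl0' : 0 ≤ l') (hl1' : l' ≤ 1)
    (s : State n m) (T : ℕ) :
    pathLaw p n m {ω | run α β s ω T ∈ {s : State n m |
        ¬ |(numDegreeGE s.graph k : ℝ) - α / (α + 1) * x| ≤ (8 / α + 5) * (η * x)}} ≤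
      ENNReal.ofReal (n * Real.exp (-(T / n)) +
        T * (T * (2 * Real.exp (-(l * Δ) + T * (l / n + l ^ 2)))) +
        2 * Real.exp (-(l' * u) + l' ^ 2 * n) + n * (2 * Real.exp (-(η ^ 2 * k / 8)))) := by
  classical
  have hn0 : (0 : ℝ) < n := by exact_mod_cast hn
  have : NeZero n := ⟨by omega⟩
  set A := {s : State n m |
    ¬ |(numDegreeGE s.graph k : ℝ) - α / (α + 1) * x| ≤ (8 / α + 5) * (η * x)} with hA
  have hAm : MeasurableSet A := measurableSet_graph fun G =>
    ¬ |(numDegreeGE G k : ℝ) - α / (α + 1) * x| ≤ (8 / α + 5) * (η * x)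
  set W : Set ((ℕ → Fin n) × (ℕ → Fin n)) :=
    ⋃ t₀ : Fin T, ⋃ t : Fin T, rankMoves s.rank Δ t₀ t with hWdef
  have hWm : MeasurableSet W := MeasurableSet.iUnion fun t₀ => MeasurableSet.iUnion fun t =>
    measurableSet_rankMoves _ _ _ _
  set e1 := n * Real.exp (-(T / n)) with he1
  set e2 := T * (T * (2 * Real.exp (-(l * Δ) + T * (l / n + l ^ 2)))) with he2
  set e3 := 2 * Real.exp (-(l' * u) + l' ^ 2 * n) with he3
  set e4 := n * (2 * Real.exp (-(η ^ 2 * k / 8))) with he4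
  have hWle : rankLaw n W ≤ ENNReal.ofReal e2 := by
    refine (measure_iUnion_fintype_le _ _).trans ((Finset.sum_le_sum fun (t₀ : Fin T) _ =>
      (measure_iUnion_fintype_le _ _).trans (Finset.sum_le_sum fun (t : Fin T) _ =>
        (rankLaw_rankMoves_le hl0 hl1 s.rank Δ t₀ t).trans (ENNReal.ofReal_le_ofReal
          (q := 2 * Real.exp (-(l * Δ) + T * (l / n + l ^ 2))) ?_))).trans (le_of_eq ?_))
    · have : ((t : ℕ) : ℝ) ≤ T := by exact_mod_cast t.isLt.le
      gcongr
    · simp only [Finset.sum_const, Finset.card_univ, Fintype.card_fin, nsmul_eq_mul]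
      rw [he2, ENNReal.ofReal_mul (Nat.cast_nonneg T), ENNReal.ofReal_mul (Nat.cast_nonneg T),
        ENNReal.ofReal_natCast]
  -- the slice over the sequences of deleted nodes and of initial ranks
  let F : (ℕ → Fin n) × (ℕ → Fin n) → ENNReal := fun y =>
    seqLaw (birthLaw p n m) {B | run α β s (B, y) T ∈ A}
  have hF1 (y) : F y ≤ 1 := prob_le_one
  have hset : MeasurableSet {ω : Path n m | run α β s ω T ∈ A} := measurable_run_right α β s T hAm
  have hFm : Measurable F := measurable_measure_prodMk_right hset
  -- Once `D` is fixed, so are the birth times `τ` and the thresholds; what remains random are the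
  -- initial ranks and the births.
  have hslice {D : ℕ → Fin n} (hD : D ∉ notReplaced n T) :
      ∫⁻ R, F (D, R) ∂(seqLaw (unif n)) ≤
        seqLaw (unif n) (Prod.mk D ⁻¹' W) + ENNReal.ofReal (e3 + e4) := by
    obtain ⟨τ, hτ⟩ := exists_lastDel hD
    have hinj := LastDel.injective hτ
    set V1 : Set (ℕ → Fin n) := {R | x * (α / (α + 1) + (8 / α + 1) * η) + u ≤
      rankCount τ (upperThreshold α η x τ) R} with hV1
    set V2 : Set (ℕ → Fin n) := {R | (rankCount τ (lowerThreshold α η x τ) R : ℝ) ≤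
      (x * (α / (α + 1) - (1 / α + 1) * η) - 2) - u} with hV2
    have hV1m : MeasurableSet V1 := measurableSet_rankCount τ _ fun c =>
      x * (α / (α + 1) + (8 / α + 1) * η) + u ≤ c
    have hV2m : MeasurableSet V2 := measurableSet_rankCount τ _ fun c =>
      (c : ℝ) ≤ (x * (α / (α + 1) - (1 / α + 1) * η) - 2) - u
    have hl2 : 0 ≤ l' ^ 2 := sq_nonneg _
    have hκ : 0 ≤ α / (α + 1) := by positivity
    have hV1le : seqLaw (unif n) V1 ≤ ENNReal.ofReal (Real.exp (-(l' * u) + l' ^ 2 * n)) := by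
      refine (seqLaw_rankCount_ge_le hinj (fun i => ?_) (sum_upperThreshold_le hα0 hx.le hn hinj)
        hl0' hl1').trans (ENNReal.ofReal_le_ofReal (Real.exp_le_exp.mpr ?_))
      · unfold upperThreshold; positivity
      · have : x * (α / (α + 1) + (8 / α + 1) * η) ≤ n * 1 :=
          mul_le_mul hxn (by linarith) (by positivity) hn0.le
        rw [mul_one] at this
        exact add_le_add le_rfl (mul_le_mul_of_nonneg_left this hl2)
    have hV2le : seqLaw (unif n) V2 ≤ ENNReal.ofReal (Real.exp (-(l' * u) + l' ^ 2 * n)) := by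
      -- The lower tail bound needs a nonnegative mean; the `3` in `hη3` leaves `2 η x ≥ 2` to
      -- spare.
      have hnn : 0 ≤ x * (α / (α + 1) - (1 / α + 1) * η) - 2 := by
        have h1 := mul_le_mul_of_nonneg_left hη3 hx.le
        have h2 : x * (α / (α + 1) - (1 / α + 1) * η) =
          x * (α / (α + 1)) - x * ((1 / α + 3) * η) + 2 * (η * x) := by ring
        linarith
      refine (seqLaw_rankCount_le_le hinj (fun i => ?_) hnn
        (le_sum_lowerThreshold hα0 hx.le hn hxn hinj) hl0' hl1').trans
        (ENNReal.ofReal_le_ofReal (Real.exp_le_exp.mpr ?_))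
      · have h1 : ((youngerCount τ i : ℕ) / n : ℝ) ^ (1 / α) ≤ 1 := by
          refine Real.rpow_le_one (by positivity) ((div_le_one hn0).mpr ?_) (by positivity)
          exact_mod_cast (youngerCount_lt τ i).le
        have h2 : 0 ≤ (1 / α + 1) * η := by positivity
        refine (mul_le_mul_of_nonneg_left ?_ hx.le).trans ((mul_one x).le.trans hxn)
        linarith
      · have h2 : 0 ≤ (1 / α + 1) * η := by positivity
        have h3 : α / (α + 1) ≤ 1 := by
          rw [div_le_one (by linarith)]; linarith
        have h4 : x * (α / (α + 1) - (1 / α + 1) * η) ≤ x * 1 :=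
          mul_le_mul_of_nonneg_left (by linarith) hx.le
        exact add_le_add le_rfl (mul_le_mul_of_nonneg_left (by linarith) hl2)
    have hpt (R : ℕ → Fin n) : F (D, R) ≤ (Prod.mk D ⁻¹' W).indicator 1 R +
        (V1.indicator 1 R + (V2.indicator 1 R + ENNReal.ofReal e4)) := by
      by_cases hRW : R ∈ Prod.mk D ⁻¹' W
      · rw [Set.indicator_of_mem hRW]
        exact (hF1 _).trans le_self_add
      by_cases hR1 : R ∈ V1
      · rw [Set.indicator_of_mem hR1]
        exact ((hF1 _).trans le_self_add).trans le_add_self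
      by_cases hR2 : R ∈ V2
      · rw [Set.indicator_of_mem hR2]
        exact (((hF1 _).trans le_self_add).trans le_add_self).trans le_add_self
      refine le_trans ?_ (le_add_self.trans (le_add_self.trans le_add_self))
      have hW' : ∀ t₀ < T, ∀ t < T, (D, R) ∉ rankMoves s.rank Δ t₀ t := by
        intro t₀ ht₀ t ht hmem
        exact hRW (Set.mem_iUnion.mpr ⟨⟨t₀, ht₀⟩, Set.mem_iUnion.mpr ⟨⟨t, ht⟩, hmem⟩⟩)
      refine le_trans (measure_mono fun B hB => ?_)
        (seqLaw_degree_deviation_le hα0 hα1 hβ p hm hn hη0 hη hx hkx hΔ0 hΔ hold s D R hτ hW')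
      by_contra hno
      simp only [Set.mem_ofPred_eq, not_exists, not_or, not_and] at hno
      refine hB ?_
      set G := (run α β s (B, D, R) T).graph
      -- Off the exceptional event, the nodes of degree at least `k` are squeezed between the two
      -- threshold counts.
      have hN1 : numDegreeGE G k ≤ rankCount τ (upperThreshold α η x τ) R := by
        refine Finset.card_le_card fun i hi => ?_
        simp only [Finset.mem_filter, Finset.mem_univ, true_and] at hi ⊢
        by_contra hlt
        exact (hno i).1 (not_le.mp hlt) hi
      have hN2 : rankCount τ (lowerThreshold α η x τ) R ≤ numDegreeGE G k := by
        refine Finset.card_le_card fun i hi => ?_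
        simp only [Finset.mem_filter, Finset.mem_univ, true_and] at hi ⊢
        by_contra hlt
        exact (hno i).2 hi (not_le.mp hlt)
      have hN1' : (numDegreeGE G k : ℝ) ≤ rankCount τ (upperThreshold α η x τ) R := by
        exact_mod_cast hN1
      have hN2' : (rankCount τ (lowerThreshold α η x τ) R : ℝ) ≤ numDegreeGE G k := by
        exact_mod_cast hN2
      have h1 : (rankCount τ (upperThreshold α η x τ) R : ℝ) <
          x * (α / (α + 1) + (8 / α + 1) * η) + u := not_le.mp hR1
      have h2 : (x * (α / (α + 1) - (1 / α + 1) * η) - 2) - u <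
          rankCount τ (lowerThreshold α η x τ) R := not_le.mp hR2
      have h3 : 0 ≤ 1 / α * (η * x) := by positivity
      -- The `5` comes from the lower side: one `η x` from the threshold, two from `2 ≤ 2 η x`, two
      -- from `u`.
      have h4 : (8 / α + 5) * (η * x) = 8 * (1 / α * (η * x)) + 5 * (η * x) := by ring
      have h5 : x * (α / (α + 1) + (8 / α + 1) * η) =
          α / (α + 1) * x + 8 * (1 / α * (η * x)) + η * x := by ring
      have h6 : x * (α / (α + 1) - (1 / α + 1) * η) =
          α / (α + 1) * x - 1 / α * (η * x) - η * x := by ring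
      rw [h5] at h1
      rw [h6] at h2
      rw [h4, abs_le]
      constructor <;> linarith
    calc ∫⁻ R, F (D, R) ∂(seqLaw (unif n))
        ≤ ∫⁻ R, ((Prod.mk D ⁻¹' W).indicator 1 R +
          (V1.indicator 1 R + (V2.indicator 1 R + ENNReal.ofReal e4))) ∂(seqLaw (unif n)) :=
          lintegral_mono hpt
      _ = seqLaw (unif n) (Prod.mk D ⁻¹' W) + (seqLaw (unif n) V1 +
          (seqLaw (unif n) V2 + ENNReal.ofReal e4)) := by
          have hDW : MeasurableSet (Prod.mk D ⁻¹' W) := measurable_prodMk_left hWm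
          rw [lintegral_add_left (measurable_one.indicator hDW),
            lintegral_add_left (measurable_one.indicator hV1m),
            lintegral_add_left (measurable_one.indicator hV2m), lintegral_indicator_one hDW,
            lintegral_indicator_one hV1m, lintegral_indicator_one hV2m]
          simp
      _ ≤ _ := by
          refine add_le_add le_rfl ?_
          rw [ENNReal.ofReal_add (by positivity) (by positivity), ← add_assoc]
          refine add_le_add ?_ le_rfl
          rw [he3, two_mul, ENNReal.ofReal_add (Real.exp_pos _).le (Real.exp_pos _).le]
          exact add_le_add hV1le hV2le
  have hNR := measurableSet_notReplaced n T
  have hptD (D : ℕ → Fin n) : ∫⁻ R, F (D, R) ∂(seqLaw (unif n)) ≤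
      (notReplaced n T).indicator 1 D +
        (seqLaw (unif n) (Prod.mk D ⁻¹' W) + ENNReal.ofReal (e3 + e4)) := by
    by_cases hD : D ∈ notReplaced n T
    · rw [Set.indicator_of_mem hD]
      refine le_trans ?_ le_self_add
      calc _ ≤ ∫⁻ _ : ℕ → Fin n, 1 ∂(seqLaw (unif n)) := lintegral_mono fun R => hF1 _
        _ = _ := by simp
    · exact (hslice hD).trans le_add_self
  calc pathLaw p n m {ω | run α β s ω T ∈ A} = ∫⁻ y, F y ∂(rankLaw n) := by
        rw [pathLaw, Measure.prod_apply_symm hset]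
        rfl
    _ = ∫⁻ D, ∫⁻ R, F (D, R) ∂(seqLaw (unif n)) ∂(seqLaw (unif n)) := by
        rw [rankLaw, lintegral_prod _ hFm.aemeasurable]
    _ ≤ ∫⁻ D, ((notReplaced n T).indicator 1 D +
        (seqLaw (unif n) (Prod.mk D ⁻¹' W) + ENNReal.ofReal (e3 + e4))) ∂(seqLaw (unif n)) :=
        lintegral_mono hptD
    _ = seqLaw (unif n) (notReplaced n T) + (rankLaw n W + ENNReal.ofReal (e3 + e4)) := by
        rw [lintegral_add_left (measurable_one.indicator hNR), lintegral_indicator_one hNR,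
          lintegral_add_left (measurable_measure_prodMk_left hWm), rankLaw,
          Measure.prod_apply hWm]
        simp
    _ ≤ ENNReal.ofReal e1 + (ENNReal.ofReal e2 + ENNReal.ofReal (e3 + e4)) :=
        add_le_add (seqLaw_notReplaced_le n T) (add_le_add hWle le_rfl)
    _ = _ := by
        rw [← ENNReal.ofReal_add (by positivity) (by positivity),
          ← ENNReal.ofReal_add (by positivity) (by positivity)]
        congr 1
        ring

end Union

/-! ### Choice of the parameters for large n -/

section Asymptotics

open Filter Topology

/-- What is needed of the number of nodes. -/
structure LargeEnough (α β p η₀ : ℝ) (n : ℕ) : Prop where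
  ten_le_log : 10 ≤ Real.log n
  log_rpow_le : Real.log n ^ (-1 / 3 : ℝ) ≤ η₀
  six_le : 6 ≤ p ^ (1 / α) * Real.log n ^ (2 / 3 : ℝ)
  inv_le : 1 / (1 - α) ≤ Real.log n ^ (1 / 6 : ℝ)
  log_le_sqrt : Real.log n ≤ √(n : ℝ)
  log_sq_le : 8 * Real.log n ^ (8 / 3 : ℝ) ≤ (n : ℝ) ^ (1 - α - β)

theorem eventually_largeEnough {α β p η₀ : ℝ} (hβ1 : β < 1 - α) (hp : 0 < p) (hη₀ : 0 < η₀) :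
    ∀ᶠ n : ℕ in atTop, LargeEnough α β p η₀ n := by
  have hlog : Tendsto (fun n : ℕ => Real.log n) atTop atTop :=
    Real.tendsto_log_atTop.comp tendsto_natCast_atTop_atTop
  have h2 : Tendsto (fun n : ℕ => Real.log n ^ (-1 / 3 : ℝ)) atTop (𝓝 0) := by
    have := (tendsto_rpow_neg_atTop (y := 1 / 3) (by norm_num)).comp hlog
    refine this.congr fun n => ?_
    norm_num [Function.comp]
  have h3 : Tendsto (fun n : ℕ => p ^ (1 / α) * Real.log n ^ (2 / 3 : ℝ)) atTop atTop :=
    ((tendsto_rpow_atTop (by norm_num)).comp hlog).const_mul_atTop (Real.rpow_pos_of_pos hp _)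
  have h4 : Tendsto (fun n : ℕ => Real.log n ^ (1 / 6 : ℝ)) atTop atTop :=
    (tendsto_rpow_atTop (by norm_num)).comp hlog
  have h5 : ∀ᶠ n : ℕ in atTop, ‖Real.log n ^ (1 : ℝ)‖ ≤ 1 * ‖(n : ℝ) ^ (1 / 2 : ℝ)‖ :=
    tendsto_natCast_atTop_atTop.eventually
      ((isLittleO_log_rpow_rpow_atTop 1 (by norm_num : (0 : ℝ) < 1 / 2)).def one_pos)
  have h6 : ∀ᶠ n : ℕ in atTop,
      ‖Real.log n ^ (8 / 3 : ℝ)‖ ≤ 1 / 8 * ‖(n : ℝ) ^ (1 - α - β)‖ :=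
    tendsto_natCast_atTop_atTop.eventually
      ((isLittleO_log_rpow_rpow_atTop (8 / 3) (by linarith : (0 : ℝ) < 1 - α - β)).def
        (by norm_num))
  filter_upwards [hlog.eventually_ge_atTop 10, h2.eventually_le_const hη₀,
    h3.eventually_ge_atTop 6, h4.eventually_ge_atTop (1 / (1 - α)), h5, h6]
    with n g1 g2 g3 g4 g5 g6
  refine ⟨g1, g2, g3, g4, ?_, ?_⟩
  · rw [Real.rpow_one, one_mul, Real.norm_of_nonneg (by linarith),
      Real.norm_of_nonneg (by positivity), ← Real.sqrt_eq_rpow] at g5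
    exact g5
  · have : 0 ≤ Real.log n := by linarith
    rw [Real.norm_of_nonneg (by positivity), Real.norm_of_nonneg (by positivity)] at g6
    linarith

/-- The factor `7 = 1 + 2 + 2 + 2` collects the four error terms of `error_le`. -/
theorem exp_bound_le {L : ℝ} (hL : 10 ≤ L) : 7 * Real.exp (4 * L - L ^ 2) ≤
    Real.exp (-(1 / 2) * L ^ 2) := by
  have h7 : (7 : ℝ) ≤ Real.exp 2 := by
    have := Real.exp_one_gt_d9
    have h2 : Real.exp 2 = Real.exp 1 * Real.exp 1 := by rw [← Real.exp_add]; norm_num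
    rw [h2]
    nlinarith
  calc 7 * Real.exp (4 * L - L ^ 2) ≤ Real.exp 2 * Real.exp (4 * L - L ^ 2) := by gcongr
    _ = Real.exp (2 + (4 * L - L ^ 2)) := (Real.exp_add _ _).symm
    _ ≤ _ := Real.exp_le_exp.mpr (by nlinarith)

/-- The total of the error probabilities. -/
theorem error_le {n L K : ℝ} (hn : 0 < n) (hL : L = Real.log n) (hL10 : 10 ≤ L)
    (hLn : L ≤ √n) (hK : L ^ 2 ≤ K) {T : ℕ} (hT1 : n * L ^ 2 ≤ T) (hT2 : T ≤ n * L ^ 2 + 1) :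
    n * Real.exp (-(T / n)) +
        T * (T * (2 * Real.exp (-(1 / √n * (6 * √n * L ^ 2)) + T * (1 / √n / n + (1 / √n) ^ 2)))) +
        2 * Real.exp (-(L / √n * (2 * √n * L)) + (L / √n) ^ 2 * n) + n * (2 * Real.exp (-K)) ≤
      Real.exp (-(1 / 2) * L ^ 2) := by
  have hs : 0 < √n := Real.sqrt_pos.mpr hn
  have hss : √n ^ 2 = n := Real.sq_sqrt hn.le
  have hnL : n = Real.exp L := by rw [hL, Real.exp_log hn]
  have hs1 : 1 ≤ √n := by linarith
  have hn10 : 10 ≤ n := by nlinarith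
  refine le_trans ?_ (exp_bound_le hL10)
  have e1 : n * Real.exp (-(T / n)) ≤ Real.exp (4 * L - L ^ 2) := by
    have h1 : L ^ 2 ≤ T / n := by rw [le_div_iff₀ hn]; linarith
    calc n * Real.exp (-(T / n)) = Real.exp (L + -(T / n)) := by
          rw [Real.exp_add, ← hnL]
      _ ≤ _ := Real.exp_le_exp.mpr (by linarith)
  -- With `l = 1 / √n` the gain is `l Δ = 6 L ^ 2`, while drift and variance over `T ≤ 2 n L ^ 2`
  -- steps cost at most `4 L ^ 2`. The union over pairs of times costs `T ^ 2 ≤ e ^ (6 L)`.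
  have e2 : T * (T * (2 * Real.exp (-(1 / √n * (6 * √n * L ^ 2)) +
      T * (1 / √n / n + (1 / √n) ^ 2)))) ≤ 2 * Real.exp (4 * L - L ^ 2) := by
    have h1 : (T : ℝ) ≤ 2 * (n * L ^ 2) := by
      have : 1 ≤ n * L ^ 2 := by nlinarith
      linarith
    have h2 : (T : ℝ) ≤ n ^ 3 := by
      have h3 : L ^ 2 ≤ n := by rw [← hss]; gcongr
      have h4 : n * L ^ 2 ≤ n * n := by gcongr
      have h5 : 2 * (n * n) ≤ n * (n * n) := by gcongr; linarith
      calc (T : ℝ) ≤ 2 * (n * n) := by linarith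
        _ ≤ n * (n * n) := h5
        _ = n ^ 3 := by ring
    have h3 : T * (1 / √n / n + (1 / √n) ^ 2) ≤ 4 * L ^ 2 := by
      have h4 : 1 / √n / n ≤ 1 / n := by
        gcongr
        exact (div_le_one hs).mpr hs1
      have h5 : (1 / √n) ^ 2 = 1 / n := by rw [div_pow, hss, one_pow]
      rw [h5]
      calc T * (1 / √n / n + 1 / n) ≤ 2 * (n * L ^ 2) * (1 / n + 1 / n) := by gcongr
        _ = 4 * L ^ 2 := by field_simp; ring
    have h4 : 1 / √n * (6 * √n * L ^ 2) = 6 * L ^ 2 := by field_simp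
    have h5 : n ^ 3 = Real.exp (3 * L) := by
      rw [hnL, ← Real.exp_nat_mul]; norm_num
    calc _ ≤ n ^ 3 * (n ^ 3 * (2 * Real.exp (-(6 * L ^ 2) + 4 * L ^ 2))) := by
          rw [h4]; gcongr
      _ = 2 * Real.exp (3 * L + (3 * L + (-(6 * L ^ 2) + 4 * L ^ 2))) := by
          rw [h5, Real.exp_add (3 * L) (3 * L + _),
            Real.exp_add (3 * L) (-(6 * L ^ 2) + 4 * L ^ 2)]
          ring
      _ ≤ _ := by
          gcongr
          nlinarith
  have e3 : 2 * Real.exp (-(L / √n * (2 * √n * L)) + (L / √n) ^ 2 * n) ≤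
      2 * Real.exp (4 * L - L ^ 2) := by
    have h1 : L / √n * (2 * √n * L) = 2 * L ^ 2 := by field_simp
    have h2 : (L / √n) ^ 2 * n = L ^ 2 := by rw [div_pow, hss]; field_simp
    rw [h1, h2]
    gcongr
    linarith
  have e4 : n * (2 * Real.exp (-K)) ≤ 2 * Real.exp (4 * L - L ^ 2) := by
    calc n * (2 * Real.exp (-K)) = 2 * Real.exp (L + -K) := by
          rw [Real.exp_add, ← hnL]; ring
      _ ≤ _ := by
          gcongr
          linarith
  linarith

/-- The finite-time bound with `T = ⌈n L ^ 2⌉`, `Δ = 6 √n L ^ 2`, `u = 2 √n L`, `l = 1 / √n` and `l'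
= L / √n`. The work is to check its hypotheses from the range of `k`. -/
theorem stationary_deviation_le {α β : ℝ} (hα0 : 0 < α) (hα1 : α < 1) (hβ0 : 0 < β)
    {p : unitInterval} (hp : 0 < (p : ℝ)) {η₀ : ℝ} (hη1 : η₀ ≤ α / 4)
    (hη2 : (8 / α + 1) * η₀ ≤ 1 - α / (α + 1)) (hη3 : (1 / α + 3) * η₀ ≤ α / (α + 1))
    {m n k : ℕ} (hm : 1 ≤ m) (hn : LargeEnough α β p η₀ n)
    (hk1 : (n : ℝ) ^ (1 - α - β) * Real.log n ^ (1 / 2 : ℝ) ≤ k)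
    (hk2 : (k : ℝ) ≤ (n : ℝ) ^ (1 - α / 2 - β) * Real.log n ^ (-2 * α - 1))
    {π : Measure (State n m)} (hπ : IsStationary α β p π) :
    π {s | ¬ |(numDegreeGE s.graph k : ℝ) -
        α / (α + 1) * (p * (n : ℝ) ^ (1 - β) / k) ^ (1 / α)| ≤
          (8 / α + 5) * (Real.log n ^ (-1 / 3 : ℝ) * (p * (n : ℝ) ^ (1 - β) / k) ^ (1 / α))} ≤
      ENNReal.ofReal (Real.exp (-(1 / 2) * Real.log n ^ 2)) := by
  obtain ⟨g1, g2, g3, g4, g5, g6⟩ := hn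
  set L := Real.log n with hL
  set η := L ^ (-1 / 3 : ℝ) with hη
  set x := (p * (n : ℝ) ^ (1 - β) / k) ^ (1 / α) with hx
  have hn1 : 1 ≤ n := by
    rcases Nat.eq_zero_or_pos n with h | h
    · rw [hL, h] at g1
      norm_num at g1
    · exact h
  have : NeZero n := ⟨by omega⟩
  have hL0 : 0 < L := by linarith
  have hL1 : 1 ≤ L := by linarith
  have hn0 : (0 : ℝ) < n := by exact_mod_cast hn1
  have hn1' : (1 : ℝ) ≤ n := by exact_mod_cast hn1
  have hs : 0 < √(n : ℝ) := Real.sqrt_pos.mpr hn0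
  have hs1 : 1 ≤ √(n : ℝ) := by linarith
  have hk0 : (0 : ℝ) < k := lt_of_lt_of_le (by positivity) hk1
  have hη0 : 0 < η := by positivity
  have hx0 : 0 < x := by positivity
  have hkx : (k : ℝ) * x ^ α = p * (n : ℝ) ^ (1 - β) := by
    rw [hx, ← Real.rpow_mul (by positivity), one_div_mul_cancel hα0.ne', Real.rpow_one]
    field_simp
  have hγ : (n : ℝ) ^ (1 - α - β) ≤ k := by
    refine le_trans ?_ hk1
    exact le_mul_of_one_le_right (by positivity) (Real.one_le_rpow hL1 (by norm_num))
  have hxn : x ≤ n := by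
    have h1 : p * (n : ℝ) ^ (1 - β) / k ≤ (n : ℝ) ^ α := by
      rw [div_le_iff₀ hk0]
      calc p * (n : ℝ) ^ (1 - β) ≤ 1 * (n : ℝ) ^ (1 - β) := by gcongr; exact p.2.2
        _ = (n : ℝ) ^ α * (n : ℝ) ^ (1 - α - β) := by
            rw [one_mul, ← Real.rpow_add hn0]; congr 1; ring
        _ ≤ _ := by gcongr
    calc x ≤ ((n : ℝ) ^ α) ^ (1 / α) := Real.rpow_le_rpow (by positivity) h1 (by positivity)
      _ = n := by rw [← Real.rpow_mul hn0.le, mul_one_div_cancel hα0.ne', Real.rpow_one]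
  -- The upper bound on `k` gives the exponent `(2 α + 1) / α = 2 + 1 / α ≥ 3` of `L`.
  have hxl : p ^ (1 / α) * (√(n : ℝ) * L ^ (3 : ℝ)) ≤ x := by
    have h1 : p * ((n : ℝ) ^ (α / 2) * L ^ (2 * α + 1)) ≤ p * (n : ℝ) ^ (1 - β) / k := by
      rw [le_div_iff₀ hk0]
      calc p * ((n : ℝ) ^ (α / 2) * L ^ (2 * α + 1)) * k
          ≤ p * ((n : ℝ) ^ (α / 2) * L ^ (2 * α + 1)) *
            ((n : ℝ) ^ (1 - α / 2 - β) * L ^ (-2 * α - 1)) := by gcongr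
        _ = p * (((n : ℝ) ^ (α / 2) * (n : ℝ) ^ (1 - α / 2 - β)) *
            (L ^ (2 * α + 1) * L ^ (-2 * α - 1))) := by ring
        _ = _ := by
            rw [← Real.rpow_add hn0, ← Real.rpow_add hL0,
              show 2 * α + 1 + (-2 * α - 1) = 0 by ring, Real.rpow_zero, mul_one,
              show α / 2 + (1 - α / 2 - β) = 1 - β by ring]
    calc p ^ (1 / α) * (√(n : ℝ) * L ^ (3 : ℝ))
        ≤ (p : ℝ) ^ (1 / α) * (√(n : ℝ) * L ^ ((2 * α + 1) * (1 / α))) := by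
          gcongr
          have h2 : 1 ≤ 1 / α := by rw [le_div_iff₀ hα0]; linarith
          have h3 : (2 * α + 1) * (1 / α) = 2 + 1 / α := by field_simp
          linarith
      _ = (p * ((n : ℝ) ^ (α / 2) * L ^ (2 * α + 1))) ^ (1 / α) := by
          rw [Real.mul_rpow hp.le (by positivity), Real.mul_rpow (by positivity) (by positivity),
            ← Real.rpow_mul hn0.le, ← Real.rpow_mul hL0.le, Real.sqrt_eq_rpow]
          congr 3
          field_simp
      _ ≤ x := Real.rpow_le_rpow (by positivity) h1 (by positivity)
  -- Here `η L ^ 3 = L ^ (2 / 3) L ^ 2`, and the spare power of `L` beats `6 p ^ (-1 / α)`.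
  have hΔ : 6 * √(n : ℝ) * L ^ 2 ≤ η * x := by
    calc 6 * √(n : ℝ) * L ^ 2 ≤ (p ^ (1 / α) * L ^ (2 / 3 : ℝ)) * √(n : ℝ) * L ^ 2 := by gcongr
      _ = η * (p ^ (1 / α) * (√(n : ℝ) * L ^ (3 : ℝ))) := by
          have h1 : L ^ (2 / 3 : ℝ) * L ^ 2 = η * L ^ (3 : ℝ) := by
            rw [hη, ← Real.rpow_natCast L 2, ← Real.rpow_add hL0, ← Real.rpow_add hL0]
            norm_num
          calc _ = p ^ (1 / α) * √(n : ℝ) * (L ^ (2 / 3 : ℝ) * L ^ 2) := by ring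
            _ = _ := by rw [h1]; ring
      _ ≤ _ := by gcongr
  have hLs : √(n : ℝ) * L ≤ √(n : ℝ) * L ^ 2 := by
    gcongr
    nlinarith
  have h1s : 1 ≤ √(n : ℝ) * L := by nlinarith
  -- The factor `L ^ (1 / 2)` in the lower bound on `k` leaves `L ^ (1 / 6)` after multiplication by
  -- `η`, enough to dominate `1 / (1 - α)`.
  have hold : (n : ℝ) ^ (1 - α - β) / (1 - α) ≤ η * k := by
    calc (n : ℝ) ^ (1 - α - β) / (1 - α) = (n : ℝ) ^ (1 - α - β) * (1 / (1 - α)) := by ring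
      _ ≤ (n : ℝ) ^ (1 - α - β) * L ^ (1 / 6 : ℝ) := by gcongr
      _ = η * ((n : ℝ) ^ (1 - α - β) * L ^ (1 / 2 : ℝ)) := by
          have h1 : L ^ (1 / 6 : ℝ) = η * L ^ (1 / 2 : ℝ) := by
            rw [hη, ← Real.rpow_add hL0]; norm_num
          rw [h1]; ring
      _ ≤ _ := by gcongr
  have hK : L ^ 2 ≤ η ^ 2 * k / 8 := by
    have h1 : L ^ 2 = η ^ 2 * L ^ (8 / 3 : ℝ) := by
      rw [hη, ← Real.rpow_natCast, ← Real.rpow_natCast, ← Real.rpow_mul hL0.le,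
        ← Real.rpow_add hL0]
      norm_num
    have h2 : η ^ 2 * (8 * L ^ (8 / 3 : ℝ)) ≤ η ^ 2 * k := by
      have := g6.trans hγ
      gcongr
    linarith
  refine measure_le_of_isStationary hπ ⌈(n : ℝ) * L ^ 2⌉₊ (measurableSet_graph fun G =>
    ¬ |(numDegreeGE G k : ℝ) - α / (α + 1) * x| ≤ (8 / α + 5) * (η * x)) fun s => ?_
  refine (pathLaw_deviation_le hα0 hα1 hβ0.le p hm hn1 hη0 (g2.trans hη1) hx0 hkx
    (Δ := 6 * √(n : ℝ) * L ^ 2) (by positivity) hΔ hold hxn (by linarith) ?_ ?_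
    (u := 2 * √(n : ℝ) * L) (l := 1 / √(n : ℝ)) (l' := L / √(n : ℝ)) (by linarith) (by positivity)
    ((div_le_one hs).mpr hs1) (by positivity) ((div_le_one hs).mpr g5) s _).trans
    (ENNReal.ofReal_le_ofReal ?_)
  · exact (mul_le_mul_of_nonneg_left g2 (by positivity)).trans hη2
  · exact (mul_le_mul_of_nonneg_left g2 (by positivity)).trans hη3
  · exact error_le hn0 hL g1 g5 hK (Nat.le_ceil _) (Nat.ceil_lt_add_one (by positivity)).le

end Asymptotics

end GeoP

theorem theorem3p1 (α β : ℝ) (hα0 : 0 < α) (hα1 : α < 1) (hβ0 : 0 < β) (hβ1 : β < 1 - α)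
    (p : unitInterval) (hp : 0 < p) :
    (∀ m n : ℕ, 1 ≤ m → 1 ≤ n → ∃! π : Measure (GeoP.State n m), GeoP.IsStationary α β p π) ∧
    ∃ C c : ℝ, 0 < C ∧ 0 < c ∧ ∃ n₀ : ℕ, ∀ m n k : ℕ, 1 ≤ m → n₀ ≤ n →
      (n : ℝ) ^ (1 - α - β) * Real.log n ^ (1 / 2 : ℝ) ≤ k →
      (k : ℝ) ≤ (n : ℝ) ^ (1 - α / 2 - β) * Real.log n ^ (-2 * α - 1) →
      ∀ π : Measure (GeoP.State n m), GeoP.IsStationary α β p π →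
        1 - Real.exp (-c * Real.log n ^ 2) ≤
          π.real {s | |(GeoP.numDegreeGE s.graph k : ℝ) -
              α / (α + 1) * (p : ℝ) ^ (1 / α) * (n : ℝ) ^ ((1 - β) / α) * (k : ℝ) ^ (-1 / α)| ≤
            C * Real.log n ^ (-1 / 3 : ℝ) *
              (α / (α + 1) * (p : ℝ) ^ (1 / α) * (n : ℝ) ^ ((1 - β) / α) *
                (k : ℝ) ^ (-1 / α))} := by
  refine ⟨fun m n _ hn => ?_, ?_⟩
  · have : NeZero n := ⟨by omega⟩
    exact GeoP.existsUnique_isStationary α β p m n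
  have hp' : 0 < (p : ℝ) := hp
  have hκ : 0 < α / (α + 1) := by positivity
  have hκ1 : 0 < 1 - α / (α + 1) := by
    rw [sub_pos, div_lt_one (by linarith)]; linarith
  have h1 : 0 < 8 / α + 1 := by positivity
  have h3 : 0 < 1 / α + 3 := by positivity
  -- The three conditions on `η` in `pathLaw_deviation_le` that depend on `α` alone.
  set η₀ := min (α / 4) (min ((1 - α / (α + 1)) / (8 / α + 1)) ((α / (α + 1)) / (1 / α + 3)))
  have hη₀ : 0 < η₀ := lt_min (by positivity) (lt_min (div_pos hκ1 h1) (div_pos hκ h3))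
  have hη1 : η₀ ≤ α / 4 := min_le_left _ _
  have hη2 : (8 / α + 1) * η₀ ≤ 1 - α / (α + 1) := by
    rw [← le_div_iff₀' h1]
    exact (min_le_right _ _).trans (min_le_left _ _)
  have hη3 : (1 / α + 3) * η₀ ≤ α / (α + 1) := by
    rw [← le_div_iff₀' h3]
    exact (min_le_right _ _).trans (min_le_right _ _)
  obtain ⟨n₀, hn₀⟩ := Filter.eventually_atTop.mp
    (GeoP.eventually_largeEnough (α := α) (β := β) hβ1 hp' hη₀)
  -- The factor `(α + 1) / α` converts an error relative to `x` into one relative to `α / (α + 1) *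
  -- x`.
  refine ⟨(8 / α + 5) * ((α + 1) / α), 1 / 2, by positivity, by norm_num, n₀,
    fun m n k hm hn hk1 hk2 π hπ => ?_⟩
  have hdev := GeoP.stationary_deviation_le hα0 hα1 hβ0 hp' hη1 hη2 hη3 hm (hn₀ n hn) hk1 hk2 hπ
  have : IsProbabilityMeasure π := hπ.1
  set A := {s : GeoP.State n m | |(GeoP.numDegreeGE s.graph k : ℝ) -
        α / (α + 1) * (p * (n : ℝ) ^ (1 - β) / k) ^ (1 / α)| ≤
          (8 / α + 5) * (Real.log n ^ (-1 / 3 : ℝ) * (p * (n : ℝ) ^ (1 - β) / k) ^ (1 / α))}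
    with hA
  have hAm : MeasurableSet A := GeoP.measurableSet_graph fun G =>
    |(GeoP.numDegreeGE G k : ℝ) - α / (α + 1) * (p * (n : ℝ) ^ (1 - β) / k) ^ (1 / α)| ≤
      (8 / α + 5) * (Real.log n ^ (-1 / 3 : ℝ) * (p * (n : ℝ) ^ (1 - β) / k) ^ (1 / α))
  have hx : (p * (n : ℝ) ^ (1 - β) / k) ^ (1 / α) =
      (p : ℝ) ^ (1 / α) * (n : ℝ) ^ ((1 - β) / α) * (k : ℝ) ^ (-1 / α) := by
    have h4 : (0 : ℝ) ≤ n := Nat.cast_nonneg n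
    have h5 : (0 : ℝ) ≤ k := Nat.cast_nonneg k
    rw [Real.div_rpow (by positivity) h5, Real.mul_rpow hp'.le (by positivity),
      ← Real.rpow_mul h4, neg_div, Real.rpow_neg h5, mul_one_div, div_eq_mul_inv]
  have hc : π.real Aᶜ ≤ Real.exp (-(1 / 2) * Real.log n ^ 2) :=
    ENNReal.toReal_le_of_le_ofReal (Real.exp_pos _).le hdev
  rw [probReal_compl_eq_one_sub hAm] at hc
  have hsub : A ⊆ {s : GeoP.State n m | |(GeoP.numDegreeGE s.graph k : ℝ) -
        α / (α + 1) * (p : ℝ) ^ (1 / α) * (n : ℝ) ^ ((1 - β) / α) * (k : ℝ) ^ (-1 / α)| ≤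
      (8 / α + 5) * ((α + 1) / α) * Real.log n ^ (-1 / 3 : ℝ) *
        (α / (α + 1) * (p : ℝ) ^ (1 / α) * (n : ℝ) ^ ((1 - β) / α) * (k : ℝ) ^ (-1 / α))} := by
    intro s hs
    have hs' := hs
    rw [hA, Set.mem_ofPred_eq, hx] at hs'
    rw [Set.mem_ofPred_eq]
    refine le_trans (le_of_eq ?_) (hs'.trans (le_of_eq ?_))
    · congr 2
      ring
    · have h6 : (α + 1) / α * (α / (α + 1)) = 1 := by field_simp
      calc _ = (8 / α + 5) * Real.log n ^ (-1 / 3 : ℝ) * ((α + 1) / α * (α / (α + 1))) *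
            ((p : ℝ) ^ (1 / α) * (n : ℝ) ^ ((1 - β) / α) * (k : ℝ) ^ (-1 / α)) := by
              rw [h6]; ring
        _ = _ := by ring
  linarith [measureReal_mono (μ := π) hsub]
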